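/- Let $R$ be a commutative $\mathbb C$-algebra (the algebra of functions of $t_o=(t_1=x,t_3,t_5,\dots)$) with commuting derivations $\partial_{t_1}=\partial,\partial_{t_3},\partial_{t_5},\dots$. For $f\in R$ let $f(t_o+s)\in R[[s_1,s_3,\dots]]$ be the formal Taylor expansion, and let $f(t_o-2[\lambda^{-1}]_o)\in R[[\lambda^{-1}]]$ be its value at $s_{2k+1}=-\frac{2}{2k+1}\lambda^{-2k-1}$. Put $\xi(t_o,\lambda)=\sum_{k\ge0}t_{2k+1}\lambda^{2k+1}$. An invertible $\tau\in R$ is a *CKP tau function* with *wave function* $\psi=w\,e^{\xi(t_o,\lambda)}$, $w=\sum_{j\ge0}w_j\lambda^{-j}$, if $$\psi(t_o,\lambda)=\Bigl(1+\tfrac1\lambda\partial_x\log\tfrac{\tau(t_o-2[\lambda^{-1}]_o)}{\tau(t_o)}\Bigr)^{1/2}\frac{\tau(t_o-2[\lambda^{-1}]_o)}{\tau(t_o)}\,e^{\xi(t_o,\lambda)}$$ (with the root $1+O(\lambda^{-1})$) and $\operatorname{Res}_\lambda\psi(t_o+s,\lambda)\,\psi(t_o,-\lambda)=0$. Let $\tau_{CW}$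 be such a tau function, $W=\sum_j w_j\partial^{-j}$ (so $\psi=W(e^{\xi})$) and $L=W\partial W^{-1}$. An *eigenfunction* of $L$ is $q\in R$ with $q_{t_m}=(L^m)_{\ge0}(q)$ for all odd $m\geq 1$; a *squared eigenfunction potential* $\Omega(q,r)$ of eigenfunctions $q,r$ is an element of $R$ with $\Omega(q,r)_{t_m}=\operatorname{Res}_\partial\bigl(\partial^{-1}r(L^m)_{\ge0}q\,\partial^{-1}\bigr)$ for all odd $m\geq 1$. Let $q_1,\dots,q_n$ be eigenfunctions of $L$ with potentials $\Omega_{ij}=\Omega(q_i,q_j)$ chosen such that $\Omega_{ij}=\Omega_{ji}$. Put $L^{\{0\}}=L$, $W^{\{0\}}=W$, $q_j^{\{0\}}=q_j$, $\Omega_{ij}^{\{0\}}=\Omega_{ij}$ and, for $k=1,\dots,n$, assuming that $\Omega_{kk}^{\{k-1\}}$ is invertible, $$T_k=T[q_k^{\{k-1\}}]=1-\bigl(\Omega_{kk}^{\{k-1\}}\bigr)^{-1}q_k^{\{k-1\}}\partial^{-1}q_k^{\{k-1\}},\qquad L^{\{k\}}=T_kL^{\{k-1\}}T_k^{-1},\qquad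 W^{\{k\}}=T_kW^{\{k-1\}},$$ $$q_j^{\{k\}}=T_k(q_j^{\{k-1\}})=q_j^{\{k-1\}}-\frac{q_k^{\{k-1\}}\Omega_{jk}^{\{k-1\}}}{\Omega_{kk}^{\{k-1\}}},\qquad \Omega_{ij}^{\{k\}}=\Omega_{ij}^{\{k-1\}}-\frac{\Omega_{ik}^{\{k-1\}}\Omega_{kj}^{\{k-1\}}}{\Omega_{kk}^{\{k-1\}}}.$$ Then: 1. For $0\le k\le n$, $L^{\{k\}}=\partial+\sum_{j\ge1}u^{\{k\}}_{j+1}\partial^{-j}$ is a CKP Lax operator, i.e. $(L^{\{k\}})^*=-L^{\{k\}}$ and $L^{\{k\}}_{t_m}=[((L^{\{k\}})^m)_{\ge0},L^{\{k\}}]$ for all odd $m\geq 1$; the $q_j^{\{k\}}$ are eigenfunctions of $L^{\{k\}}$; and the $\Omega^{\{k\}}_{ij}=\Omega^{\{k\}}_{ji}$ are potentials $\Omega(q_i^{\{k\}},q_j^{\{k\}})$ with respect to $L^{\{k\}}$. 2. $L^{\{n\}}=W^{\{n\}}\partial (W^{\{n\}})^{-1}$, and for every square root in $R$ of $\det(\Omega_{ij})_{1\le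 i,j\le n}$, $$\tau_{CW}^{\{n\}}=\sqrt{\det(\Omega_{ij})_{1\le i,j\le n}}\;\tau_{CW}$$ is a CKP tau function with wave function $\psi^{\{n\}}=W^{\{n\}}(e^{\xi})=T_n\cdots T_1(\psi)$. Every other CKP tau function with this wave function is $c\,\tau_{CW}^{\{n\}}$ with $c\in R$ invertible and $\partial_{t_m}c=0$ for all odd $m\geq 1$. -/

import Mathlib

noncomputable section

namespace CKP

/-! ## Pseudo-differential operators

`R` plays the role of the algebra of functions of `t_o = (t₁, t₃, t₅, …)`, and `D` that of the
derivation `∂ = ∂/∂x`. -/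

/-- A formal pseudo-differential operator `∑ i, coeff i ∂ ^ i` (finite order, `i` tending to `-∞`). -/
@[ext]
structure PseudoDiffOp (R : Type*) [CommRing R] where
  coeff : ℤ → R
  bdd : ∃ N : ℤ, ∀ i, N < i → coeff i = 0

namespace PseudoDiffOp

variable {R : Type*} [CommRing R] [Algebra ℂ R]

/-- The operator `a ∂ ^ i`. -/
def mono (a : R) (i : ℤ) : PseudoDiffOp R where
  coeff p := if p = i then a else 0
  bdd := ⟨i, fun p hp => if_neg (by omega)⟩

instance : Sub (PseudoDiffOp R) where
  sub A B :=
    { coeff := fun p => A.coeff p - B.coeff p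
      bdd := by
        obtain ⟨M, hM⟩ := A.bdd
        obtain ⟨N, hN⟩ := B.bdd
        exact ⟨max M N, fun i hi => by
          rw [hM i (lt_of_le_of_lt (le_max_left _ _) hi),
            hN i (lt_of_le_of_lt (le_max_right _ _) hi), sub_zero]⟩ }

instance : Neg (PseudoDiffOp R) where
  neg A :=
    { coeff := fun p => -A.coeff p
      bdd := by
        obtain ⟨M, hM⟩ := A.bdd
        exact ⟨M, fun i hi => by rw [hM i hi, neg_zero]⟩ }

/-- The `(m, k)` summand of the coefficient of `∂ ^ p` in `A ∘ B`, from the Leibniz rule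
`∂ ^ m ∘ b = ∑ k, (m choose k) b^(k) ∂ ^ (m - k)`, valid for every integer `m`. -/
def compTerm (D : Derivation ℂ R R) (A B : PseudoDiffOp R) (p : ℤ) (mk : ℤ × ℕ) : R :=
  Ring.choose mk.1 mk.2 • (A.coeff mk.1 * D^[mk.2] (B.coeff (p - mk.1 + mk.2)))

/-- Only finitely many summands of a coefficient of a composition are nonzero. -/
lemma compTerm_support (D : Derivation ℂ R R) (A B : PseudoDiffOp R) (p : ℤ) :
    (Function.support (compTerm D A B p)).Finite := by
  obtain ⟨M, hM⟩ := A.bdd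
  obtain ⟨N, hN⟩ := B.bdd
  refine ((Set.finite_Icc (p - N) M).prod (Set.finite_Iic (N - p + M).toNat)).subset ?_
  rintro ⟨m, k⟩ h
  have h1 : m ≤ M := by
    by_contra hc
    exact h (by simp [compTerm, hM m (by omega)])
  have h2 : p - m + k ≤ N := by
    by_contra hc
    exact h (by simp [compTerm, hN (p - m + k) (by omega)])
  simp only [Set.mem_prod, Set.mem_Icc, Set.mem_Iic]
  omega

/-- Composition `A ∘ B` of pseudo-differential operators. -/
def comp (D : Derivation ℂ R R) (A B : PseudoDiffOp R) : PseudoDiffOp R where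
  coeff p := ∑ᶠ mk : ℤ × ℕ, compTerm D A B p mk
  bdd := by
    obtain ⟨M, hM⟩ := A.bdd
    obtain ⟨N, hN⟩ := B.bdd
    refine ⟨M + N, fun p hp => finsum_eq_zero_of_forall_eq_zero ?_⟩
    rintro ⟨m, k⟩
    by_cases h : M < m
    · simp [compTerm, hM m h]
    · simp [compTerm, hN (p - m + k) (by omega)]

/-- `A ^ n`. -/
def pow (D : Derivation ℂ R R) (A : PseudoDiffOp R) : ℕ → PseudoDiffOp R
  | 0 => mono 1 0
  | n + 1 => comp D (pow D A n) A

/-- The formal adjoint `(∑ a_i ∂ ^ i)^* = ∑ (-∂) ^ i ∘ a_i`. The sum is finite since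
`A` has finite order. -/
def adjoint (D : Derivation ℂ R R) (A : PseudoDiffOp R) : PseudoDiffOp R where
  coeff p := ∑ᶠ k : ℕ,
    Int.negOnePow (p + k) • (Ring.choose (p + k : ℤ) k • D^[k] (A.coeff (p + k)))
  bdd := by
    obtain ⟨M, hM⟩ := A.bdd
    refine ⟨M, fun p hp => finsum_eq_zero_of_forall_eq_zero fun k => ?_⟩
    simp [hM (p + k) (by omega)]

/-- The differential part `A_{≥ 0}`. -/
def nonneg (A : PseudoDiffOp R) : PseudoDiffOp R where
  coeff p := if 0 ≤ p then A.coeff p else 0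
  bdd := by
    obtain ⟨M, hM⟩ := A.bdd
    exact ⟨M, fun p hp => by simp [hM p hp]⟩

/-- The action `A_{≥ 0}(f)` of the differential part of `A` on a function (a finite sum). -/
def applyNonneg (D : Derivation ℂ R R) (A : PseudoDiffOp R) (f : R) : R :=
  ∑ᶠ i : ℕ, A.coeff i * D^[i] f

/-- Differentiation of the coefficients of an operator with respect to a time. -/
def timeDeriv (δ : Derivation ℂ R R) (A : PseudoDiffOp R) : PseudoDiffOp R where
  coeff p := δ (A.coeff p)
  bdd := by
    obtain ⟨M, hM⟩ := A.bdd
    exact ⟨M, fun p hp => by rw [hM p hp, map_zero]⟩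

/-- The operator `W = ∑_{j ≥ 0} w_j ∂ ^ (-j)` with symbol `w(λ) = ∑_j w_j λ ^ (-j)`; here and
below the variable of a power series stands for `λ⁻¹`. -/
def ofSeries (w : PowerSeries R) : PseudoDiffOp R where
  coeff p := if p ≤ 0 then PowerSeries.coeff (-p).toNat w else 0
  bdd := ⟨0, fun p hp => if_neg (by omega)⟩

end PseudoDiffOp

open PseudoDiffOp

variable {R : Type*} [CommRing R] [Algebra ℂ R]

/-! ## Taylor expansion and Miwa shifts

`d k` stands for `∂ / ∂ t_{2k+1}`; in particular `d 0 = ∂_x`. -/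

/-- The weight `∑ k, (2k+1) α_k` of the monomial `∏ k, t_{2k+1} ^ α_k`. -/
def weight (α : ℕ →₀ ℕ) : ℕ := α.sum fun k m => (2 * k + 1) * m

lemma le_weight (α : ℕ →₀ ℕ) (k : ℕ) : (2 * k + 1) * α k ≤ weight α := by
  by_cases h : k ∈ α.support
  · exact Finset.single_le_sum (f := fun k => (2 * k + 1) * α k)
      (fun _ _ => Nat.zero_le _) h
  · simp [Finsupp.notMem_support_iff.mp h]

lemma finite_weight (N : ℕ) : {α : ℕ →₀ ℕ | weight α = N}.Finite := by
  let f : ℕ →₀ ℕ := Finsupp.onFinset (Finset.range (N + 1))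
    (fun k => if k < N + 1 then N else 0) (fun k hk => by
      by_contra h
      simp_all)
  refine (Set.finite_Iic f).subset fun α hα => ?_
  intro k
  have h := le_weight α k
  rw [show weight α = N from hα] at h
  have hf : f k = if k < N + 1 then N else 0 := rfl
  rw [hf]
  split_ifs with hk
  · nlinarith [Nat.zero_le (k * α k)]
  · by_contra hc
    have : 1 ≤ α k := by omega
    nlinarith

/-- The finitely many multi-indices of weight `N`. -/
def ofWeight (N : ℕ) : Finset (ℕ →₀ ℕ) := (finite_weight N).toFinset

/-- `∏ k, α_k !`. -/
def multiFactorial (α : ℕ →₀ ℕ) : ℂ := α.prod fun _ m => (m.factorial : ℂ)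

/-- The mixed partial derivative `∏ k, (∂ / ∂ t_{2k+1}) ^ α_k` (used for commuting `d k`). -/
def partialDeriv (d : ℕ → Derivation ℂ R R) (α : ℕ →₀ ℕ) (f : R) : R :=
  (α.support.sort (· ≤ ·)).foldr (fun k g => (d k)^[α k] g) f

/-- The Taylor expansion `f(t_o + s) = ∑ α, (∂^α f)(t_o) s^α / α!` in formal variables
`s = (s₁, s₃, s₅, …)`. -/
def taylor (d : ℕ → Derivation ℂ R R) (f : R) : MvPowerSeries ℕ R :=
  fun α => (multiFactorial α)⁻¹ • partialDeriv d α f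

/-- `f(t_o - 2[λ⁻¹]_o)`, `[λ⁻¹]_o = (λ⁻¹, λ⁻³/3, λ⁻⁵/5, …)`, as a power series in `λ⁻¹`: the
Taylor expansion at `s_{2k+1} = -2 λ^{-(2k+1)} / (2k+1)`. -/
def miwaShift (d : ℕ → Derivation ℂ R R) (f : R) : PowerSeries R :=
  PowerSeries.mk fun N => ∑ α ∈ ofWeight N,
    (α.prod fun k m => (-2 / (2 * k + 1) : ℂ) ^ m) • MvPowerSeries.coeff α (taylor d f)

/-- Coefficientwise derivative of a power series in `λ⁻¹`. -/
def seriesDeriv (δ : Derivation ℂ R R) (f : PowerSeries R) : PowerSeries R :=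
  PowerSeries.mk fun N => δ (PowerSeries.coeff N f)

/-! ## Wave functions and tau functions

A wave function is written `ψ(t_o, λ) = w(t_o, λ) e^{ξ(t_o, λ)}` with `w` a power series in `λ⁻¹`
and `ξ(t_o, λ) = ∑ k, t_{2k+1} λ^{2k+1}`. -/

/-- The relation between tau function and wave function
`ψ = (1 + λ⁻¹ ∂_x log ρ)^{1/2} ρ e^ξ`, `ρ = τ(t_o - 2[λ⁻¹]_o) / τ(t_o)`, for an invertible `τ`.
The square root is the one of the form `1 + O(λ⁻¹)`; note that `ρ` is invertible. -/
def IsWaveOfTau (d : ℕ → Derivation ℂ R R) (τ : R) (w : PowerSeries R) : Prop :=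
  IsUnit τ ∧ ∃ G ρ : PowerSeries R,
    PowerSeries.C τ * ρ = miwaShift d τ ∧
    PowerSeries.constantCoeff G = 1 ∧
    G ^ 2 = 1 + PowerSeries.X * (Ring.inverse ρ * seriesDeriv (d 0) ρ) ∧
    w = G * ρ

/-- The coefficient of `λ^N` in `e^{ξ(s, λ)}`. -/
def expXi (R : Type*) [CommRing R] [Algebra ℂ R] (N : ℕ) : MvPowerSeries ℕ R :=
  fun α => if weight α = N then algebraMap ℂ R (multiFactorial α)⁻¹ else 0

/-- The coefficient of `λ^{-N}` in `w(t_o + s, λ) w(t_o, -λ)`. -/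
def waveProduct (d : ℕ → Derivation ℂ R R) (w : PowerSeries R) (N : ℕ) : MvPowerSeries ℕ R :=
  ∑ ij ∈ Finset.HasAntidiagonal.antidiagonal N, taylor d (PowerSeries.coeff ij.1 w) *
    MvPowerSeries.C ((-1) ^ ij.2 * PowerSeries.coeff ij.2 w)

/-- The bilinear equation `Res_λ ψ(t_o + s, λ) ψ(t_o, -λ) = 0`, as an identity of formal power
series in `s`. The residue is `∑ N, waveProduct (N + 1) * expXi N`; its coefficient at `s^α` is a
finite sum because `expXi N` only has terms of weight `N`. -/
def Bilinear (d : ℕ → Derivation ℂ R R) (w : PowerSeries R) : Prop :=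
  ∀ α : ℕ →₀ ℕ, ∑ᶠ N : ℕ, MvPowerSeries.coeff α (waveProduct d w (N + 1) * expXi R N) = 0

/-- `τ` is a CKP tau function, with wave function `ψ = w e^ξ`. -/
def IsCKPTau (d : ℕ → Derivation ℂ R R) (τ : R) (w : PowerSeries R) : Prop :=
  IsWaveOfTau d τ w ∧ Bilinear d w

/-! ## Lax operators, eigenfunctions, squared eigenfunction potentials -/

/-- `L = W ∂ W⁻¹`, for an invertible operator `W`. -/
def IsDressedBy (D : Derivation ℂ R R) (L W : PseudoDiffOp R) : Prop :=
  comp D L W = comp D W (mono 1 1)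

/-- `L = ∂ + ∑_{j ≥ 1} u_{j+1} ∂^{-j}` with `L^* = -L` and `L_{t_n} = [(L^n)_{≥0}, L]`,
`n = 1, 3, 5, …`. -/
structure IsCKPLax (d : ℕ → Derivation ℂ R R) (L : PseudoDiffOp R) : Prop where
  coeff_of_one_lt : ∀ i, 1 < i → L.coeff i = 0
  coeff_one : L.coeff 1 = 1
  coeff_zero : L.coeff 0 = 0
  adjoint_eq : adjoint (d 0) L = -L
  lax : ∀ k : ℕ, timeDeriv (d k) L =
    comp (d 0) (nonneg (pow (d 0) L (2 * k + 1))) L -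
      comp (d 0) L (nonneg (pow (d 0) L (2 * k + 1)))

/-- `q_{t_n} = (L^n)_{≥0}(q)`, `n = 1, 3, 5, …`. -/
def IsEigenfunction (d : ℕ → Derivation ℂ R R) (L : PseudoDiffOp R) (q : R) : Prop :=
  ∀ k : ℕ, d k q = applyNonneg (d 0) (pow (d 0) L (2 * k + 1)) q

/-- `Ω` is a squared eigenfunction potential `Ω(q, r)`:
`Ω_{t_n} = Res_∂ (∂⁻¹ r (L^n)_{≥0} q ∂⁻¹)`, `n = 1, 3, 5, …`. -/
def IsSEP (d : ℕ → Derivation ℂ R R) (L : PseudoDiffOp R) (q r Ω : R) : Prop :=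
  ∀ k : ℕ, d k Ω =
    (comp (d 0) (comp (d 0) (mono 1 (-1)) (mono r 0))
      (comp (d 0) (nonneg (pow (d 0) L (2 * k + 1))) (mono q (-1)))).coeff (-1)

/-! ## Chains of CKP Darboux transformations -/

/-- The operator `T[q] = 1 - Ω⁻¹ q ∂⁻¹ q`, with `Ω = Ω(q, q)` invertible. -/
def darbouxOp (D : Derivation ℂ R R) (q Ω : R) : PseudoDiffOp R :=
  mono 1 0 - comp D (mono (Ring.inverse Ω * q) (-1)) (mono q 0)

/-- Eigenfunctions `q_1, …, q_n` together with their potentials `Ω(q_i, q_j)`. -/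
structure EigenData (R : Type*) (n : ℕ) where
  q : Fin n → R
  Ω : Matrix (Fin n) (Fin n) R

/-- The effect of `T[q_p]` on eigenfunctions and potentials:
`q_j ↦ T[q_p](q_j) = q_j - Ω(q_p, q_p)⁻¹ q_p Ω(q_j, q_p)`, where `∂⁻¹ (q_p q_j)` is the chosen
potential `Ω(q_j, q_p)`, and
`Ω(q_i, q_j) ↦ Ω(q_i, q_j) - Ω(q_i, q_p) Ω(q_p, q_j) Ω(q_p, q_p)⁻¹`,
which fixes the integration constants of the new potentials. -/
def EigenData.step {n : ℕ} (E : EigenData R n) (p : Fin n) : EigenData R n where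
  q j := E.q j - Ring.inverse (E.Ω p p) * E.q p * E.Ω j p
  Ω := Matrix.of fun i j => E.Ω i j - E.Ω i p * E.Ω p j * Ring.inverse (E.Ω p p)

/-- The data `q_j^{k}`, `Ω_{ij}^{k}` after the first `k ≤ n` transformations of the chain; the
`k`-th transformation (counted from `0`) is `T[q_k^{k}]`. -/
def EigenData.chain {n : ℕ} (E : EigenData R n) : ℕ → EigenData R n
  | 0 => E
  | k + 1 => if h : k < n then (E.chain k).step ⟨k, h⟩ else E.chain k

/-- The operator `T[q_k^{k}]` of the `k`-th transformation of the chain. -/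
def EigenData.chainOp {n : ℕ} (D : Derivation ℂ R R) (E : EigenData R n) (k : Fin n) :
    PseudoDiffOp R :=
  darbouxOp D ((E.chain k).q k) ((E.chain k).Ω k k)

/-- The dressing operator `W^{k} = T[q_{k-1}^{k-1}] ⋯ T[q_0] W` after `k ≤ n` transformations;
the corresponding wave function is `ψ^{k} = W^{k}(e^ξ)`. -/
def EigenData.chainDressing {n : ℕ} (D : Derivation ℂ R R) (E : EigenData R n)
    (W : PseudoDiffOp R) : ℕ → PseudoDiffOp R
  | 0 => W
  | k + 1 => if h : k < n then comp D (E.chainOp D ⟨k, h⟩) (E.chainDressing D W k)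
      else E.chainDressing D W k

end CKP

end

/-!
# Chains of Darboux transformations of CKP tau functions

A wave function `W(e^ξ)` with `W = 1 + O(∂⁻¹)` satisfies the bilinear equation if and only if `W`
satisfies the Sato equations (`IsSato`): `W W^* = 1`, and the time derivatives of `W(e^ξ)` are given
by differential operators `B k`. Indeed, the Taylor coefficients of `W(e^ξ)` are values at `e^ξ` of
operators (`waveTaylor`), and the bilinear equation says that the products of these operators with
`W^*` have residue zero (`bilinear_iff`); as it may be differentiated in `x`, these products are
then differential operators. For `L = W ∂ W⁻¹` one finds `B k = (L ^ (2k+1))_{≥ 0}`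
(`IsSato.B_eq`), so that `L` is a CKP Lax operator and eigenfunctions and potentials may be
described by `B k` alone.

That a Darboux transformation `T = 1 - Ω⁻¹ q ∂⁻¹ q` preserves all this (`IsSato.darboux`,
`app_darbouxB`, `res_darbouxB`) is a computation with the rule
`∂⁻¹ ω' ∂⁻¹ = ω ∂⁻¹ - ∂⁻¹ ω`. It gives `T T^* = 1`, and, together with the skew-adjointness of `B`,
that `(T_t + T B) T^*` is a differential operator.

For the tau function, write `σ` for the transformation `F(t_o, λ) ↦ F(t_o - 2[λ⁻¹]_o, -λ)` of power
series in `λ⁻¹` (`miwaInv`), which is multiplicative and an involution. In terms of the square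
`f = τ²` the relation between tau function and wave function is `w² = P + ½ λ⁻¹ ∂_x P` with
`P = σ(f) / f` (`IsWaveOfSquare`); it is linear in `P`, and it implies `P σ(w) = w`. Let `χ` be the
symbol of `λ ∂⁻¹ q W`. The bilinear identities for `q` and `Ω = Ω(q, q)`, taken at the Miwa shift,
are the addition formulas `q + σ(q) = 2 σ(w) χ` and `σ(Ω) = Ω - 2 λ⁻¹ σ(χ) χ`
(`IsSato.add_miwaInv_eigenfunction`, `IsSato.miwaInv_potential`). Applying `σ` to the first one
yields `χ = P σ(χ)`. Hence the second one says that `P` becomes `P - 2 λ⁻¹ Ω⁻¹ χ²` when `f` is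
replaced by `Ω f`, and this matches the new wave function `w - Ω⁻¹ q λ⁻¹ χ`: a Darboux
transformation multiplies `τ²` by `Ω(q, q)` (`IsWaveOfSquare.darboux`).

After `n` steps `τ²` has been multiplied by the product of the pivots `Ω_{kk}^{k}`. The recursion
for the potentials is Gaussian elimination, so this product is `det Ω` (`EigenData.det_eq_prod`).
Conversely the wave function determines `P`, hence the ratio of the shifted tau function to the tau
function, and a quotient of two tau functions is invariant under the Miwa shift; its derivatives
vanish (`IsWaveOfTau.exists_eq_mul`).
-/

noncomputable section

namespace CKP

open PseudoDiffOp Finset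

variable {R : Type*} [CommRing R]

/-! ### The additive group of pseudo-differential operators -/

namespace PseudoDiffOp

instance : Zero (PseudoDiffOp R) := ⟨⟨fun _ => 0, 0, fun _ _ => rfl⟩⟩

instance : Add (PseudoDiffOp R) where
  add A B :=
    { coeff := fun p => A.coeff p + B.coeff p
      bdd := by
        obtain ⟨M, hM⟩ := A.bdd
        obtain ⟨N, hN⟩ := B.bdd
        exact ⟨max M N, fun i hi => by
          rw [hM i (lt_of_le_of_lt (le_max_left _ _) hi),
            hN i (lt_of_le_of_lt (le_max_right _ _) hi), add_zero]⟩ }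

@[simp] lemma coeff_zero' (p : ℤ) : (0 : PseudoDiffOp R).coeff p = 0 := rfl
@[simp] lemma coeff_add (A B : PseudoDiffOp R) (p : ℤ) :
    (A + B).coeff p = A.coeff p + B.coeff p := rfl
@[simp] lemma coeff_neg (A : PseudoDiffOp R) (p : ℤ) : (-A).coeff p = -A.coeff p := rfl
@[simp] lemma coeff_sub (A B : PseudoDiffOp R) (p : ℤ) :
    (A - B).coeff p = A.coeff p - B.coeff p := rfl

instance : AddCommGroup (PseudoDiffOp R) where
  add_assoc A B C := by ext; simp [add_assoc]
  zero_add A := by ext; simp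
  add_zero A := by ext; simp
  add_comm A B := by ext; simp [add_comm]
  neg_add_cancel A := by ext; simp
  sub_eq_add_neg A B := by ext; simp [sub_eq_add_neg]
  nsmul := nsmulRec
  zsmul := zsmulRec

/-- The coefficient of `∂ ^ p`, as an additive map. -/
def coeffHom (p : ℤ) : PseudoDiffOp R →+ R where
  toFun A := A.coeff p
  map_zero' := rfl
  map_add' _ _ := rfl

lemma coeff_sum {ι : Type*} (s : Finset ι) (f : ι → PseudoDiffOp R) (p : ℤ) :
    (∑ i ∈ s, f i).coeff p = ∑ i ∈ s, (f i).coeff p :=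
  map_sum (coeffHom p) f s

lemma coeff_mono (a : R) (i p : ℤ) : (mono a i).coeff p = if p = i then a else 0 := rfl

/-- The order of `A` is at most `N`. -/
def OrdLE (A : PseudoDiffOp R) (N : ℤ) : Prop := ∀ i, N < i → A.coeff i = 0

lemma OrdLE.mono {A : PseudoDiffOp R} {M N : ℤ} (h : OrdLE A M) (hMN : M ≤ N) : OrdLE A N :=
  fun i hi => h i (hMN.trans_lt hi)

lemma OrdLE.sub {A B : PseudoDiffOp R} {N : ℤ} (hA : OrdLE A N) (hB : OrdLE B N) :
    OrdLE (A - B) N := fun i hi => by simp [hA i hi, hB i hi]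

lemma OrdLE.neg {A : PseudoDiffOp R} {N : ℤ} (hA : OrdLE A N) :
    OrdLE (-A) N := fun i hi => by simp [hA i hi]

lemma ordLE_mono (a : R) (i : ℤ) : OrdLE (PseudoDiffOp.mono a i) i :=
  fun p hp => if_neg (by omega)

/-- An additive functional which kills monomials of order at most `M` and operators of sufficiently
low order kills every operator of order at most `M`. -/
lemma addMonoidHom_eq_zero {G : Type*} [AddCommGroup G] (F : PseudoDiffOp R →+ G) (M N : ℤ)
    (h1 : ∀ a i, i ≤ M → F (PseudoDiffOp.mono a i) = 0) (h2 : ∀ A, OrdLE A N → F A = 0)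
    (A : PseudoDiffOp R) (hA : OrdLE A M) : F A = 0 := by
  have key : F (A - ∑ i ∈ Ioc N M, PseudoDiffOp.mono (A.coeff i) i) = 0 := by
    apply h2
    intro p hp
    rw [coeff_sub, coeff_sum]
    simp only [coeff_mono]
    rw [Finset.sum_ite_eq]
    split_ifs with h
    · simp
    · simp only [mem_Ioc, not_and, not_le] at h
      simp [hA p (h hp)]
  rw [map_sub, map_sum, Finset.sum_eq_zero, sub_zero] at key
  · exact key
  · intro i hi
    exact h1 _ _ (mem_Ioc.mp hi).2

/-- An additive endomorphism which kills monomials and raises orders by a bounded amount is zero. -/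
lemma addMonoidHom_end_eq_zero (F : PseudoDiffOp R →+ PseudoDiffOp R) (K : ℤ)
    (h1 : ∀ a i, F (PseudoDiffOp.mono a i) = 0) (h2 : ∀ A N, OrdLE A N → OrdLE (F A) (N + K))
    (A : PseudoDiffOp R) : F A = 0 := by
  obtain ⟨M, hM⟩ := A.bdd
  ext p
  refine addMonoidHom_eq_zero ((coeffHom p).comp F) M (p - K - 1) ?_ ?_ A hM
  · intro a i _
    simp [h1]
  · intro A hA
    exact h2 A _ hA p (by omega)

variable [Algebra ℂ R] (D : Derivation ℂ R R)

lemma coeff_comp (A B : PseudoDiffOp R) (p : ℤ) :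
    (comp D A B).coeff p = ∑ᶠ mk : ℤ × ℕ, compTerm D A B p mk := rfl

lemma iterate_add (k : ℕ) (a b : R) : D^[k] (a + b) = D^[k] a + D^[k] b :=
  iterate_map_add D k a b

lemma iterate_one (k : ℕ) : D^[k] (1 : R) = if k = 0 then 1 else 0 := by
  cases k with
  | zero => simp
  | succ k => simp [Function.iterate_succ_apply]

lemma comp_add_left (A A' B : PseudoDiffOp R) : comp D (A + A') B = comp D A B + comp D A' B := by
  ext p
  rw [coeff_add, coeff_comp, coeff_comp, coeff_comp,
    ← finsum_add_distrib (compTerm_support D A B p) (compTerm_support D A' B p)]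
  refine finsum_congr fun mk => ?_
  simp [compTerm, add_mul]

lemma comp_add_right (A B B' : PseudoDiffOp R) : comp D A (B + B') = comp D A B + comp D A B' := by
  ext p
  rw [coeff_add, coeff_comp, coeff_comp, coeff_comp,
    ← finsum_add_distrib (compTerm_support D A B p) (compTerm_support D A B' p)]
  refine finsum_congr fun mk => ?_
  simp [compTerm, mul_add]

lemma comp_ordLE {A B : PseudoDiffOp R} {M N : ℤ} (hA : OrdLE A M) (hB : OrdLE B N) :
    OrdLE (comp D A B) (M + N) := by
  intro p hp
  rw [coeff_comp]
  refine finsum_eq_zero_of_forall_eq_zero ?_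
  rintro ⟨m, k⟩
  by_cases h : M < m
  · simp [compTerm, hA m h]
  · simp [compTerm, hB (p - m + k) (by omega)]

/-- The leading coefficient of a composition. -/
lemma comp_coeff_top {A B : PseudoDiffOp R} {M N : ℤ} (hA : OrdLE A M) (hB : OrdLE B N) :
    (comp D A B).coeff (M + N) = A.coeff M * B.coeff N := by
  rw [coeff_comp, finsum_eq_single _ ((M, 0) : ℤ × ℕ)]
  · simp [compTerm]
  · rintro ⟨m, k⟩ hmk
    by_cases h : M < m
    · simp [compTerm, hA m h]
    · by_cases h' : m = M ∧ k = 0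
      · exact absurd (by ext <;> simp [h']) hmk
      · simp [compTerm, hB (M + N - m + k) (by omega)]

/-- Composition as a biadditive map. -/
def compHom : PseudoDiffOp R →+ PseudoDiffOp R →+ PseudoDiffOp R :=
  AddMonoidHom.mk' (fun A => AddMonoidHom.mk' (fun B => comp D A B) (comp_add_right D A))
    (fun A A' => by ext1 B; exact comp_add_left D A A' B)

@[simp] lemma compHom_apply (A B : PseudoDiffOp R) : compHom D A B = comp D A B := rfl

lemma coeff_mono_comp (a : R) (i : ℤ) (B : PseudoDiffOp R) (p : ℤ) :
    (comp D (PseudoDiffOp.mono a i) B).coeff p =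
      ∑ᶠ k : ℕ, Ring.choose i k • (a * D^[k] (B.coeff (p - i + k))) := by
  rw [coeff_comp]
  rw [← finsum_mem_univ, ← finsum_mem_inter_support]
  have : (fun k : ℕ => Ring.choose i k • (a * D^[k] (B.coeff (p - i + k)))) =
      fun k => compTerm D (PseudoDiffOp.mono a i) B p ((fun k => (i, k)) k) := by
    ext k; simp [compTerm, coeff_mono]
  rw [this, ← finsum_mem_univ (f := fun k : ℕ => compTerm D (PseudoDiffOp.mono a i) B p
    ((fun k => (i, k)) k)), ← finsum_mem_image (g := fun k : ℕ => ((i, k) : ℤ × ℕ))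
    (f := compTerm D (PseudoDiffOp.mono a i) B p) (fun x _ y _ h => by simpa using h),
    ← finsum_mem_inter_support (s := _ '' _)]
  refine finsum_congr fun ⟨m, k⟩ => finsum_congr_Prop ?_ fun _ => rfl
  simp only [Set.mem_inter_iff, Set.mem_univ, true_and, Set.image_univ, Set.mem_range,
    Prod.mk.injEq, Function.mem_support, eq_iff_iff]
  constructor
  · intro h
    refine ⟨⟨k, ?_, rfl⟩, h⟩
    by_contra hne
    exact h (by simp [compTerm, coeff_mono, Ne.symm hne])
  · exact fun h => h.2

lemma mono_comp_support (a : R) (i : ℤ) (B : PseudoDiffOp R) (p : ℤ) :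
    (Function.support fun k : ℕ =>
      Ring.choose i k • (a * D^[k] (B.coeff (p - i + k)))).Finite := by
  obtain ⟨N, hN⟩ := B.bdd
  refine (Set.finite_Iic (N - p + i).toNat).subset fun k hk => ?_
  by_contra hc
  simp only [Set.mem_Iic, not_le] at hc
  exact hk (by simp [hN (p - i + k) (by omega)])

lemma coeff_mono_zero_comp (a : R) (B : PseudoDiffOp R) (p : ℤ) :
    (comp D (PseudoDiffOp.mono a 0) B).coeff p = a * B.coeff p := by
  rw [coeff_mono_comp, finsum_eq_single _ 0]
  · simp
  · intro k hk
    rw [Ring.choose_zero_pos ℤ (Nat.pos_of_ne_zero hk), zero_smul]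

lemma coeff_dx_comp (B : PseudoDiffOp R) (p : ℤ) :
    (comp D (PseudoDiffOp.mono 1 1) B).coeff p = B.coeff (p - 1) + D (B.coeff p) := by
  rw [coeff_mono_comp, finsum_eq_sum_of_support_subset (s := {0, 1})]
  · simp
  · intro k hk
    by_contra hc
    have h2 : 1 < k := by
      simp only [coe_insert, coe_singleton, Set.mem_insert_iff, Set.mem_singleton_iff] at hc
      omega
    apply hk
    have : Ring.choose (1 : ℤ) k = 0 := by
      have := Ring.choose_natCast (R := ℤ) 1 k
      simp only [Nat.cast_one] at this
      rw [this, Nat.choose_eq_zero_of_lt h2]; simp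
    simp [this]

lemma coeff_comp_dpow (A : PseudoDiffOp R) (j p : ℤ) :
    (comp D A (PseudoDiffOp.mono 1 j)).coeff p = A.coeff (p - j) := by
  rw [coeff_comp, finsum_eq_single _ ((p - j, 0) : ℤ × ℕ)]
  · simp [compTerm, coeff_mono]
  · rintro ⟨m, k⟩ hmk
    simp only [compTerm, coeff_mono]
    cases k with
    | zero =>
      have : p - m ≠ j := fun h => hmk (by ext <;> simp; omega)
      simp [this]
    | succ k => split_ifs <;> simp [iterate_one]

lemma mono_comp_dx_comp (a : R) (i : ℤ) (B : PseudoDiffOp R) :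
    comp D (PseudoDiffOp.mono a (i + 1)) B =
      comp D (PseudoDiffOp.mono a i) (comp D (PseudoDiffOp.mono 1 1) B) := by
  ext p
  rw [coeff_mono_comp, coeff_mono_comp]
  simp only [coeff_dx_comp]
  obtain ⟨N, hN⟩ := B.bdd
  set K := (N - p + i).toNat + 3 with hK
  rw [finsum_eq_sum_of_support_subset (s := range (K + 1)), finsum_eq_sum_of_support_subset
    (s := range K)]
  · have e1 : ∀ k : ℕ, Ring.choose i k • (a * D^[k] (B.coeff (p - i + k - 1) +
        D (B.coeff (p - i + k)))) = Ring.choose i k • (a * D^[k] (B.coeff (p - (i + 1) + k))) +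
        Ring.choose i k • (a * D^[k + 1] (B.coeff (p - (i + 1) + (k + 1 : ℕ)))) := by
      intro k
      rw [iterate_add, Function.iterate_succ_apply, mul_add, smul_add]
      congr 4 <;> push_cast <;> ring_nf
    rw [sum_congr rfl fun k _ => e1 k, sum_add_distrib, sum_range_succ']
    have e2 : ∀ k : ℕ, Ring.choose (i + 1) (k + 1) = Ring.choose i k + Ring.choose i (k + 1) :=
      fun k => Ring.choose_succ_succ i k
    simp only [e2, add_smul, sum_add_distrib]
    have e3 := sum_range_succ' (fun k : ℕ => Ring.choose i k •
      (a * D^[k] (B.coeff (p - (i + 1) + k)))) K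
    rw [sum_range_succ] at e3
    rw [hN (p - (i + 1) + K) (by omega), iterate_map_zero, mul_zero, smul_zero, add_zero] at e3
    rw [e3]
    simp only [Ring.choose_zero_right]
    ring
  · intro k hk
    by_contra hc
    simp only [coe_range, Set.mem_Iio, not_lt] at hc
    exact hk (by simp [hN (p - i + k - 1) (by omega), hN (p - i + k) (by omega)])
  · intro k hk
    by_contra hc
    simp only [coe_range, Set.mem_Iio, not_lt] at hc
    exact hk (by simp [hN (p - (i + 1) + k) (by omega)])

lemma dx_comp_injective {A : PseudoDiffOp R} {i : ℤ}
    (h : comp D (PseudoDiffOp.mono 1 i) A = 0) : A = 0 := by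
  -- descend from the order of `A`, the leading coefficient of `∂ ^ i A` being that of `A`
  obtain ⟨M, hM⟩ := A.bdd
  have key : ∀ n : ℕ, OrdLE A (M - n) := by
    intro n
    induction n with
    | zero => exact fun p hp => hM p (by simpa using hp)
    | succ n ih =>
      intro p hp
      by_cases h1 : M - n < p
      · exact ih p h1
      · have h2 : p = M - n := by push_cast at hp; omega
        have := comp_coeff_top D (ordLE_mono (1 : R) i) ih
        rw [h] at this
        simpa [coeff_mono, h2] using this.symm
  ext p
  exact key (M - p + 1).toNat p (by omega)

lemma dpow_zero_comp (B : PseudoDiffOp R) : comp D (PseudoDiffOp.mono 1 0) B = B := by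
  ext p; simp [coeff_mono_zero_comp]

lemma dx_comp_dxi_comp (B : PseudoDiffOp R) :
    comp D (PseudoDiffOp.mono 1 1) (comp D (PseudoDiffOp.mono 1 (-1)) B) = B := by
  rw [← sub_eq_zero]
  apply dx_comp_injective D (i := -1)
  rw [← compHom_apply, map_sub, compHom_apply, compHom_apply, ← mono_comp_dx_comp]
  simp [dpow_zero_comp]

lemma comp_dpow_comp_dx (B C : PseudoDiffOp R) :
    comp D (comp D B (PseudoDiffOp.mono 1 1)) C = comp D B (comp D (PseudoDiffOp.mono 1 1) C) := by
  obtain ⟨N, hN⟩ := C.bdd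
  rw [← sub_eq_zero]
  refine addMonoidHom_end_eq_zero
    (((compHom D).flip C).comp ((compHom D).flip (PseudoDiffOp.mono 1 1)) -
      (compHom D).flip (comp D (PseudoDiffOp.mono 1 1) C)) (N + 1) ?_ ?_ B
  · intro a i
    have : comp D (PseudoDiffOp.mono a i) (PseudoDiffOp.mono 1 1) =
        PseudoDiffOp.mono a (i + 1) := by
      ext p
      rw [coeff_comp_dpow, coeff_mono, coeff_mono]
      congr 1
      simp only [eq_iff_iff]; omega
    simp [this, mono_comp_dx_comp]
  · intro A M hA
    refine OrdLE.sub ?_ ?_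
    · exact (comp_ordLE D (comp_ordLE D hA (ordLE_mono 1 1)) hN).mono (by omega)
    · exact (comp_ordLE D hA (comp_ordLE D (ordLE_mono 1 1) hN)).mono (by omega)

lemma coeff_timeDeriv (δ : Derivation ℂ R R) (A : PseudoDiffOp R) (p : ℤ) :
    (timeDeriv δ A).coeff p = δ (A.coeff p) := rfl

lemma iterate_comm {δ : Derivation ℂ R R} (h : ∀ f, δ (D f) = D (δ f)) (k : ℕ) (f : R) :
    δ (D^[k] f) = D^[k] (δ f) :=
  (Function.Commute.iterate_right (f := δ) (g := D) h k) f

lemma timeDeriv_comp {δ : Derivation ℂ R R} (h : ∀ f, δ (D f) = D (δ f)) (A B : PseudoDiffOp R) :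
    timeDeriv δ (comp D A B) = comp D (timeDeriv δ A) B + comp D A (timeDeriv δ B) := by
  ext p
  rw [coeff_timeDeriv, coeff_add, coeff_comp, coeff_comp, coeff_comp,
    ← finsum_add_distrib (compTerm_support D _ B p) (compTerm_support D A _ p)]
  have := AddMonoidHom.map_finsum (δ : R →+ R) (compTerm_support D A B p)
  refine Eq.trans this (finsum_congr fun mk => ?_)
  simp only [compTerm, coeff_timeDeriv, ← iterate_comm D h]
  change δ _ = _
  rw [map_zsmul, Derivation.leibniz, ← smul_add]
  congr 1
  simp only [smul_eq_mul]; ring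

lemma dx_comp_eq (B : PseudoDiffOp R) : comp D (PseudoDiffOp.mono 1 1) B =
    timeDeriv D B + comp D B (PseudoDiffOp.mono 1 1) := by
  ext p
  rw [coeff_dx_comp, coeff_add, coeff_comp_dpow, coeff_timeDeriv, add_comm]

lemma comp_comp_dx (B C : PseudoDiffOp R) :
    comp D (comp D B C) (PseudoDiffOp.mono 1 1) = comp D B (comp D C (PseudoDiffOp.mono 1 1)) := by
  ext p
  rw [coeff_comp_dpow, coeff_comp, coeff_comp]
  refine finsum_congr fun mk => ?_
  simp only [compTerm, coeff_comp_dpow]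
  rw [show p - 1 - mk.1 + mk.2 = p - mk.1 + mk.2 - 1 by ring]

lemma dx_comp_assoc (B C : PseudoDiffOp R) : comp D (comp D (PseudoDiffOp.mono 1 1) B) C =
    comp D (PseudoDiffOp.mono 1 1) (comp D B C) := by
  rw [dx_comp_eq, dx_comp_eq, comp_add_left, comp_dpow_comp_dx, dx_comp_eq D C, comp_add_right,
    comp_comp_dx, timeDeriv_comp D (fun _ => rfl), add_assoc]

lemma dpow_comp_assoc (i : ℤ) : ∀ B C : PseudoDiffOp R,
    comp D (comp D (PseudoDiffOp.mono 1 i) B) C =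
    comp D (PseudoDiffOp.mono 1 i) (comp D B C) := by
  induction i using Int.induction_on with
  | zero => intro B C; rw [dpow_zero_comp, dpow_zero_comp]
  | succ i ih =>
    intro B C
    rw [mono_comp_dx_comp, mono_comp_dx_comp, ih, dx_comp_assoc]
  | pred i ih =>
    intro B C
    have e : (-(i : ℤ)) = (-i - 1) + 1 := by ring
    rw [e] at ih
    have := ih (comp D (PseudoDiffOp.mono 1 (-1)) B) C
    rwa [mono_comp_dx_comp, mono_comp_dx_comp, ← dx_comp_assoc D _ C, dx_comp_dxi_comp] at this

lemma mono_comp (a : R) (i : ℤ) (B : PseudoDiffOp R) : comp D (PseudoDiffOp.mono a i) B =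
    comp D (PseudoDiffOp.mono a 0) (comp D (PseudoDiffOp.mono 1 i) B) := by
  ext p
  rw [coeff_mono_zero_comp, coeff_mono_comp, coeff_mono_comp]
  refine Eq.trans (finsum_congr fun k => ?_)
    (AddMonoidHom.map_finsum (AddMonoidHom.mulLeft a) (mono_comp_support D 1 i B p)).symm
  simp only [one_mul, AddMonoidHom.coe_mulLeft, mul_smul_comm]

lemma mono_zero_comp_assoc (a : R) (B C : PseudoDiffOp R) :
    comp D (comp D (PseudoDiffOp.mono a 0) B) C = comp D (PseudoDiffOp.mono a 0) (comp D B C) := by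
  ext p
  rw [coeff_mono_zero_comp, coeff_comp, coeff_comp]
  refine Eq.trans (finsum_congr fun mk => ?_)
    (AddMonoidHom.map_finsum (AddMonoidHom.mulLeft a) (compTerm_support D B C p)).symm
  simp only [compTerm, coeff_mono_zero_comp, mul_assoc, AddMonoidHom.coe_mulLeft, mul_smul_comm]

lemma comp_assoc (A B C : PseudoDiffOp R) : comp D (comp D A B) C = comp D A (comp D B C) := by
  obtain ⟨M, hM⟩ := B.bdd
  obtain ⟨N, hN⟩ := C.bdd
  rw [← sub_eq_zero]
  refine addMonoidHom_end_eq_zero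
    (((compHom D).flip C).comp ((compHom D).flip B) -
      (compHom D).flip (comp D B C)) (M + N) ?_ ?_ A
  · intro a i
    simp only [AddMonoidHom.sub_apply, AddMonoidHom.comp_apply, AddMonoidHom.flip_apply,
      compHom_apply]
    rw [mono_comp, mono_zero_comp_assoc, dpow_comp_assoc, ← mono_comp, sub_self]
  · intro A K hA
    refine OrdLE.sub ?_ ?_
    · exact (comp_ordLE D (comp_ordLE D hA hM) hN).mono (by omega)
    · exact (comp_ordLE D hA (comp_ordLE D hM hN)).mono (by omega)

end PseudoDiffOp

/-! ### The ring of pseudo-differential operators and the adjoint -/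

variable [Algebra ℂ R]

/-- Pseudo-differential operators with composition with respect to `∂ = D` as multiplication. -/
def Psi (_D : Derivation ℂ R R) : Type _ := PseudoDiffOp R

instance (D : Derivation ℂ R R) : AddCommGroup (Psi D) :=
  inferInstanceAs (AddCommGroup (PseudoDiffOp R))

instance (D : Derivation ℂ R R) : Ring (Psi D) where
  __ := (inferInstance : AddCommGroup (Psi D))
  mul := comp D
  one := mono 1 0
  left_distrib := comp_add_right D
  right_distrib := comp_add_left D
  zero_mul B := map_zero ((compHom D).flip B)
  mul_zero B := map_zero (compHom D B)
  mul_assoc := comp_assoc D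
  one_mul := dpow_zero_comp D
  mul_one A := by
    refine PseudoDiffOp.ext (funext fun p => ?_)
    exact (coeff_comp_dpow D A 0 p).trans (by rw [sub_zero])

namespace Psi

variable {D : Derivation ℂ R R}

/-- The coefficient of `∂ ^ p`. -/
def coeff (A : Psi D) (p : ℤ) : R := PseudoDiffOp.coeff A p

/-- The coefficient of `∂ ^ p` as an additive map. -/
def coeffHom (p : ℤ) : Psi D →+ R := PseudoDiffOp.coeffHom p

@[ext] lemma ext {A B : Psi D} (h : ∀ p, A.coeff p = B.coeff p) : A = B :=
  PseudoDiffOp.ext (funext h)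

@[simp] lemma coeffHom_apply (p : ℤ) (A : Psi D) : coeffHom p A = A.coeff p := rfl
@[simp] lemma coeff_zero (p : ℤ) : (0 : Psi D).coeff p = 0 := rfl
@[simp] lemma coeff_add (A B : Psi D) (p : ℤ) : (A + B).coeff p = A.coeff p + B.coeff p := rfl
@[simp] lemma coeff_neg (A : Psi D) (p : ℤ) : (-A).coeff p = -A.coeff p := rfl
@[simp] lemma coeff_sub (A B : Psi D) (p : ℤ) : (A - B).coeff p = A.coeff p - B.coeff p := rfl
lemma coeff_sum {ι : Type*} (s : Finset ι) (f : ι → Psi D) (p : ℤ) :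
    (∑ i ∈ s, f i).coeff p = ∑ i ∈ s, (f i).coeff p := map_sum (coeffHom p) f s
lemma coeff_nsmul (n : ℕ) (A : Psi D) (p : ℤ) : (n • A).coeff p = n • A.coeff p :=
  map_nsmul (coeffHom p) n A

variable (D) in
/-- The operator of multiplication by a function. -/
def fn : R →+* Psi D where
  toFun a := mono a 0
  map_one' := rfl
  map_mul' a b := by
    refine ext fun p => Eq.trans ?_ (coeff_mono_zero_comp D a (mono b 0) p).symm
    change (if _ then _ else _) = _ * (if _ then _ else _)
    simp
  map_zero' := ext fun p => ite_self _
  map_add' a b := ext fun p => by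
    change (if _ then _ else _) = (if _ then _ else _) + (if _ then _ else _)
    split_ifs <;> simp

variable (D) in
/-- The operator `∂ ^ j`. -/
def dpow (j : ℤ) : Psi D := mono 1 j

lemma coeff_dpow (j p : ℤ) : (dpow D j).coeff p = if p = j then 1 else 0 := rfl
lemma coeff_fn (a : R) (p : ℤ) : (fn D a).coeff p = if p = 0 then a else 0 := rfl
lemma coeff_one (p : ℤ) : (1 : Psi D).coeff p = if p = 0 then 1 else 0 := rfl
@[simp] lemma coeff_fn_mul (a : R) (A : Psi D) (p : ℤ) : (fn D a * A).coeff p = a * A.coeff p :=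
  coeff_mono_zero_comp D a A p
@[simp] lemma coeff_mul_dpow (A : Psi D) (j p : ℤ) : (A * dpow D j).coeff p = A.coeff (p - j) :=
  coeff_comp_dpow D A j p
lemma coeff_dpow_one_mul (A : Psi D) (p : ℤ) :
    (dpow D 1 * A).coeff p = A.coeff (p - 1) + D (A.coeff p) :=
  coeff_dx_comp D A p

@[simp] lemma dpow_zero : dpow D 0 = 1 := rfl

lemma dpow_mul_dpow (i j : ℤ) : dpow D i * dpow D j = dpow D (i + j) := by
  ext p
  simp only [coeff_mul_dpow, coeff_dpow]
  congr 1
  simp only [eq_iff_iff]; omega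

lemma dpow_mul_dpow_assoc (i j : ℤ) (A : Psi D) :
    dpow D i * (dpow D j * A) = dpow D (i + j) * A := by
  rw [← mul_assoc, dpow_mul_dpow]

lemma mono_eq (a : R) (i : ℤ) : (mono a i : Psi D) = fn D a * dpow D i := by
  refine ext fun p => ?_
  rw [coeff_fn_mul, coeff_dpow, mul_ite, mul_one, mul_zero]
  rfl

lemma dpow_one_mul_fn (a : R) : dpow D 1 * fn D a = fn D a * dpow D 1 + fn D (D a) := by
  ext p
  rw [coeff_dpow_one_mul, coeff_add, coeff_mul_dpow, coeff_fn, coeff_fn, coeff_fn]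
  split_ifs <;> simp

/-- Integration by parts, `∂⁻¹ a' ∂⁻¹ = a ∂⁻¹ - ∂⁻¹ a`. -/
lemma dpow_neg_one_mul_fn_deriv (a : R) :
    dpow D (-1) * fn D (D a) * dpow D (-1) = fn D a * dpow D (-1) - dpow D (-1) * fn D a := by
  rw [eq_sub_of_add_eq' (dpow_one_mul_fn a).symm, mul_sub, sub_mul, dpow_mul_dpow_assoc]
  simp only [mul_assoc, dpow_mul_dpow]
  simp

/-- The order of `A` is at most `N`. -/
def OrdLE (A : Psi D) (N : ℤ) : Prop := ∀ i, N < i → A.coeff i = 0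

lemma OrdLE.mono {A : Psi D} {M N : ℤ} (h : OrdLE A M) (hMN : M ≤ N) : OrdLE A N :=
  fun i hi => h i (hMN.trans_lt hi)
lemma OrdLE.sub {A B : Psi D} {N : ℤ} (hA : OrdLE A N) (hB : OrdLE B N) : OrdLE (A - B) N :=
  PseudoDiffOp.OrdLE.sub hA hB
lemma OrdLE.neg {A : Psi D} {N : ℤ} (hA : OrdLE A N) : OrdLE (-A) N :=
  PseudoDiffOp.OrdLE.neg hA
lemma OrdLE.mul {A B : Psi D} {M N : ℤ} (hA : OrdLE A M) (hB : OrdLE B N) :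
    OrdLE (A * B) (M + N) := comp_ordLE D hA hB
lemma ordLE_dpow (j : ℤ) : OrdLE (dpow D j) j := ordLE_mono 1 j
lemma ordLE_fn (a : R) : OrdLE (fn D a) 0 := ordLE_mono a 0
lemma exists_ordLE (A : Psi D) : ∃ N, OrdLE A N := A.bdd
lemma coeff_mul_top {A B : Psi D} {M N : ℤ} (hA : OrdLE A M) (hB : OrdLE B N) :
    (A * B).coeff (M + N) = A.coeff M * B.coeff N := comp_coeff_top D hA hB

lemma addMonoidHom_eq_zero {G : Type*} [AddCommGroup G] (F : Psi D →+ G) (M N : ℤ)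
    (h1 : ∀ a i, i ≤ M → F (fn D a * dpow D i) = 0) (h2 : ∀ A, OrdLE A N → F A = 0)
    (A : Psi D) (hA : OrdLE A M) : F A = 0 :=
  PseudoDiffOp.addMonoidHom_eq_zero F M N (fun a i hi => by
    rw [show (mono a i : PseudoDiffOp R) = fn D a * dpow D i from mono_eq a i]; exact h1 a i hi)
    h2 A hA

lemma addMonoidHom_end_eq_zero (F : Psi D →+ Psi D) (K : ℤ)
    (h1 : ∀ a i, F (fn D a * dpow D i) = 0) (h2 : ∀ A N, OrdLE A N → OrdLE (F A) (N + K))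
    (A : Psi D) : F A = 0 :=
  PseudoDiffOp.addMonoidHom_end_eq_zero F K (fun a i => by
    rw [show (mono a i : PseudoDiffOp R) = fn D a * dpow D i from mono_eq a i]; exact h1 a i)
    h2 A

/-! ### The formal adjoint -/

lemma adjoint_summand_support (A : Psi D) (p : ℤ) : (Function.support fun k : ℕ =>
    Int.negOnePow (p + k) • (Ring.choose (p + k : ℤ) k • D^[k] (A.coeff (p + k)))).Finite := by
  obtain ⟨M, hM⟩ := exists_ordLE A
  refine (Set.finite_Iic (M - p).toNat).subset fun k hk => ?_
  by_contra hc
  simp only [Set.mem_Iic, not_le] at hc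
  exact hk (by simp [hM (p + k) (by omega)])

/-- The formal adjoint as an additive map. -/
def adj : Psi D →+ Psi D :=
  AddMonoidHom.mk' (fun A => adjoint D A) fun A B => by
    refine ext fun p => ?_
    refine Eq.trans (finsum_congr fun k => ?_)
      (finsum_add_distrib (adjoint_summand_support A p) (adjoint_summand_support B p))
    rw [← smul_add, ← smul_add, ← iterate_add]
    rfl

lemma coeff_adj (A : Psi D) (p : ℤ) : (adj A).coeff p = ∑ᶠ k : ℕ,
    Int.negOnePow (p + k) • (Ring.choose (p + k : ℤ) k • D^[k] (A.coeff (p + k))) := rfl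

lemma OrdLE.adj {A : Psi D} {N : ℤ} (hA : OrdLE A N) : OrdLE (adj A) N := by
  intro p hp
  rw [coeff_adj]
  refine finsum_eq_zero_of_forall_eq_zero fun k => ?_
  simp [hA (p + k) (by omega)]

lemma adj_fn_mul_dpow (a : R) (j : ℤ) :
    adj (fn D a * dpow D j) = (Int.negOnePow j : ℤ) • (dpow D j * fn D a) := by
  ext p
  have e1 : (dpow D j * fn D a).coeff p =
      ∑ᶠ k : ℕ, Ring.choose j k • (1 * D^[k] ((fn D a).coeff (p - j + k))) :=
    coeff_mono_comp D 1 j _ p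
  have e2 := map_zsmul (coeffHom p) (Int.negOnePow j : ℤ) (dpow D j * fn D a)
  rw [coeffHom_apply, coeffHom_apply] at e2
  rw [e2, e1, coeff_adj]
  have e3 := AddMonoidHom.map_finsum (DistribSMul.toAddMonoidHom R (Int.negOnePow j : ℤ))
    (mono_comp_support D 1 j (fn D a) p)
  refine Eq.trans (finsum_congr fun k => ?_) e3.symm
  simp only [coeff_fn_mul, coeff_dpow, DistribSMul.toAddMonoidHom_apply, one_mul]
  change _ = _ • _ • D^[k] ((fn D a).coeff _)
  rw [coeff_fn, Units.smul_def]
  by_cases h : p + k = j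
  · rw [h, if_pos rfl, if_pos (by omega), mul_one]
  · rw [if_neg h, if_neg (by omega), mul_zero, iterate_map_zero, smul_zero, smul_zero,
      smul_zero, smul_zero]

@[simp] lemma adj_fn (a : R) : adj (fn D a) = fn D a := by
  simpa using adj_fn_mul_dpow (D := D) a 0

@[simp] lemma adj_one : adj (1 : Psi D) = 1 := by
  simpa using adj_fn (D := D) 1

lemma adj_dpow (j : ℤ) : adj (dpow D j) = (Int.negOnePow j : ℤ) • dpow D j := by
  simpa using adj_fn_mul_dpow (D := D) 1 j

lemma adj_fn_mul (a : R) (B : Psi D) : adj (fn D a * B) = adj B * fn D a := by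
  rw [← sub_eq_zero]
  refine addMonoidHom_end_eq_zero (adj.comp (AddMonoidHom.mulLeft (fn D a)) -
    (AddMonoidHom.mulRight (fn D a)).comp adj) 0 ?_ ?_ B
  · intro b i
    simp only [AddMonoidHom.sub_apply, AddMonoidHom.comp_apply, AddMonoidHom.coe_mulLeft,
      AddMonoidHom.coe_mulRight]
    rw [← mul_assoc, ← map_mul, adj_fn_mul_dpow, adj_fn_mul_dpow, smul_mul_assoc, mul_assoc,
      ← map_mul, mul_comm b a, sub_self]
  · intro A N hA
    exact OrdLE.sub (((ordLE_fn a).mul hA).adj.mono (by omega)) (hA.adj.mul (ordLE_fn a))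

lemma adj_dpow_one_mul (B : Psi D) : adj (dpow D 1 * B) = -(adj B * dpow D 1) := by
  rw [← sub_eq_zero]
  refine addMonoidHom_end_eq_zero (adj.comp (AddMonoidHom.mulLeft (dpow D 1)) -
    -(AddMonoidHom.mulRight (dpow D 1)).comp adj) 1 ?_ ?_ B
  · intro b i
    simp only [AddMonoidHom.sub_apply, AddMonoidHom.neg_apply, AddMonoidHom.comp_apply,
      AddMonoidHom.coe_mulLeft, AddMonoidHom.coe_mulRight]
    rw [← mul_assoc, dpow_one_mul_fn, add_mul, mul_assoc, dpow_mul_dpow, map_add,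
      adj_fn_mul_dpow, adj_fn_mul_dpow, adj_fn_mul_dpow, add_comm 1 i, Int.negOnePow_succ,
      ← dpow_mul_dpow, mul_assoc, dpow_one_mul_fn, smul_mul_assoc, mul_add]
    simp only [Units.val_neg, neg_smul, smul_add, mul_assoc]
    abel
  · intro A N hA
    refine OrdLE.sub (((ordLE_dpow 1).mul hA).adj.mono (by omega)) ?_
    exact (hA.adj.mul (ordLE_dpow 1)).neg

lemma adj_dpow_mul (i : ℤ) : ∀ B : Psi D,
    adj (dpow D i * B) = (Int.negOnePow i : ℤ) • (adj B * dpow D i) := by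
  induction i using Int.induction_on with
  | zero => intro B; simp
  | succ i ih =>
    intro B
    rw [← dpow_mul_dpow, mul_assoc, ih, adj_dpow_one_mul, Int.negOnePow_succ, Units.val_neg,
      neg_smul, neg_mul, smul_neg, mul_assoc, dpow_mul_dpow, add_comm 1, dpow_mul_dpow]
  | pred i ih =>
    intro B
    have h1 := ih (dpow D (-1) * B)
    have h2 := adj_dpow_one_mul (dpow D (-1) * B)
    rw [dpow_mul_dpow_assoc] at h1 h2
    rw [show (1 : ℤ) + -1 = 0 by ring, dpow_zero, one_mul] at h2
    rw [sub_eq_add_neg, h1, h2, neg_mul, mul_assoc, dpow_mul_dpow]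
    have e : Int.negOnePow (-(i : ℤ) + -1) = -Int.negOnePow (-(i : ℤ)) := by
      rw [Int.negOnePow_add]; simp
    rw [e, show (1 : ℤ) + (-i + -1) = -i by ring]
    simp

lemma adj_mul (A B : Psi D) : adj (A * B) = adj B * adj A := by
  obtain ⟨K, hK⟩ := exists_ordLE B
  rw [← sub_eq_zero]
  refine addMonoidHom_end_eq_zero (adj.comp (AddMonoidHom.mulRight B) -
    (AddMonoidHom.mulLeft (adj B)).comp adj) K ?_ ?_ A
  · intro b i
    simp only [AddMonoidHom.sub_apply, AddMonoidHom.comp_apply,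
      AddMonoidHom.coe_mulLeft, AddMonoidHom.coe_mulRight]
    rw [mul_assoc, adj_fn_mul, adj_dpow_mul, adj_fn_mul_dpow, smul_mul_assoc, mul_assoc,
      mul_smul_comm, sub_self]
  · intro A N hA
    exact OrdLE.sub (hA.mul hK).adj ((hK.adj.mul hA.adj).mono (by omega))

lemma adj_dpow_neg_one : adj (dpow D (-1)) = -dpow D (-1) := by
  rw [adj_dpow]; simp

/-! ### Differential operators, residues and the action on functions -/

variable (D) in
/-- The subring of differential operators. -/
def Diff : Subring (Psi D) where
  carrier := {A | ∀ p, p < 0 → A.coeff p = 0}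
  zero_mem' _ _ := rfl
  one_mem' p hp := by rw [coeff_one, if_neg hp.ne]
  add_mem' hA hB p hp := by rw [coeff_add, hA p hp, hB p hp, add_zero]
  neg_mem' hA p hp := by rw [coeff_neg, hA p hp, neg_zero]
  mul_mem' {A B} hA hB p hp := by
    refine finsum_eq_zero_of_forall_eq_zero ?_
    rintro ⟨m, k⟩
    change Ring.choose m k • (A.coeff m * D^[k] (B.coeff (p - m + k))) = 0
    rcases lt_or_ge m 0 with hm | hm
    · simp [hA m hm]
    · obtain ⟨m, rfl⟩ := Int.eq_ofNat_of_zero_le hm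
      rcases lt_or_ge m k with hk | hk
      · rw [Ring.choose_natCast, Nat.choose_eq_zero_of_lt hk]; simp
      · simp [hB (p - m + k) (by omega)]

lemma fn_mem_Diff (a : R) : fn D a ∈ Diff D := fun p hp => by rw [coeff_fn, if_neg hp.ne]

lemma dpow_mem_Diff {j : ℤ} (hj : 0 ≤ j) : dpow D j ∈ Diff D := fun p hp => by
  rw [coeff_dpow, if_neg (by omega)]

lemma adj_mem_Diff {A : Psi D} (hA : A ∈ Diff D) : adj A ∈ Diff D := by
  intro p hp
  rw [coeff_adj]
  refine finsum_eq_zero_of_forall_eq_zero fun k => ?_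
  rcases lt_or_ge (p + k) 0 with hm | hm
  · simp [hA _ hm]
  · obtain ⟨m, hm⟩ := Int.eq_ofNat_of_zero_le hm
    rw [hm, Ring.choose_natCast, Nat.choose_eq_zero_of_lt (by omega)]
    simp

/-- The differential part. -/
def pos : Psi D →+ Psi D where
  toFun A := nonneg A
  map_zero' := ext fun p => ite_self _
  map_add' A B := ext fun p => by
    change (if _ then _ else _) = (if _ then _ else _) + (if _ then _ else _)
    split_ifs
    · rfl
    · simp

lemma coeff_pos (A : Psi D) (p : ℤ) : (pos A).coeff p = if 0 ≤ p then A.coeff p else 0 := rfl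

lemma pos_mem_Diff (A : Psi D) : pos A ∈ Diff D := fun p hp => by
  rw [coeff_pos, if_neg (by omega)]

lemma sub_pos_ordLE (A : Psi D) : OrdLE (A - pos A) (-1) := fun p hp => by
  rw [coeff_sub, coeff_pos, if_pos (by omega), sub_self]

lemma eq_zero_of_mem_Diff_of_ordLE {A : Psi D} (h1 : A ∈ Diff D) (h2 : OrdLE A (-1)) : A = 0 := by
  ext p
  rcases lt_or_ge p 0 with h | h
  · exact h1 p h
  · exact h2 p (by omega)

lemma pos_of_mem_Diff {A : Psi D} (h : A ∈ Diff D) : pos A = A :=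
  (sub_eq_zero.mp (eq_zero_of_mem_Diff_of_ordLE (sub_mem h (pos_mem_Diff A))
    (sub_pos_ordLE A))).symm

lemma pos_of_ordLE {A : Psi D} (h : OrdLE A (-1)) : pos A = 0 := by
  ext p
  rw [coeff_pos]
  split_ifs with hp
  · exact h p (by omega)
  · rfl

/-- The residue `Res_∂`. -/
def res (A : Psi D) : R := A.coeff (-1)

@[simp] lemma res_add (A B : Psi D) : res (A + B) = res A + res B := rfl
@[simp] lemma res_sub (A B : Psi D) : res (A - B) = res A - res B := rfl
@[simp] lemma res_neg (A : Psi D) : res (-A) = -res A := rfl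
@[simp] lemma res_fn_mul (a : R) (A : Psi D) : res (fn D a * A) = a * res A := coeff_fn_mul _ _ _

lemma res_of_mem_Diff {A : Psi D} (h : A ∈ Diff D) : res A = 0 := h _ (by norm_num)
lemma res_of_ordLE {A : Psi D} (h : OrdLE A (-2)) : res A = 0 := h _ (by norm_num)

@[simp] lemma res_mul_fn (A : Psi D) (a : R) : res (A * fn D a) = res A * a := by
  have h : res (A * fn D a) = res (pos A * fn D a) + res ((A - pos A) * fn D a) := by
    rw [← res_add, ← add_mul, add_sub_cancel]
  have h2 := coeff_mul_top (sub_pos_ordLE A) (ordLE_fn a)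
  rw [h, res_of_mem_Diff (mul_mem (pos_mem_Diff A) (fn_mem_Diff a)), zero_add]
  rw [add_zero] at h2
  rw [res, h2, coeff_sub, coeff_pos, coeff_fn]
  simp [res]

/-- The value `S(f)` of the differential operator `S` on the function `f`, as the constant term
of `S ∘ f`. -/
def app (S : Psi D) (f : R) : R := (S * fn D f).coeff 0

lemma app_eq_res (S : Psi D) (f : R) : app S f = res (S * fn D f * dpow D (-1)) := by
  rw [res, coeff_mul_dpow]; simp [app]

@[simp] lemma app_add_left (S S' : Psi D) (f : R) : app (S + S') f = app S f + app S' f := by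
  simp [app, add_mul]
@[simp] lemma app_sub_left (S S' : Psi D) (f : R) : app (S - S') f = app S f - app S' f := by
  simp [app, sub_mul]
@[simp] lemma app_fn_mul_left (a : R) (S : Psi D) (f : R) : app (fn D a * S) f = a * app S f := by
  simp [app, mul_assoc]
@[simp] lemma app_zero_right (S : Psi D) : app S 0 = 0 := by simp [app]
@[simp] lemma app_one (f : R) : app (1 : Psi D) f = f := by simp [app, coeff_fn]

lemma app_sum_left {ι : Type*} (s : Finset ι) (S : ι → Psi D) (f : R) :
    app (∑ i ∈ s, S i) f = ∑ i ∈ s, app (S i) f := by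
  simp [app, sum_mul, coeff_sum]

/-- `S ∘ f - S(f)` is divisible by `∂` on the right. -/
lemma mul_fn_mul_dpow_sub_mem_Diff {S : Psi D} (hS : S ∈ Diff D) (f : R) :
    S * fn D f * dpow D (-1) - fn D (app S f) * dpow D (-1) ∈ Diff D := by
  intro p hp
  have h := mul_mem hS (fn_mem_Diff f)
  rw [coeff_sub, coeff_mul_dpow, coeff_mul_dpow, coeff_fn]
  split_ifs with hp0
  · rw [hp0, app, sub_self]
  · rw [h _ (by omega), sub_zero]

lemma app_mul {S S' : Psi D} (hS : S ∈ Diff D) (hS' : S' ∈ Diff D) (f : R) :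
    app (S * S') f = app S (app S' f) := by
  rw [app_eq_res, app_eq_res, ← sub_eq_zero, ← res_sub,
    show S * S' * fn D f * dpow D (-1) - S * fn D (app S' f) * dpow D (-1) =
      S * (S' * fn D f * dpow D (-1) - fn D (app S' f) * dpow D (-1)) by noncomm_ring]
  exact res_of_mem_Diff (mul_mem hS (mul_fn_mul_dpow_sub_mem_Diff hS' f))

/-- If `B` is a skew-adjoint differential operator, the integral part of `∂⁻¹ f B` is
`-∂⁻¹ B(f)`. -/
lemma dpow_mul_fn_mul_add_mem_Diff {B : Psi D} (hB : B ∈ Diff D) (hB' : adj B = -B) (f : R) :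
    dpow D (-1) * fn D f * B + dpow D (-1) * fn D (app B f) ∈ Diff D := by
  have h := adj_mem_Diff (mul_fn_mul_dpow_sub_mem_Diff hB f)
  rw [map_sub, adj_mul, adj_mul, adj_mul, hB', adj_dpow_neg_one, adj_fn, adj_fn] at h
  convert h using 1
  noncomm_ring

/-- If `Res ∂ ^ k A = 0` for all `k`, then `A` is a differential operator. -/
lemma mem_Diff_of_res_eq_zero {A : Psi D} (h : ∀ k : ℕ, res (dpow D k * A) = 0) : A ∈ Diff D := by
  have hN : ∀ k : ℕ, res (dpow D k * (A - pos A)) = 0 := by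
    intro k
    rw [mul_sub, res_sub, h k, res_of_mem_Diff (mul_mem (dpow_mem_Diff (Int.natCast_nonneg k))
      (pos_mem_Diff A)), sub_zero]
  have key : ∀ k : ℕ, OrdLE (A - pos A) (-1 - k) := by
    intro k
    induction k with
    | zero => exact (sub_pos_ordLE A).mono (by simp)
    | succ k ih =>
      intro p hp
      by_cases h1 : -1 - (k : ℤ) < p
      · exact ih p h1
      · have h2 : p = -1 - k := by push_cast at hp; omega
        have := coeff_mul_top (ordLE_dpow (D := D) (k : ℤ)) ih
        rw [show (k : ℤ) + (-1 - k) = -1 by ring] at this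
        have h3 := hN k
        rw [res, this, coeff_dpow, if_pos rfl, one_mul] at h3
        rw [h2, h3]
  intro p hp
  have := key (-p).toNat p (by omega)
  rwa [coeff_sub, coeff_pos, if_neg (by omega), sub_zero] at this

/-- Right multiplication by an operator with leading term `∂ ^ 0` is injective. -/
lemma eq_zero_of_mul_eq_zero {A V : Psi D} (hV : OrdLE V 0) (hV0 : V.coeff 0 = 1)
    (h : A * V = 0) : A = 0 := by
  obtain ⟨M, hM⟩ := exists_ordLE A
  have key : ∀ n : ℕ, OrdLE A (M - n) := by
    intro n
    induction n with
    | zero => exact hM.mono (by simp)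
    | succ n ih =>
      intro p hp
      by_cases h1 : M - n < p
      · exact ih p h1
      · have h2 : p = M - n := by push_cast at hp; omega
        have := coeff_mul_top ih hV
        rw [h, hV0] at this
        simpa [h2] using this.symm
  ext p
  exact key (M - p + 1).toNat p (by omega)

lemma coeff_adj_zero {W : Psi D} (hW : OrdLE W 0) : (adj W).coeff 0 = W.coeff 0 := by
  rw [coeff_adj, finsum_eq_single _ 0]
  · simp
  · intro k hk
    rw [hW ((0 : ℤ) + k) (by omega), iterate_map_zero, smul_zero, smul_zero]

/-- If `W = 1 + O(∂⁻¹)` and `W W^* = 1` then also `W^* W = 1`. -/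
lemma adj_mul_self_eq_one {W : Psi D} (hW : OrdLE W 0) (hW0 : W.coeff 0 = 1)
    (h : W * adj W = 1) : adj W * W = 1 := by
  refine sub_eq_zero.mp (eq_zero_of_mul_eq_zero hW.adj ((coeff_adj_zero hW).trans hW0) ?_)
  rw [sub_mul, mul_assoc, h, mul_one, one_mul, sub_self]

/-! ### Derivatives in the times -/

/-- The coefficientwise time derivative. -/
def tderiv (δ : Derivation ℂ R R) : Psi D →+ Psi D where
  toFun A := timeDeriv δ A
  map_zero' := ext fun _ => map_zero δ
  map_add' _ _ := ext fun _ => map_add δ _ _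

@[simp] lemma coeff_tderiv (δ : Derivation ℂ R R) (A : Psi D) (p : ℤ) :
    (tderiv δ A).coeff p = δ (A.coeff p) := rfl

lemma tderiv_mul {δ : Derivation ℂ R R} (h : ∀ f, δ (D f) = D (δ f)) (A B : Psi D) :
    tderiv δ (A * B) = tderiv δ A * B + A * tderiv δ B := timeDeriv_comp D h A B

@[simp] lemma tderiv_fn (δ : Derivation ℂ R R) (a : R) : tderiv δ (fn D a) = fn D (δ a) := by
  ext p
  rw [coeff_tderiv, coeff_fn, coeff_fn]
  split_ifs <;> simp

@[simp] lemma tderiv_dpow (δ : Derivation ℂ R R) (j : ℤ) : tderiv δ (dpow D j) = 0 := by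
  ext p
  rw [coeff_tderiv, coeff_dpow]
  split_ifs <;> simp

@[simp] lemma tderiv_one (δ : Derivation ℂ R R) : tderiv δ (1 : Psi D) = 0 :=
  tderiv_dpow δ 0

lemma tderiv_mem_Diff (δ : Derivation ℂ R R) {A : Psi D} (h : A ∈ Diff D) :
    tderiv δ A ∈ Diff D := fun p hp => by rw [coeff_tderiv, h p hp, map_zero]

lemma OrdLE.tderiv (δ : Derivation ℂ R R) {A : Psi D} {N : ℤ} (h : OrdLE A N) :
    OrdLE (tderiv δ A) N := fun p hp => by rw [coeff_tderiv, h p hp, map_zero]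

/-- The derivative of an operator with leading term `∂ ^ 0` has negative order. -/
lemma ordLE_tderiv_of_coeff_zero (δ : Derivation ℂ R R) {A : Psi D} (h : OrdLE A 0)
    (h0 : A.coeff 0 = 1) : OrdLE (Psi.tderiv δ A) (-1) := fun p hp => by
  rw [coeff_tderiv]
  rcases eq_or_lt_of_le (show (0 : ℤ) ≤ p by omega) with rfl | h1
  · rw [h0, Derivation.map_one_eq_zero]
  · rw [h p h1, map_zero]

/-- `∂ W = W' + W ∂`. -/
lemma dpow_one_mul (A : Psi D) : dpow D 1 * A = tderiv D A + A * dpow D 1 := dx_comp_eq D A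

lemma app_tderiv {δ : Derivation ℂ R R} (h : ∀ f, δ (D f) = D (δ f)) (S : Psi D) (f : R) :
    δ (app S f) = app (tderiv δ S) f + app S (δ f) := by
  have := congrArg (fun A : Psi D => A.coeff 0) (tderiv_mul h S (fn D f))
  simpa [app] using this

end Psi

/-! ### Taylor coefficients -/

section Taylor

variable (d : ℕ → Derivation ℂ R R)

/-- The coefficient of `s ^ α` in `f(t_o + s)`. -/
def taylorCoeff (f : R) (α : ℕ →₀ ℕ) : R := MvPowerSeries.coeff α (taylor d f)

lemma taylorCoeff_eq (f : R) (α : ℕ →₀ ℕ) :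
    taylorCoeff d f α = (multiFactorial α)⁻¹ • partialDeriv d α f := rfl

lemma weight_add (α β : ℕ →₀ ℕ) : weight (α + β) = weight α + weight β :=
  Finsupp.sum_add_index' (fun _ => rfl) (fun _ _ _ => Nat.mul_add _ _ _)

@[simp] lemma weight_single (k : ℕ) : weight (Finsupp.single k 1) = 2 * k + 1 := by
  simp [weight]

@[simp] lemma weight_zero : weight 0 = 0 := rfl

lemma erase_add_single (α : ℕ →₀ ℕ) (k m : ℕ) :
    Finsupp.erase k (α + Finsupp.single k m) = Finsupp.erase k α := by
  ext i
  by_cases h : i = k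
  · simp [h]
  · simp [h]

lemma multiFactorial_add_single (α : ℕ →₀ ℕ) (k : ℕ) :
    multiFactorial (α + Finsupp.single k 1) = (α k + 1 : ℕ) * multiFactorial α := by
  unfold multiFactorial
  rw [← Finsupp.mul_prod_erase' _ k _ (fun _ => by simp), erase_add_single,
    ← Finsupp.mul_prod_erase' α k _ (fun _ => by simp)]
  simp [Nat.factorial_succ, mul_assoc]

@[simp] lemma multiFactorial_zero : multiFactorial 0 = 1 := rfl

@[simp] lemma partialDeriv_zero (f : R) : partialDeriv d 0 f = f := by simp [partialDeriv]

@[simp] lemma taylorCoeff_zero (f : R) : taylorCoeff d f 0 = f := by simp [taylorCoeff_eq]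

@[simp] lemma taylorCoeff_map_zero (α : ℕ →₀ ℕ) : taylorCoeff d 0 α = 0 := by
  have h0 : partialDeriv d α 0 = 0 := by
    unfold partialDeriv
    induction α.support.sort (· ≤ ·) with
    | nil => rfl
    | cons a l ih => rw [List.foldr_cons, ih, iterate_map_zero]
  rw [taylorCoeff_eq, h0, smul_zero]

variable {d} (hd : ∀ (i j : ℕ) (f : R), d i (d j f) = d j (d i f))

include hd

lemma iterate_iterate_comm (i j m n : ℕ) (f : R) :
    (d i)^[m] ((d j)^[n] f) = (d j)^[n] ((d i)^[m] f) :=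
  Function.Commute.iterate_iterate (f := d i) (g := d j) (hd i j) m n f

lemma partialDeriv_eq_erase (α : ℕ →₀ ℕ) (k : ℕ) (f : R) :
    partialDeriv d α f = (d k)^[α k]
      (((α.support.erase k).sort (· ≤ ·)).foldr (fun k g => (d k)^[α k] g) f) := by
  have hlc : LeftCommutative (fun k (g : R) => (d k)^[α k] g) :=
    ⟨fun i j g => iterate_iterate_comm hd i j _ _ g⟩
  by_cases h : k ∈ α.support
  · have hp : (α.support.sort (· ≤ ·)).Perm (k :: (α.support.erase k).sort (· ≤ ·)) := by
      refine List.perm_of_nodup_nodup_toFinset_eq (Finset.sort_nodup _ _) ?_ ?_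
      · simp [Finset.sort_nodup]
      · simp [Finset.insert_erase h]
    exact hp.foldr_eq f
  · rw [Finset.erase_eq_of_notMem h, Finsupp.notMem_support_iff.mp h]
    rfl

lemma partialDeriv_add_single (α : ℕ →₀ ℕ) (k : ℕ) (f : R) :
    partialDeriv d (α + Finsupp.single k 1) f = d k (partialDeriv d α f) := by
  rw [partialDeriv_eq_erase hd _ k, partialDeriv_eq_erase hd α k, ← Finsupp.support_erase,
    erase_add_single, Finsupp.support_erase, Finsupp.add_apply, Finsupp.single_eq_same,
    ← Function.iterate_succ_apply' (d k)]
  congr 1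
  refine List.foldr_ext _ _ _ fun i hi g => ?_
  have : i ≠ k := by
    rw [Finset.mem_sort] at hi
    exact Finset.ne_of_mem_erase hi
  simp [this.symm]

lemma nsmul_taylorCoeff_add_single (f : R) (α : ℕ →₀ ℕ) (k : ℕ) :
    (α k + 1) • taylorCoeff d f (α + Finsupp.single k 1) = d k (taylorCoeff d f α) := by
  rw [taylorCoeff_eq, taylorCoeff_eq, partialDeriv_add_single hd, multiFactorial_add_single,
    Derivation.map_smul, ← Nat.cast_smul_eq_nsmul ℂ, smul_smul, mul_inv, ← mul_assoc,
    mul_inv_cancel₀ (Nat.cast_ne_zero.mpr (Nat.succ_ne_zero _)), one_mul]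

end Taylor

/-- Division by a positive integer. -/
lemma eq_of_nsmul_eq {n : ℕ} (hn : n ≠ 0) {a b : R} (h : n • a = n • b) : a = b := by
  rw [← Nat.cast_smul_eq_nsmul ℂ, ← Nat.cast_smul_eq_nsmul ℂ] at h
  have hn' : (n : ℂ) ≠ 0 := by exact_mod_cast hn
  simpa [smul_smul, inv_mul_cancel₀ hn'] using congrArg (fun x => (n : ℂ)⁻¹ • x) h

/-- Leibniz rule for sums over multi-indices, in the first index. -/
lemma sum_antidiagonal_add_single_fst {M : Type*} [AddCommMonoid M]
    (F : (ℕ →₀ ℕ) → (ℕ →₀ ℕ) → M) (α : ℕ →₀ ℕ) (k : ℕ) :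
    ∑ x ∈ HasAntidiagonal.antidiagonal (α + Finsupp.single k 1 : ℕ →₀ ℕ), x.1 k • F x.1 x.2 =
      ∑ x ∈ HasAntidiagonal.antidiagonal α, (x.1 k + 1) • F (x.1 + Finsupp.single k 1) x.2 := by
  classical
  symm
  refine Finset.sum_of_injOn (fun x => (x.1 + Finsupp.single k 1, x.2)) ?_ ?_ ?_ ?_
  · rintro ⟨a, b⟩ _ ⟨a', b'⟩ _ h
    simpa using h
  · rintro ⟨a, b⟩ h
    simp only [mem_coe, HasAntidiagonal.mem_antidiagonal] at h ⊢
    rw [← h]; abel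
  · rintro ⟨a, b⟩ h h'
    have h0 : a k = 0 := by
      by_contra hc
      refine h' ⟨(a - Finsupp.single k 1, b), ?_, ?_⟩
      · have hle : Finsupp.single k 1 ≤ a := by
          rw [Finsupp.single_le_iff]; omega
        rw [HasAntidiagonal.mem_antidiagonal] at h
        simp only [mem_coe, HasAntidiagonal.mem_antidiagonal]
        rw [← add_left_inj (Finsupp.single k 1), ← h, add_right_comm, tsub_add_cancel_of_le hle]
      · have hle : Finsupp.single k 1 ≤ a := by
          rw [Finsupp.single_le_iff]; omega
        simp [tsub_add_cancel_of_le hle]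
    simp [h0]
  · rintro ⟨a, b⟩ _
    simp

lemma sum_antidiagonal_add_single_snd {M : Type*} [AddCommMonoid M]
    (F : (ℕ →₀ ℕ) → (ℕ →₀ ℕ) → M) (α : ℕ →₀ ℕ) (k : ℕ) :
    ∑ x ∈ HasAntidiagonal.antidiagonal (α + Finsupp.single k 1 : ℕ →₀ ℕ), x.2 k • F x.1 x.2 =
      ∑ x ∈ HasAntidiagonal.antidiagonal α, (x.2 k + 1) • F x.1 (x.2 + Finsupp.single k 1) := by
  have h := sum_antidiagonal_add_single_fst (fun a b => F b a) α k
  rwa [Finsupp.sum_antidiagonal_swap _ fun a b => a k • F b a,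
    Finsupp.sum_antidiagonal_swap _ fun a b => (a k + 1) • F b (a + Finsupp.single k 1)] at h

namespace Psi

variable (d : ℕ → Derivation ℂ R R)

/-- The coefficient of `s ^ α` in `U(t_o + s)`. -/
def taylorOp (U : Psi (d 0)) (α : ℕ →₀ ℕ) : Psi (d 0) where
  coeff p := taylorCoeff d (U.coeff p) α
  bdd := by
    obtain ⟨N, hN⟩ := exists_ordLE U
    refine ⟨N, fun p hp => ?_⟩
    rw [hN p hp, taylorCoeff_map_zero]

lemma coeff_taylorOp (U : Psi (d 0)) (α : ℕ →₀ ℕ) (p : ℤ) :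
    (taylorOp d U α).coeff p = taylorCoeff d (U.coeff p) α := rfl

lemma ordLE_taylorOp {d : ℕ → Derivation ℂ R R} {U : Psi (d 0)} {N : ℤ} (hU : OrdLE U N)
    (α : ℕ →₀ ℕ) : OrdLE (taylorOp d U α) N := fun p hp => by
  rw [coeff_taylorOp, hU p hp, taylorCoeff_map_zero]

lemma fn_algebraMap_mul {D : Derivation ℂ R R} (c : ℂ) (A : Psi D) :
    fn D (algebraMap ℂ R c) * A = A * fn D (algebraMap ℂ R c) := by
  ext p
  rw [coeff_fn_mul]
  refine Eq.symm ((finsum_eq_single _ ((p, 0) : ℤ × ℕ) ?_).trans ?_)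
  · rintro ⟨m, k⟩ hmk
    change Ring.choose m k • (A.coeff m * D^[k] ((fn D _).coeff (p - m + k))) = 0
    rw [coeff_fn]
    cases k with
    | zero =>
      have : p - m ≠ 0 := fun h => hmk (by ext <;> simp; omega)
      simp [this]
    | succ k => split_ifs <;> simp
  · change Ring.choose p 0 • (A.coeff p * D^[0] ((fn D _).coeff (p - p + (0 : ℕ)))) = _
    rw [coeff_fn]
    simp [mul_comm]

/-- The coefficient of `s ^ γ` in `e^{ξ(s, ∂)}`. -/
def expOp (γ : ℕ →₀ ℕ) : Psi (d 0) :=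
  fn (d 0) (algebraMap ℂ R (multiFactorial γ)⁻¹) * dpow (d 0) (weight γ)

/-- The operator whose value at `e^{ξ(t_o, λ)}` is the coefficient of `s ^ α` in the Taylor
expansion at `t_o + s` of the wave function `U(e^ξ)`. -/
def waveTaylor (U : Psi (d 0)) (α : ℕ →₀ ℕ) : Psi (d 0) :=
  ∑ x ∈ HasAntidiagonal.antidiagonal α, taylorOp d U x.1 * expOp d x.2

/-- The operator whose value at `e^ξ` is the derivative of `U(e^ξ)` with respect to `t_{2k+1}`. -/
def nabla (k : ℕ) (U : Psi (d 0)) : Psi (d 0) :=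
  tderiv (d k) U + U * dpow (d 0) (2 * k + 1)

@[simp] lemma waveTaylor_zero (U : Psi (d 0)) : waveTaylor d U 0 = U := by
  simp only [waveTaylor, Finsupp.antidiagonal_zero, sum_singleton, expOp]
  ext p
  simp [coeff_taylorOp]

variable {d} (hd : ∀ (i j : ℕ) (f : R), d i (d j f) = d j (d i f))

include hd

lemma nsmul_waveTaylor_add_single (U : Psi (d 0)) (α : ℕ →₀ ℕ) (k : ℕ) :
    (α k + 1) • waveTaylor d U (α + Finsupp.single k 1) = nabla d k (waveTaylor d U α) := by
  have e1 : ∀ β : ℕ →₀ ℕ, (β k + 1) • taylorOp d U (β + Finsupp.single k 1) =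
      tderiv (d k) (taylorOp d U β) := fun β => ext fun p => by
    rw [coeff_nsmul, coeff_taylorOp, nsmul_taylorCoeff_add_single hd]; rfl
  have e2 : ∀ γ : ℕ →₀ ℕ, (γ k + 1) • expOp d (γ + Finsupp.single k 1) =
      expOp d γ * dpow (d 0) (2 * k + 1) := fun γ => by
    rw [expOp, expOp, mul_assoc, dpow_mul_dpow, weight_add, weight_single, ← smul_mul_assoc,
      multiFactorial_add_single, ← map_nsmul, ← map_nsmul, mul_inv, nsmul_eq_mul, ← mul_assoc,
      mul_inv_cancel₀ (Nat.cast_ne_zero.mpr (Nat.succ_ne_zero _)), one_mul]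
    push_cast
    rfl
  have e3 : ∀ γ : ℕ →₀ ℕ, tderiv (d k) (expOp d γ) = 0 := fun γ => by
    rw [expOp, tderiv_mul (fun f => hd k 0 f), tderiv_fn, tderiv_dpow, Derivation.map_algebraMap]
    simp
  have e4 : (α k + 1) • waveTaylor d U (α + Finsupp.single k 1) =
      ∑ x ∈ HasAntidiagonal.antidiagonal (α + Finsupp.single k 1 : ℕ →₀ ℕ), (x.1 k + x.2 k) •
        (taylorOp d U x.1 * expOp d x.2) := by
    rw [waveTaylor, smul_sum]
    refine sum_congr rfl fun x hx => ?_
    have := DFunLike.congr_fun (HasAntidiagonal.mem_antidiagonal.mp hx) k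
    simp only [Finsupp.add_apply, Finsupp.single_eq_same] at this
    rw [this]
  rw [e4]
  simp only [add_smul]
  rw [sum_add_distrib,
    sum_antidiagonal_add_single_fst (fun a b => taylorOp d U a * expOp d b),
    sum_antidiagonal_add_single_snd (fun a b => taylorOp d U a * expOp d b),
    nabla, waveTaylor, map_sum, sum_mul]
  congr 1
  · refine sum_congr rfl fun x _ => ?_
    rw [tderiv_mul (fun f => hd k 0 f), e3, mul_zero, add_zero, ← e1, smul_mul_assoc]
  · refine sum_congr rfl fun x _ => ?_
    rw [mul_assoc, ← e2, mul_smul_comm]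

end Psi

/-! ### The residue pairing and the bilinear equation -/

namespace Psi

lemma res_dpow_mul_adj {D : Derivation ℂ R R} (m : ℤ) (X : Psi D) :
    res (dpow D m * adj X) = Int.negOnePow (m + 1) • X.coeff (-1 - m) := by
  obtain ⟨M, hM⟩ := exists_ordLE X
  rw [← sub_eq_zero]
  refine addMonoidHom_eq_zero (((coeffHom (-1)).comp
    ((AddMonoidHom.mulLeft (dpow D m)).comp adj)) -
    (DistribSMul.toAddMonoidHom R (Int.negOnePow (m + 1))).comp (coeffHom (-1 - m))) M (-2 - m)
    ?_ ?_ X hM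
  · intro b j _
    simp only [AddMonoidHom.sub_apply, AddMonoidHom.comp_apply, AddMonoidHom.coe_mulLeft,
      coeffHom_apply, DistribSMul.toAddMonoidHom_apply]
    have := res_mul_fn (dpow D (m + j)) b
    rw [res] at this
    rw [adj_fn_mul_dpow, mul_smul_comm, ← mul_assoc, dpow_mul_dpow, ← coeffHom_apply,
      map_zsmul, coeffHom_apply, this, coeff_fn_mul, coeff_dpow, ← Units.smul_def]
    by_cases h : -1 - m = j
    · rw [if_pos h, res, coeff_dpow, if_pos (by omega), show m + 1 = -j by omega,
        Int.negOnePow_neg, mul_one, one_mul, sub_self]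
    · rw [if_neg h, res, coeff_dpow, if_neg (by omega)]; simp
  · intro A hA
    simp only [AddMonoidHom.sub_apply, AddMonoidHom.comp_apply, AddMonoidHom.coe_mulLeft,
      coeffHom_apply, DistribSMul.toAddMonoidHom_apply]
    rw [hA (-1 - m) (by omega), ((ordLE_dpow m).mul hA.adj) (-1) (by omega)]
    simp

variable (D : Derivation ℂ R R)

/-- The operator `∑ u_j ∂ ^ (-j)`. -/
def ser (u : PowerSeries R) : Psi D := ofSeries u

variable {D}

lemma coeff_ser (u : PowerSeries R) (p : ℤ) :
    (ser D u).coeff p = if p ≤ 0 then PowerSeries.coeff (-p).toNat u else 0 := rfl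

lemma coeff_ser_neg (u : PowerSeries R) (n : ℕ) :
    (ser D u).coeff (-n) = PowerSeries.coeff n u := by
  rw [coeff_ser, if_pos (by omega)]; simp

lemma ordLE_ser (u : PowerSeries R) : OrdLE (ser D u) 0 := fun p hp => by
  rw [coeff_ser, if_neg (by omega)]

/-- `Res_∂ U ∂ ^ b X^*` is the residue in `λ` of the product `λ ^ b U(λ) X(-λ)` of symbols. -/
lemma res_mul_dpow_mul_adj {U : Psi D} (hU : OrdLE U 0) (b : ℕ) (χ : PowerSeries R) :
    res (U * dpow D b * adj (ser D χ)) = ∑ x ∈ HasAntidiagonal.antidiagonal (b + 1),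
      U.coeff (-x.1) * ((-1) ^ x.2 * PowerSeries.coeff x.2 χ) := by
  rw [← sub_eq_zero]
  refine addMonoidHom_eq_zero (((coeffHom (-1)).comp
    ((AddMonoidHom.mulRight (adj (ser D χ))).comp (AddMonoidHom.mulRight (dpow D b)))) -
    ∑ x ∈ HasAntidiagonal.antidiagonal (b + 1), (AddMonoidHom.mulRight
      ((-1) ^ x.2 * PowerSeries.coeff x.2 χ)).comp (coeffHom (-x.1))) 0 (-b - 2)
    ?_ ?_ U hU |>.symm.trans ?_ |>.symm
  · intro a i hi
    simp only [AddMonoidHom.sub_apply, AddMonoidHom.comp_apply, AddMonoidHom.coe_mulRight,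
      coeffHom_apply, AddMonoidHom.finsetSum_apply]
    have e := res_dpow_mul_adj (i + b) (ser D χ)
    rw [res] at e
    simp only [mul_assoc, coeff_fn_mul, dpow_mul_dpow_assoc]
    rw [e, sub_eq_zero]
    obtain ⟨j, rfl⟩ : ∃ j : ℕ, i = -j := ⟨(-i).toNat, by omega⟩
    simp only [coeff_dpow, neg_inj, Nat.cast_inj]
    by_cases hj : j ≤ b + 1
    · rw [Finset.sum_eq_single (j, b + 1 - j)]
      · rw [show -1 - (-(j : ℤ) + b) = -((b + 1 - j : ℕ) : ℤ) by omega, coeff_ser_neg,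
          show -(j : ℤ) + b + 1 = ((b + 1 - j : ℕ) : ℤ) by omega, Units.smul_def,
          Int.coe_negOnePow_natCast]
        simp
      · rintro ⟨x, y⟩ hxy hne
        rw [HasAntidiagonal.mem_antidiagonal] at hxy
        simp only at hxy ⊢
        rw [if_neg, zero_mul, mul_zero]
        intro h
        exact hne (by ext <;> simp <;> omega)
      · intro h
        exact absurd (HasAntidiagonal.mem_antidiagonal.mpr (by simp; omega)) h
    · rw [coeff_ser, if_neg (by omega), smul_zero, mul_zero, Finset.sum_eq_zero]
      rintro ⟨x, y⟩ hxy
      rw [HasAntidiagonal.mem_antidiagonal] at hxy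
      simp only at hxy ⊢
      rw [if_neg (by omega), zero_mul, mul_zero]
  · intro A hA
    simp only [AddMonoidHom.sub_apply, AddMonoidHom.comp_apply, AddMonoidHom.coe_mulRight,
      coeffHom_apply, AddMonoidHom.finsetSum_apply]
    rw [((hA.mul (ordLE_dpow (b : ℤ))).mul (ordLE_ser χ).adj) (-1) (by omega), zero_sub,
      neg_eq_zero]
    refine Finset.sum_eq_zero fun x hx => ?_
    rw [HasAntidiagonal.mem_antidiagonal] at hx
    rw [hA _ (by omega), zero_mul]
  · simp [res, AddMonoidHom.finsetSum_apply, mul_assoc]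

variable {d : ℕ → Derivation ℂ R R}

/-- The residue pairing of a Taylor expanded wave function with a second one. -/
lemma res_waveTaylor_mul_adj (u χ : PowerSeries R) (α : ℕ →₀ ℕ) :
    res (waveTaylor d (ser (d 0) u) α * adj (ser (d 0) χ)) =
      ∑ x ∈ HasAntidiagonal.antidiagonal α, (multiFactorial x.2)⁻¹ •
        ∑ y ∈ HasAntidiagonal.antidiagonal (weight x.2 + 1),
          taylorCoeff d (PowerSeries.coeff y.1 u) x.1 *
            ((-1) ^ y.2 * PowerSeries.coeff y.2 χ) := by
  rw [waveTaylor, sum_mul, res, coeff_sum]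
  refine sum_congr rfl fun x _ => ?_
  have hU : OrdLE (taylorOp d (ser (d 0) u) x.1) 0 := ordLE_taylorOp (ordLE_ser u) x.1
  rw [expOp, ← mul_assoc, ← fn_algebraMap_mul, mul_assoc, mul_assoc, coeff_fn_mul, ← mul_assoc,
    ← Algebra.smul_def]
  refine congrArg _ ((res_mul_dpow_mul_adj hU _ χ).trans ?_)
  refine sum_congr rfl fun y _ => ?_
  rw [coeff_taylorOp, coeff_ser_neg]

/-- The bilinear equation in terms of residues of pseudo-differential operators. -/
lemma bilinear_iff (w : PowerSeries R) : Bilinear d w ↔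
    ∀ α, res (waveTaylor d (ser (d 0) w) α * adj (ser (d 0) w)) = 0 := by
  refine forall_congr' fun α => ?_
  rw [res_waveTaylor_mul_adj]
  have : ∀ N, MvPowerSeries.coeff α (waveProduct d w (N + 1) * expXi R N) =
      ∑ x ∈ HasAntidiagonal.antidiagonal α, if weight x.2 = N then (multiFactorial x.2)⁻¹ •
        ∑ y ∈ HasAntidiagonal.antidiagonal (N + 1), taylorCoeff d (PowerSeries.coeff y.1 w) x.1 *
            ((-1) ^ y.2 * PowerSeries.coeff y.2 w) else 0 := by
    intro N
    rw [MvPowerSeries.coeff_mul]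
    refine sum_congr rfl fun x _ => ?_
    have e1 : MvPowerSeries.coeff x.2 (expXi R N) =
      if weight x.2 = N then algebraMap ℂ R (multiFactorial x.2)⁻¹ else 0 := rfl
    rw [e1]
    split_ifs
    · rw [mul_comm, ← Algebra.smul_def, waveProduct, map_sum]
      congr 1
      refine sum_congr rfl fun y _ => ?_
      rw [MvPowerSeries.coeff_mul_C]
      rfl
    · rw [mul_zero]
  simp only [this]
  rw [finsum_sum_comm]
  · refine Eq.congr (sum_congr rfl fun x _ => ?_) rfl
    rw [finsum_eq_single _ (weight x.2)]
    · rw [if_pos rfl]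
    · intro N hN
      rw [if_neg (Ne.symm hN)]
  · intro x _
    refine (Set.finite_singleton (weight x.2)).subset fun N hN => ?_
    by_contra hc
    exact hN (if_neg fun h => hc h.symm)

end Psi

end CKP

end

noncomputable section

namespace CKP

open Finset

variable {R : Type*} [CommRing R] [Algebra ℂ R]

namespace Psi

lemma adj_adj {D : Derivation ℂ R R} (A : Psi D) : adj (adj A) = A := by
  rw [← sub_eq_zero]
  refine addMonoidHom_end_eq_zero (adj.comp adj - AddMonoidHom.id _) 0 ?_ ?_ A
  · intro b i
    simp only [AddMonoidHom.sub_apply, AddMonoidHom.comp_apply, AddMonoidHom.id_apply]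
    rw [adj_fn_mul_dpow, map_zsmul, adj_dpow_mul, adj_fn, ← Units.smul_def, ← Units.smul_def,
      smul_smul, Int.units_mul_self, one_smul, sub_self]
  · intro A N hA
    exact (OrdLE.sub hA.adj.adj hA).mono (by omega)

lemma tderiv_adj {D δ : Derivation ℂ R R} (h : ∀ f, δ (D f) = D (δ f)) (A : Psi D) :
    tderiv δ (adj A) = adj (tderiv δ A) := by
  rw [← sub_eq_zero]
  refine addMonoidHom_end_eq_zero ((tderiv δ).comp adj - adj.comp (tderiv δ)) 0 ?_ ?_ A
  · intro b i
    simp only [AddMonoidHom.sub_apply, AddMonoidHom.comp_apply]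
    rw [adj_fn_mul_dpow, map_zsmul, tderiv_mul h, tderiv_mul h, tderiv_dpow, tderiv_fn, mul_zero,
      add_zero, zero_mul, zero_add, adj_fn_mul_dpow, sub_self]
  · intro A N hA
    exact (OrdLE.sub (hA.adj.tderiv δ) (hA.tderiv δ).adj).mono (by omega)

lemma app_dpow {D : Derivation ℂ R R} (i : ℕ) (f : R) : app (dpow D i) f = D^[i] f := by
  induction i with
  | zero => simp
  | succ i ih =>
    have h1 : app (dpow D 1) (D^[i] f) = D (D^[i] f) := by
      rw [app, dpow_one_mul_fn]
      simp [coeff_fn]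
    rw [Function.iterate_succ_apply', ← h1, ← ih, ← app_mul (dpow_mem_Diff (by omega))
      (dpow_mem_Diff (by omega)), dpow_mul_dpow]
    congr 2
    push_cast; ring

lemma applyNonneg_eq {D : Derivation ℂ R R} (A : Psi D) (f : R) :
    PseudoDiffOp.applyNonneg D A f = app (pos A) f := by
  obtain ⟨M, hM⟩ := exists_ordLE A
  have h : pos A = ∑ i ∈ range (M.toNat + 1), fn D (A.coeff i) * dpow D i := by
    ext p
    rw [coeff_pos, coeff_sum]
    simp only [coeff_fn_mul, coeff_dpow, mul_ite, mul_one, mul_zero]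
    split_ifs with hp
    · obtain ⟨j, rfl⟩ := Int.eq_ofNat_of_zero_le hp
      simp only [Nat.cast_inj]
      rw [Finset.sum_ite_eq]
      split_ifs with hj
      · rfl
      · rw [mem_range] at hj
        exact hM _ (by omega)
    · rw [Finset.sum_eq_zero]
      intro i _
      rw [if_neg (by omega)]
  rw [h, app_sum_left]
  change ∑ᶠ i : ℕ, A.coeff i * D^[i] f = _
  rw [finsum_eq_sum_of_support_subset (s := range (M.toNat + 1))]
  · refine sum_congr rfl fun i _ => ?_
    rw [app_fn_mul_left, app_dpow]
  · intro i hi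
    by_contra hc
    simp only [coe_range, Set.mem_Iio, not_lt] at hc
    refine hi ?_
    change A.coeff i * _ = 0
    rw [hM _ (by omega), zero_mul]

lemma pow_eq {D : Derivation ℂ R R} (A : Psi D) (n : ℕ) : PseudoDiffOp.pow D A n = A ^ n := by
  induction n with
  | zero => rfl
  | succ n ih =>
    rw [pow_succ, ← ih]; rfl

end Psi

open Psi

lemma isEigenfunction_iff {d : ℕ → Derivation ℂ R R} (L : Psi (d 0)) (q : R) :
    IsEigenfunction d L q ↔ ∀ k, d k q = app (pos (L ^ (2 * k + 1))) q := by
  refine forall_congr' fun k => ?_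
  rw [pow_eq, applyNonneg_eq]

lemma isSEP_iff {d : ℕ → Derivation ℂ R R} (L : Psi (d 0)) (q r Ω : R) :
    IsSEP d L q r Ω ↔ ∀ k, d k Ω = res (dpow (d 0) (-1) * fn (d 0) r *
      (pos (L ^ (2 * k + 1)) * (fn (d 0) q * dpow (d 0) (-1)))) := by
  refine forall_congr' fun k => ?_
  rw [pow_eq, ← mono_eq]
  rfl

/-! ### Sato equations -/

/-- The Sato equations: `W = 1 + O(∂⁻¹)` satisfies `W W^* = 1`, and the wave function `W(e^ξ)`
evolves under the differential operators `B k`. -/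
structure IsSato (d : ℕ → Derivation ℂ R R) (W : Psi (d 0)) (B : ℕ → Psi (d 0)) : Prop where
  ordLE : OrdLE W 0
  coeff_zero : W.coeff 0 = 1
  mul_adj : W * adj W = 1
  mem_Diff : ∀ k, B k ∈ Diff (d 0)
  nabla_eq : ∀ k, nabla d k W = B k * W

section Sato

variable {d : ℕ → Derivation ℂ R R} (hd : ∀ (i j : ℕ) (f : R), d i (d j f) = d j (d i f))

lemma nabla_zero (U : Psi (d 0)) : nabla d 0 U = dpow (d 0) 1 * U :=
  (dpow_one_mul U).symm

include hd

lemma nabla_mul (k : ℕ) (Q U : Psi (d 0)) :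
    nabla d k (Q * U) = tderiv (d k) Q * U + Q * nabla d k U := by
  rw [nabla, nabla, tderiv_mul (fun f => hd k 0 f)]
  noncomm_ring

namespace IsSato

omit hd in
lemma eq_nabla_mul {W : Psi (d 0)} {B : ℕ → Psi (d 0)} (h : IsSato d W B) (k : ℕ) :
    B k = nabla d k W * adj W := by
  rw [h.nabla_eq, mul_assoc, h.mul_adj, mul_one]

omit hd in
lemma eq_of_mul_eq {W : Psi (d 0)} {B : ℕ → Psi (d 0)} (h : IsSato d W B) {A C : Psi (d 0)}
    (hAC : A * W = C * W) : A = C := by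
  rw [← mul_one A, ← h.mul_adj, ← mul_assoc, hAC, mul_assoc, h.mul_adj, mul_one]

/-- The operators `B k` are skew-adjoint. -/
lemma adj_B {W : Psi (d 0)} {B : ℕ → Psi (d 0)} (h : IsSato d W B) (k : ℕ) :
    adj (B k) = -B k := by
  have h1 := congrArg (tderiv (d k)) h.mul_adj
  rw [tderiv_mul (fun f => hd k 0 f), tderiv_one] at h1
  have h2 : adj (dpow (d 0) (2 * k + 1)) = -dpow (d 0) (2 * k + 1) := by
    rw [adj_dpow, Int.negOnePow_two_mul_add_one]; simp
  rw [h.eq_nabla_mul, Psi.adj_mul, adj_adj, nabla, map_add, Psi.adj_mul, h2,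
    ← tderiv_adj (fun f => hd k 0 f), eq_neg_iff_add_eq_zero, ← h1]
  noncomm_ring

omit hd in
/-- `B k` is the differential part of `L ^ (2k+1)`, where `L = W ∂ W⁻¹`. -/
lemma B_eq {W : Psi (d 0)} {B : ℕ → Psi (d 0)} (h : IsSato d W B) {L : Psi (d 0)}
    (hL : L * W = W * dpow (d 0) 1) (k : ℕ) : B k = pos (L ^ (2 * k + 1)) := by
  have hpow : ∀ n : ℕ, L ^ n * W = W * dpow (d 0) n := by
    intro n
    induction n with
    | zero => simp
    | succ n ih =>
      rw [pow_succ, mul_assoc, hL, ← mul_assoc, ih, mul_assoc, dpow_mul_dpow]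
      push_cast; rfl
  have h1 : B k = tderiv (d k) W * adj W + L ^ (2 * k + 1) := by
    have e := hpow (2 * k + 1)
    push_cast at e
    rw [h.eq_nabla_mul, nabla, ← e, add_mul, mul_assoc _ W, h.mul_adj, mul_one]
  rw [← pos_of_mem_Diff (h.mem_Diff k)]
  conv_lhs => rw [h1]
  rw [map_add, pos_of_ordLE, zero_add]
  exact OrdLE.mul (M := -1) (N := 0) (ordLE_tderiv_of_coeff_zero _ h.ordLE h.coeff_zero)
    h.ordLE.adj

/-- The Sato equations imply that `L = W ∂ W⁻¹` is a CKP Lax operator. -/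
lemma isCKPLax {W : Psi (d 0)} {B : ℕ → Psi (d 0)} (h : IsSato d W B) {L : Psi (d 0)}
    (hL : L * W = W * dpow (d 0) 1) : IsCKPLax d L := by
  have hLe : L = W * dpow (d 0) 1 * adj W := by
    rw [← hL, mul_assoc, h.mul_adj, mul_one]
  have hord : OrdLE L 1 := by
    rw [hLe]
    exact ((h.ordLE.mul (ordLE_dpow 1)).mul h.ordLE.adj).mono (by omega)
  have hadj : adj L = -L := by
    rw [hLe, Psi.adj_mul, Psi.adj_mul, adj_adj, adj_dpow]
    simp [mul_assoc]
  have hL1 : L.coeff 1 = 1 := by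
    have h1 := coeff_mul_top hord h.ordLE
    rw [hL, h.coeff_zero, coeff_mul_dpow, mul_one] at h1
    exact h1.symm.trans (by simpa using h.coeff_zero)
  refine ⟨hord, hL1, ?_, hadj, fun k => ?_⟩
  · -- the coefficient of `∂ ^ 0` in `L^* = -L` gives `2 L_0 = 0`, as `L_1 = 1`
    have h2 : (adj L).coeff 0 = L.coeff 0 := by
      rw [coeff_adj, finsum_eq_single _ 0]
      · simp
      · intro k hk
        by_cases hk1 : k = 1
        · subst hk1
          simp [hL1]
        · rw [hord _ (by omega), iterate_map_zero, smul_zero, smul_zero]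
    rw [hadj, coeff_neg] at h2
    refine eq_of_nsmul_eq two_ne_zero ?_
    change 2 • L.coeff 0 = 2 • (0 : R)
    rw [smul_zero, two_nsmul]
    nth_rw 1 [← h2]
    exact neg_add_cancel _
  · rw [pow_eq]
    change tderiv (d k) L = pos (L ^ (2 * k + 1)) * L - L * pos (L ^ (2 * k + 1))
    rw [← h.B_eq hL]
    apply h.eq_of_mul_eq
    have h1 := congrArg (tderiv (d k)) hL
    rw [tderiv_mul (fun f => hd k 0 f), tderiv_mul (fun f => hd k 0 f), tderiv_dpow, mul_zero,
      add_zero] at h1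
    have h2 : tderiv (d k) W = B k * W - W * dpow (d 0) (2 * k + 1) := by
      rw [← h.nabla_eq, nabla, add_sub_cancel_right]
    have h3 : L * (W * dpow (d 0) (2 * k + 1)) = W * dpow (d 0) (2 * k + 1) * dpow (d 0) 1 := by
      rw [← mul_assoc, hL, mul_assoc, mul_assoc, dpow_mul_dpow, dpow_mul_dpow, add_comm]
    rw [eq_sub_of_add_eq h1, h2, mul_sub, sub_mul, h3, sub_mul, mul_assoc (B k) L, hL]
    noncomm_ring

end IsSato

omit hd in
lemma multiIndex_induction {P : (ℕ →₀ ℕ) → Prop} (h0 : P 0)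
    (hs : ∀ α k, P α → P (α + Finsupp.single k 1)) (α : ℕ →₀ ℕ) : P α := by
  induction α using Finsupp.induction with
  | zero => exact h0
  | single_add a b f _ _ ih =>
    clear * - ih hs
    induction b with
    | zero => simpa using ih
    | succ b ihb =>
      have := hs _ a ihb
      rwa [add_right_comm, ← Finsupp.single_add] at this

omit hd in
lemma eq_fn_mul_of_nsmul_eq {D : Derivation ℂ R R} {n : ℕ} {A C : Psi D} (h : (n + 1) • A = C) :
    A = fn D (algebraMap ℂ R (n + 1 : ℂ)⁻¹) * C := by
  have hn : ((n + 1 : ℕ) : ℂ) ≠ 0 := Nat.cast_ne_zero.mpr n.succ_ne_zero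
  rw [← h, mul_smul_comm, ← smul_mul_assoc, ← map_nsmul, ← map_nsmul, nsmul_eq_mul]
  rw [show (n + 1 : ℂ) = (n + 1 : ℕ) by push_cast; rfl, mul_inv_cancel₀ hn, map_one, map_one,
    one_mul]

omit hd in
lemma eq_algebraMap_mul_of_nsmul_eq {n : ℕ} {a c : R} (h : (n + 1) • a = c) :
    a = algebraMap ℂ R (n + 1 : ℂ)⁻¹ * c := by
  have hn : ((n + 1 : ℕ) : ℂ) ≠ 0 := Nat.cast_ne_zero.mpr n.succ_ne_zero
  rw [← h, ← Nat.cast_smul_eq_nsmul ℂ, ← Algebra.smul_def, smul_smul]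
  push_cast at hn ⊢
  rw [inv_mul_cancel₀ hn, one_smul]

/-- The bilinear equation implies the Sato equations. -/
lemma isSato_of_bilinear {w : PowerSeries R} (hw : PowerSeries.constantCoeff w = 1)
    (h : Bilinear d w) : IsSato d (ser (d 0) w) fun k =>
      nabla d k (ser (d 0) w) * adj (ser (d 0) w) := by
  set W := ser (d 0) w with hW
  have hW0 : W.coeff 0 = 1 := by rw [hW, coeff_ser]; simpa using hw
  rw [bilinear_iff] at h
  have key : ∀ (j : ℕ) α, res (dpow (d 0) j * (waveTaylor d W α * adj W)) = 0 := by
    intro j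
    induction j with
    | zero => intro α; simpa using h α
    | succ j ih =>
      intro α
      have h1 := nsmul_waveTaylor_add_single hd W α 0
      rw [nabla_zero] at h1
      have : dpow (d 0) (j + 1 : ℕ) * (waveTaylor d W α * adj W) =
          (α 0 + 1) • (dpow (d 0) j * (waveTaylor d W (α + Finsupp.single 0 1) * adj W)) := by
        rw [← mul_smul_comm, ← smul_mul_assoc, h1, mul_assoc, dpow_mul_dpow_assoc]
        push_cast; rfl
      rw [this, res, coeff_nsmul]
      change _ • res _ = 0
      rw [ih, smul_zero]
  have hunit : W * adj W = 1 := by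
    have h1 : W * adj W ∈ Diff (d 0) := mem_Diff_of_res_eq_zero fun k => by
      simpa using key k 0
    have h2 : OrdLE (W * adj W - 1) (-1) := by
      intro p hp
      have h3 := (ordLE_ser w).mul (ordLE_ser (D := d 0) w).adj
      rcases eq_or_lt_of_le (show (0 : ℤ) ≤ p by omega) with rfl | h4
      · have := coeff_mul_top (ordLE_ser (D := d 0) w) (ordLE_ser (D := d 0) w).adj
        rw [coeff_adj_zero (ordLE_ser w), ← hW, hW0] at this
        rw [coeff_sub, coeff_one, if_pos rfl, sub_eq_zero]
        simpa using this
      · rw [coeff_sub, coeff_one, if_neg (by omega), h3 p (by omega), sub_zero]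
    exact sub_eq_zero.mp (eq_zero_of_mem_Diff_of_ordLE (sub_mem h1 (one_mem _)) h2)
  refine ⟨ordLE_ser w, hW0, hunit, fun k => mem_Diff_of_res_eq_zero fun j => ?_, fun k => ?_⟩
  · have h1 := nsmul_waveTaylor_add_single hd W 0 k
    rw [waveTaylor_zero] at h1
    simp only [Finsupp.coe_zero, Pi.zero_apply, zero_add, one_smul] at h1
    rw [← h1]
    exact key j _
  · rw [mul_assoc, adj_mul_self_eq_one (ordLE_ser w) hW0 hunit, mul_one]

/-- A common differential operator `Q` which produces `T α` from `W` and `t α` from `q` propagates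
to the next multi-index, if `T` and `t` are the Taylor coefficients of a wave function and of a
function. -/
lemma exists_diff_step {W : Psi (d 0)} {B : ℕ → Psi (d 0)} (h : IsSato d W B) {q : R}
    (hq : ∀ k, d k q = app (B k) q) {T : (ℕ →₀ ℕ) → Psi (d 0)} {t : (ℕ →₀ ℕ) → R}
    {α : ℕ →₀ ℕ} {k : ℕ}
    (hT : (α k + 1) • T (α + Finsupp.single k 1) = nabla d k (T α))
    (ht : (α k + 1) • t (α + Finsupp.single k 1) = d k (t α))
    (hQ : ∃ Q ∈ Diff (d 0), T α = Q * W ∧ t α = app Q q) :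
    ∃ Q ∈ Diff (d 0), T (α + Finsupp.single k 1) = Q * W ∧
      t (α + Finsupp.single k 1) = app Q q := by
  obtain ⟨Q, hQ, h1, h2⟩ := hQ
  refine ⟨fn (d 0) (algebraMap ℂ R (α k + 1 : ℂ)⁻¹) * (tderiv (d k) Q + Q * B k),
    mul_mem (fn_mem_Diff _) (add_mem (tderiv_mem_Diff _ hQ) (mul_mem hQ (h.mem_Diff k))), ?_, ?_⟩
  · rw [eq_fn_mul_of_nsmul_eq hT, h1, nabla_mul hd, h.nabla_eq]
    noncomm_ring
  · rw [eq_algebraMap_mul_of_nsmul_eq ht, h2, app_tderiv (fun f => hd k 0 f), hq k, app_fn_mul_left,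
      app_add_left, app_mul hQ (h.mem_Diff k)]

lemma IsSato.exists_waveTaylor_eq {W : Psi (d 0)} {B : ℕ → Psi (d 0)} (h : IsSato d W B) {q : R}
    (hq : ∀ k, d k q = app (B k) q) (α : ℕ →₀ ℕ) :
    ∃ Q ∈ Diff (d 0), waveTaylor d W α = Q * W ∧ taylorCoeff d q α = app Q q := by
  induction α using multiIndex_induction with
  | h0 => exact ⟨1, one_mem _, by simp, by simp⟩
  | hs α k ih =>
    exact exists_diff_step hd h hq (nsmul_waveTaylor_add_single hd W α k)
      (nsmul_taylorCoeff_add_single hd q α k) ih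

/-- The Sato equations imply the bilinear equation. -/
lemma IsSato.bilinear {w : PowerSeries R} {B : ℕ → Psi (d 0)}
    (h : IsSato d (ser (d 0) w) B) : Bilinear d w := by
  rw [bilinear_iff]
  intro α
  obtain ⟨Q, hQ, h1, -⟩ := h.exists_waveTaylor_eq hd (q := 0) (by simp) α
  rw [h1, mul_assoc, h.mul_adj, mul_one, res_of_mem_Diff hQ]

/-- The bilinear identity for an eigenfunction `q`: with `χ` the symbol of `∂⁻¹ q W`,
`q(t_o + s)` is minus the residue of `w(t_o + s, λ) χ(t_o, -λ) e^{ξ(s, λ)}`. -/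
lemma IsSato.taylorCoeff_eigenfunction {W : Psi (d 0)} {B : ℕ → Psi (d 0)} (h : IsSato d W B)
    {q : R} (hq : ∀ k, d k q = app (B k) q) (α : ℕ →₀ ℕ) :
    taylorCoeff d q α =
      -res (waveTaylor d W α * adj (dpow (d 0) (-1) * fn (d 0) q * W)) := by
  obtain ⟨Q, hQ, h1, h2⟩ := h.exists_waveTaylor_eq hd hq α
  rw [h1, h2, Psi.adj_mul, Psi.adj_mul, adj_fn, adj_dpow_neg_one, app_eq_res, ← res_neg,
    mul_assoc Q W, ← mul_assoc W, h.mul_adj]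
  congr 1
  noncomm_ring

/-- The derivatives of the potential `Ω = Ω(q, q)` and of the wave function `(∂⁻¹ q W)(e^ξ)` are
given by the same differential operators. -/
lemma IsSato.nabla_integral {W : Psi (d 0)} {B : ℕ → Psi (d 0)} (h : IsSato d W B) {q Ω : R}
    (hq : ∀ k, d k q = app (B k) q)
    (hΩ : ∀ k, d k Ω = res (dpow (d 0) (-1) * fn (d 0) q *
      (B k * (fn (d 0) q * dpow (d 0) (-1))))) (k : ℕ) :
    ∃ S ∈ Diff (d 0), nabla d k (dpow (d 0) (-1) * fn (d 0) q * W) = S * W ∧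
      d k Ω = app S q := by
  refine ⟨_, dpow_mul_fn_mul_add_mem_Diff (h.mem_Diff k) (h.adj_B hd k) q, ?_, ?_⟩
  · rw [nabla_mul hd, h.nabla_eq, tderiv_mul (fun f => hd k 0 f), tderiv_dpow, tderiv_fn, hq]
    noncomm_ring
  · rw [app_add_left, hΩ, app_eq_res, app_eq_res]
    have : res (dpow (d 0) (-1) * fn (d 0) (app (B k) q) * fn (d 0) q * dpow (d 0) (-1)) = 0 :=
      res_of_ordLE ((((ordLE_dpow _).mul (ordLE_fn _)).mul (ordLE_fn _)).mul (ordLE_dpow _))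
    rw [this, add_zero]
    congr 1
    noncomm_ring

/-- The bilinear identity for a squared eigenfunction potential. -/
lemma IsSato.taylorCoeff_potential {W : Psi (d 0)} {B : ℕ → Psi (d 0)} (h : IsSato d W B)
    {q Ω : R} (hq : ∀ k, d k q = app (B k) q)
    (hΩ : ∀ k, d k Ω = res (dpow (d 0) (-1) * fn (d 0) q *
      (B k * (fn (d 0) q * dpow (d 0) (-1))))) (α : ℕ →₀ ℕ) :
    taylorCoeff d Ω α = (if α = 0 then Ω else 0) -
      res (waveTaylor d (dpow (d 0) (-1) * fn (d 0) q * W) α *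
        adj (dpow (d 0) (-1) * fn (d 0) q * W)) := by
  set X := dpow (d 0) (-1) * fn (d 0) q * W with hX
  have key : α = 0 ∨ ∃ S ∈ Diff (d 0), waveTaylor d X α = S * W ∧ taylorCoeff d Ω α = app S q := by
    induction α using multiIndex_induction with
    | h0 => exact Or.inl rfl
    | hs α k ih =>
      right
      rcases ih with rfl | ih
      · obtain ⟨S, hS, h1, h2⟩ := h.nabla_integral hd hq hΩ k
        refine ⟨S, hS, ?_, ?_⟩
        · have := nsmul_waveTaylor_add_single hd X 0 k
          rw [← h1]; simpa using this
        · have := nsmul_taylorCoeff_add_single hd Ω 0 k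
          rw [← h2]; simpa using this
      · exact exists_diff_step hd h hq (nsmul_waveTaylor_add_single hd X α k)
          (nsmul_taylorCoeff_add_single hd Ω α k) ih
  by_cases h0 : α = 0
  · have hXo : OrdLE X (-1) :=
      OrdLE.mul (M := -1 + 0) (N := 0) ((ordLE_dpow _).mul (ordLE_fn _)) h.ordLE
    rw [if_pos h0, h0, taylorCoeff_zero, waveTaylor_zero, res_of_ordLE (hXo.mul hXo.adj), sub_zero]
  · obtain ⟨S, hS, h1, h2⟩ := key.resolve_left h0
    rw [if_neg h0, h1, h2, hX, Psi.adj_mul, Psi.adj_mul, adj_fn, adj_dpow_neg_one, app_eq_res,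
      zero_sub, ← res_neg, mul_assoc S W, ← mul_assoc W, h.mul_adj]
    congr 1
    noncomm_ring

end Sato

end CKP

end

noncomputable section

namespace CKP

open Finset

variable {R : Type*} [CommRing R] [Algebra ℂ R]

/-! ### Miwa shifts of families indexed by multi-indices -/

lemma mem_ofWeight {N : ℕ} {α : ℕ →₀ ℕ} : α ∈ ofWeight N ↔ weight α = N := by
  simp [ofWeight]

/-- The value of the monomial `s ^ α` at `s_{2k+1} = -2 / (2k+1)`. -/
def miwaMonomial (α : ℕ →₀ ℕ) : ℂ := α.prod fun k m => (-2 / (2 * k + 1) : ℂ) ^ m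

lemma miwaMonomial_add (α β : ℕ →₀ ℕ) :
    miwaMonomial (α + β) = miwaMonomial α * miwaMonomial β :=
  Finsupp.prod_add_index' (fun _ => pow_zero _) (fun _ _ _ => pow_add _ _ _)

lemma miwaMonomial_single (k : ℕ) : miwaMonomial (Finsupp.single k 1) = -2 / (2 * k + 1) := by
  simp [miwaMonomial]

/-- The coefficient of `λ ^ (-N)` in the power series `∑ t_α s ^ α` at
`s_{2k+1} = -2 λ ^ (-(2k+1)) / (2k+1)`. -/
def miwaSum {M : Type*} [AddCommGroup M] [Module ℂ M] (t : (ℕ →₀ ℕ) → M) (N : ℕ) : M :=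
  ∑ α ∈ ofWeight N, miwaMonomial α • t α

section miwaSum

variable {M : Type*} [AddCommGroup M] [Module ℂ M]

lemma ofWeight_zero : ofWeight 0 = {0} := by
  ext α
  rw [mem_ofWeight, mem_singleton]
  refine ⟨fun h => ?_, fun h => by rw [h]; rfl⟩
  ext k
  have := le_weight α k
  rw [h] at this
  simpa using this

lemma miwaSum_zero (t : (ℕ →₀ ℕ) → M) : miwaSum t 0 = t 0 := by
  rw [miwaSum, ofWeight_zero, sum_singleton]
  simp [miwaMonomial]

lemma weight_eq_sum {N : ℕ} {α : ℕ →₀ ℕ} (h : weight α = N + 1) :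
    ∑ k ∈ range (N / 2 + 1), (2 * k + 1) * α k = N + 1 := by
  rw [← h]
  symm
  refine Finset.sum_subset (fun k hk => ?_) fun k _ hk => ?_
  · have h1 := le_weight α k
    rw [h] at h1
    have h2 : 1 ≤ α k := Nat.one_le_iff_ne_zero.mpr (Finsupp.mem_support_iff.mp hk)
    rw [mem_range]
    have : 2 * k + 1 ≤ N + 1 := by nlinarith
    omega
  · simp only [Finsupp.notMem_support_iff.mp hk, mul_zero]

/-- Euler's identity for the Miwa shift, which reflects `λ ∂_λ s_{2k+1} = 2 λ ^ (-(2k+1))`. -/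
lemma nsmul_miwaSum_succ (t : (ℕ →₀ ℕ) → M) (t' : ℕ → (ℕ →₀ ℕ) → M)
    (h : ∀ α k, (α k + 1) • t (α + Finsupp.single k 1) = t' k α) (N : ℕ) :
    (N + 1) • miwaSum t (N + 1) =
      ∑ k ∈ range (N / 2 + 1), (-2 : ℂ) • miwaSum (t' k) (N - 2 * k) := by
  have e1 : (N + 1) • miwaSum t (N + 1) = ∑ α ∈ ofWeight (N + 1),
      ∑ k ∈ range (N / 2 + 1), ((2 * k + 1) * α k) • miwaMonomial α • t α := by
    rw [miwaSum, smul_sum]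
    refine sum_congr rfl fun α hα => ?_
    rw [← sum_smul, weight_eq_sum (mem_ofWeight.mp hα)]
  rw [e1, sum_comm]
  refine sum_congr rfl fun k hk => ?_
  have hk' : 2 * k ≤ N := by rw [mem_range] at hk; omega
  rw [miwaSum, smul_sum]
  symm
  refine Finset.sum_of_injOn (fun β => β + Finsupp.single k 1) ?_ ?_ ?_ ?_
  · intro a _ b _ hab
    simpa using hab
  · intro β hβ
    rw [mem_coe, mem_ofWeight] at hβ ⊢
    rw [weight_add, weight_single, hβ]
    omega
  · intro α hα hα'
    have h0 : α k = 0 := by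
      by_contra hc
      have hle : Finsupp.single k 1 ≤ α := by
        rw [Finsupp.single_le_iff]; omega
      refine hα' ⟨α - Finsupp.single k 1, ?_, tsub_add_cancel_of_le hle⟩
      rw [mem_ofWeight] at hα
      rw [mem_coe, mem_ofWeight]
      have := weight_add (α - Finsupp.single k 1) (Finsupp.single k 1)
      rw [tsub_add_cancel_of_le hle, weight_single, hα] at this
      omega
    simp [h0]
  · intro β _
    have hne : (2 * k + 1 : ℂ) ≠ 0 := by exact_mod_cast Nat.succ_ne_zero (2 * k)
    rw [← h, miwaMonomial_add, miwaMonomial_single]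
    simp only [Finsupp.add_apply, Finsupp.single_eq_same, ← Nat.cast_smul_eq_nsmul ℂ, smul_smul]
    congr 1
    push_cast
    field_simp

omit [Module ℂ M] in
lemma sum_ofWeight_antidiagonal (F : (ℕ →₀ ℕ) → (ℕ →₀ ℕ) → M) (n : ℕ) :
    ∑ α ∈ ofWeight n, ∑ x ∈ HasAntidiagonal.antidiagonal α, F x.1 x.2 =
      ∑ y ∈ HasAntidiagonal.antidiagonal n, ∑ β ∈ ofWeight y.1, ∑ γ ∈ ofWeight y.2, F β γ := by
  simp only [← sum_product']
  rw [sum_sigma', sum_sigma']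
  refine Finset.sum_nbij' (fun s => ⟨(weight s.2.1, weight s.2.2), s.2⟩)
    (fun s => ⟨s.2.1 + s.2.2, s.2⟩) ?_ ?_ ?_ ?_ ?_
  · rintro ⟨α, β, γ⟩ h
    simp only [mem_sigma, mem_ofWeight, HasAntidiagonal.mem_antidiagonal, mem_product] at h ⊢
    rw [← weight_add, h.2]
    exact ⟨h.1, trivial, trivial⟩
  · rintro ⟨⟨a, b⟩, β, γ⟩ h
    simp only [mem_sigma, mem_ofWeight, HasAntidiagonal.mem_antidiagonal, mem_product] at h ⊢
    rw [weight_add, h.2.1, h.2.2]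
    exact ⟨h.1, trivial⟩
  · rintro ⟨α, β, γ⟩ h
    simp only [mem_sigma, mem_ofWeight, HasAntidiagonal.mem_antidiagonal] at h
    simp [h.2]
  · rintro ⟨⟨a, b⟩, β, γ⟩ h
    simp only [mem_sigma, mem_ofWeight, HasAntidiagonal.mem_antidiagonal, mem_product] at h
    simp [h.2.1, h.2.2]
  · rintro ⟨α, β, γ⟩ _
    rfl

/-- The coefficients of `e^{ξ(s, μ)} = (1 - μ / λ) / (1 + μ / λ)` at `s = -2[λ⁻¹]_o`. -/
lemma miwaSum_exp (b : ℕ) : miwaSum (fun γ => (multiFactorial γ)⁻¹) b =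
    if b = 0 then 1 else 2 * (-1) ^ b := by
  have hrec := nsmul_miwaSum_succ (fun γ => (multiFactorial γ)⁻¹)
    (fun _ γ => (multiFactorial γ)⁻¹) (fun α k => by
      rw [multiFactorial_add_single, nsmul_eq_mul, mul_inv, ← mul_assoc,
        mul_inv_cancel₀ (Nat.cast_ne_zero.mpr (Nat.succ_ne_zero _)), one_mul])
  induction b using Nat.strong_induction_on with
  | _ b ih =>
    cases b with
    | zero => rw [miwaSum_zero]; simp
    | succ N =>
      have h1 := hrec N
      have h2 : ∀ k ∈ range (N / 2 + 1), (-2 : ℂ) • miwaSum (fun γ => (multiFactorial γ)⁻¹)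
          (N - 2 * k) = if N = 2 * k then -2 else -4 * (-1) ^ N := by
        intro k hk
        rw [mem_range] at hk
        rw [ih _ (by omega)]
        have e : (-1 : ℂ) ^ N = (-1) ^ (N - 2 * k) := by
          conv_lhs => rw [show N = N - 2 * k + 2 * k by omega]
          rw [pow_add, pow_mul]; simp
        by_cases h : N = 2 * k
        · rw [if_pos (by omega), if_pos h]; simp
        · rw [if_neg (by omega), if_neg h, e, smul_eq_mul]; ring
      rw [sum_congr rfl h2] at h1
      have hne : ((N + 1 : ℕ) : ℂ) ≠ 0 := Nat.cast_ne_zero.mpr (Nat.succ_ne_zero _)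
      rw [if_neg (Nat.succ_ne_zero _)]
      rw [nsmul_eq_mul] at h1
      refine mul_left_cancel₀ hne (h1.trans ?_)
      rcases Nat.even_or_odd' N with ⟨m, rfl | rfl⟩
      · rw [show 2 * m / 2 + 1 = m + 1 by omega, sum_range_succ, if_pos rfl,
          sum_congr rfl (g := fun _ => (-4 : ℂ)) fun k hk => ?_]
        · simp [pow_succ]; ring
        · rw [mem_range] at hk
          rw [if_neg (by omega), pow_mul]; simp
      · rw [show (2 * m + 1) / 2 + 1 = m + 1 by omega,
          sum_congr rfl (g := fun _ => (4 : ℂ)) fun k hk => ?_]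
        · simp [pow_succ]; ring
        · rw [if_neg (by omega), pow_succ, pow_mul]; simp

end miwaSum

lemma coeff_miwaShift (d : ℕ → Derivation ℂ R R) (f : R) (N : ℕ) :
    PowerSeries.coeff N (miwaShift d f) = miwaSum (taylorCoeff d f) N :=
  PowerSeries.coeff_mk _ _

/-- The recursion which determines the Miwa shift. -/
lemma nsmul_coeff_miwaShift_succ {d : ℕ → Derivation ℂ R R}
    (hd : ∀ (i j : ℕ) (f : R), d i (d j f) = d j (d i f)) (f : R) (N : ℕ) :
    (N + 1) • PowerSeries.coeff (N + 1) (miwaShift d f) =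
      ∑ k ∈ range (N / 2 + 1), (-2 : ℂ) • d k (PowerSeries.coeff (N - 2 * k) (miwaShift d f)) := by
  rw [coeff_miwaShift, nsmul_miwaSum_succ _ (fun k α => d k (taylorCoeff d f α))
    (fun α k => nsmul_taylorCoeff_add_single hd f α k)]
  refine sum_congr rfl fun k _ => ?_
  rw [coeff_miwaShift, miwaSum, miwaSum, map_sum]
  simp only [Derivation.map_smul]

/-! ### The involution of the Miwa shift -/

section MiwaInvolution

variable (d : ℕ → Derivation ℂ R R)

open PowerSeries

/-- The coefficients of `miwaInv`. -/
def miwaInvCoeff : ℕ → PowerSeries R → R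
  | 0, F => constantCoeff F
  | n + 1, F => algebraMap ℂ R ((n + 1 : ℕ) : ℂ)⁻¹ * (-miwaInvCoeff n (derivative R F) -
      2 * ∑ k ∈ range (n / 2 + 1), d k (miwaInvCoeff (n - 2 * k) F))
termination_by n => n
decreasing_by all_goals omega

/-- The transformation `F(t_o, λ) ↦ F(t_o - 2[λ⁻¹]_o, -λ)` of power series in `λ⁻¹`, defined as
the solution of `∂_z σ(F) + 2 ∑ k, z ^ (2k) ∂σ(F) / ∂t_{2k+1} = -σ(∂_z F)`, `z = λ⁻¹`, with the same
constant term as `F`. -/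
def miwaInv (F : PowerSeries R) : PowerSeries R := PowerSeries.mk fun n => miwaInvCoeff d n F

/-- The derivation `∑ k, z ^ (2k) ∂ / ∂t_{2k+1}`. -/
def timeSum (F : PowerSeries R) : PowerSeries R :=
  PowerSeries.mk fun n => ∑ k ∈ range (n / 2 + 1), d k (coeff (n - 2 * k) F)

variable {d}

lemma coeff_seriesDeriv (δ : Derivation ℂ R R) (F : PowerSeries R) (n : ℕ) :
    coeff n (seriesDeriv δ F) = δ (coeff n F) := coeff_mk _ _

lemma seriesDeriv_mul (δ : Derivation ℂ R R) (F G : PowerSeries R) :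
    seriesDeriv δ (F * G) = seriesDeriv δ F * G + F * seriesDeriv δ G := by
  ext n
  simp only [map_add, coeff_seriesDeriv, coeff_mul, map_sum, Derivation.leibniz, smul_eq_mul]
  rw [sum_add_distrib, add_comm]
  congr 1
  refine sum_congr rfl fun x _ => mul_comm _ _

lemma seriesDeriv_add (δ : Derivation ℂ R R) (F G : PowerSeries R) :
    seriesDeriv δ (F + G) = seriesDeriv δ F + seriesDeriv δ G := by
  ext n; simp [coeff_seriesDeriv]

lemma seriesDeriv_sub (δ : Derivation ℂ R R) (F G : PowerSeries R) :
    seriesDeriv δ (F - G) = seriesDeriv δ F - seriesDeriv δ G := by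
  ext n; simp [coeff_seriesDeriv]

lemma seriesDeriv_C (δ : Derivation ℂ R R) (a : R) : seriesDeriv δ (C a) = C (δ a) := by
  ext n
  rw [coeff_seriesDeriv, coeff_C, coeff_C]
  split_ifs <;> simp

lemma seriesDeriv_X (δ : Derivation ℂ R R) : seriesDeriv δ (X : PowerSeries R) = 0 := by
  ext n
  rw [coeff_seriesDeriv, coeff_X]
  split_ifs <;> simp

lemma seriesDeriv_derivative (δ : Derivation ℂ R R) (F : PowerSeries R) :
    seriesDeriv δ (derivative R F) = derivative R (seriesDeriv δ F) := by
  ext n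
  rw [coeff_seriesDeriv, coeff_derivative, coeff_derivative, coeff_seriesDeriv]
  have : ((n : R) + 1) = ((n + 1 : ℕ) : R) := by push_cast; rfl
  rw [this, mul_comm, ← nsmul_eq_mul, map_nsmul, nsmul_eq_mul, mul_comm]

omit [Algebra ℂ R] in
lemma eq_zero_of_forall_X_pow_dvd {F : PowerSeries R} (h : ∀ n, X ^ (n + 1) ∣ F) : F = 0 := by
  ext n
  exact X_pow_dvd_iff.mp (h n) n n.lt_succ_self

/-- The partial sums of `timeSum`. -/
lemma X_pow_dvd_timeSum_sub (F : PowerSeries R) (K : ℕ) :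
    X ^ K ∣ timeSum d F - ∑ k ∈ range K, X ^ (2 * k) * seriesDeriv (d k) F := by
  rw [X_pow_dvd_iff]
  intro n hn
  have e : ∀ k, coeff n (X ^ (2 * k) * seriesDeriv (d k) F) =
      if 2 * k ≤ n then d k (coeff (n - 2 * k) F) else 0 := fun k => by
    rw [coeff_X_pow_mul', coeff_seriesDeriv]
  rw [map_sub, timeSum, coeff_mk, map_sum, sub_eq_zero]
  simp only [e]
  refine (sum_congr rfl fun k hk => ?_).trans
    (sum_subset (range_subset_range.mpr (by omega)) fun k _ hk => if_neg ?_)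
  · rw [if_pos]; rw [mem_range] at hk; omega
  · rw [mem_range] at hk; omega

lemma timeSum_add (F G : PowerSeries R) :
    timeSum d (F + G) = timeSum d F + timeSum d G := by
  ext n
  simp [timeSum, sum_add_distrib]

lemma timeSum_sub (F G : PowerSeries R) :
    timeSum d (F - G) = timeSum d F - timeSum d G := by
  ext n
  simp [timeSum]

lemma timeSum_mul (F G : PowerSeries R) :
    timeSum d (F * G) = timeSum d F * G + F * timeSum d G := by
  rw [← sub_eq_zero]
  refine eq_zero_of_forall_X_pow_dvd fun n => ?_
  have h1 := X_pow_dvd_timeSum_sub (d := d) (F * G) (n + 1)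
  have h2 := (X_pow_dvd_timeSum_sub (d := d) F (n + 1)).mul_right G
  have h3 := (X_pow_dvd_timeSum_sub (d := d) G (n + 1)).mul_right F
  convert (h1.sub h2).sub h3 using 1
  simp only [seriesDeriv_mul, mul_add, sum_add_distrib, sub_mul, sum_mul]
  have e1 : ∑ k ∈ range (n + 1), X ^ (2 * k) * (F * seriesDeriv (d k) G) =
      ∑ k ∈ range (n + 1), X ^ (2 * k) * seriesDeriv (d k) G * F :=
    sum_congr rfl fun _ _ => by ring
  rw [e1]
  simp only [mul_assoc]
  ring

lemma timeSum_seriesDeriv (hd : ∀ (i j : ℕ) (f : R), d i (d j f) = d j (d i f)) (i : ℕ)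
    (F : PowerSeries R) : timeSum d (seriesDeriv (d i) F) = seriesDeriv (d i) (timeSum d F) := by
  ext n
  simp only [timeSum, coeff_mk, coeff_seriesDeriv, map_sum]
  exact sum_congr rfl fun k _ => hd _ _ _

lemma X_pow_dvd_timeSum {F : PowerSeries R} {n : ℕ} (h : X ^ n ∣ F) :
    X ^ n ∣ timeSum d F := by
  rw [X_pow_dvd_iff] at h ⊢
  intro m hm
  rw [timeSum, coeff_mk]
  exact sum_eq_zero fun k _ => by rw [h _ (by omega), map_zero]

lemma timeSum_one : timeSum d (1 : PowerSeries R) = 0 := by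
  have := timeSum_mul (d := d) 1 1
  simpa using this

lemma timeSum_X : timeSum d (X : PowerSeries R) = 0 := by
  ext n
  simp only [timeSum, coeff_mk, coeff_X, map_zero]
  refine sum_eq_zero fun k _ => ?_
  split_ifs <;> simp

lemma constantCoeff_miwaInv (F : PowerSeries R) :
    constantCoeff (miwaInv d F) = constantCoeff F := by
  rw [← coeff_zero_eq_constantCoeff_apply, miwaInv, coeff_mk, miwaInvCoeff]

/-- The evolution equation of the transformation `miwaInv`. -/
lemma derivative_miwaInv (F : PowerSeries R) : derivative R (miwaInv d F) =
    -2 * timeSum d (miwaInv d F) - miwaInv d (derivative R F) := by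
  ext n
  have hn : ((n + 1 : ℕ) : ℂ) ≠ 0 := Nat.cast_ne_zero.mpr n.succ_ne_zero
  have hi : algebraMap ℂ R ((n + 1 : ℕ) : ℂ)⁻¹ * (n + 1) = 1 := by
    have : ((n : R) + 1) = algebraMap ℂ R ((n + 1 : ℕ) : ℂ) := by simp
    rw [this, ← map_mul, inv_mul_cancel₀ hn, map_one]
  rw [neg_mul, two_mul, map_sub, map_neg, map_add, coeff_derivative]
  simp only [miwaInv, timeSum, coeff_mk]
  rw [miwaInvCoeff]
  linear_combination (-miwaInvCoeff d n (derivative R F) -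
      2 * ∑ k ∈ range (n / 2 + 1), d k (miwaInvCoeff d (n - 2 * k) F)) * hi

/-- Uniqueness for evolution equations in `z`: a family with vanishing constant terms is zero if
its derivatives vanish to the order to which the family does. -/
lemma eq_zero_of_evolution {ι : Type*} (Φ : ι → PowerSeries R)
    (h0 : ∀ i, constantCoeff (Φ i) = 0)
    (h1 : ∀ n, (∀ i, X ^ n ∣ Φ i) → ∀ i, X ^ n ∣ derivative R (Φ i)) (i : ι) : Φ i = 0 := by
  have key : ∀ n, ∀ i, X ^ (n + 1) ∣ Φ i := by
    intro n
    induction n with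
    | zero => intro i; rw [zero_add, pow_one, X_dvd_iff]; exact h0 i
    | succ n ih =>
      intro i
      have h2 := h1 _ ih i
      rw [X_pow_dvd_iff] at h2 ⊢
      intro m hm
      cases m with
      | zero => simpa using h0 i
      | succ m =>
        have h3 := h2 m (by omega)
        rw [coeff_derivative] at h3
        refine eq_of_nsmul_eq m.succ_ne_zero ?_
        rw [smul_zero, nsmul_eq_mul, mul_comm]
        exact_mod_cast h3
  exact eq_zero_of_forall_X_pow_dvd fun n => key n i

lemma miwaInv_add (F G : PowerSeries R) :
    miwaInv d (F + G) = miwaInv d F + miwaInv d G := by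
  rw [← sub_eq_zero]
  let Φ : PowerSeries R × PowerSeries R → PowerSeries R := fun x =>
    miwaInv d (x.1 + x.2) - (miwaInv d x.1 + miwaInv d x.2)
  refine eq_zero_of_evolution Φ (fun x => ?_) (fun n ih x => ?_) (F, G)
  · simp [Φ, constantCoeff_miwaInv]
  · have e : derivative R (Φ x) =
        -2 * timeSum d (Φ x) - Φ (derivative R x.1, derivative R x.2) := by
      simp only [Φ, map_sub, map_add, derivative_miwaInv, timeSum_sub, timeSum_add]
      ring
    rw [e]
    exact ((X_pow_dvd_timeSum (ih x)).mul_left _).sub (ih _)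

lemma miwaInv_zero : miwaInv d (0 : PowerSeries R) = 0 := by
  have := miwaInv_add (d := d) 0 0
  simpa using this

lemma miwaInv_neg (F : PowerSeries R) : miwaInv d (-F) = -miwaInv d F := by
  rw [eq_neg_iff_add_eq_zero, ← miwaInv_add, neg_add_cancel, miwaInv_zero]

lemma miwaInv_sub (F G : PowerSeries R) : miwaInv d (F - G) = miwaInv d F - miwaInv d G := by
  rw [sub_eq_add_neg, miwaInv_add, miwaInv_neg, sub_eq_add_neg]

lemma miwaInv_mul (F G : PowerSeries R) :
    miwaInv d (F * G) = miwaInv d F * miwaInv d G := by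
  rw [← sub_eq_zero]
  let Φ : PowerSeries R × PowerSeries R → PowerSeries R := fun x =>
    miwaInv d (x.1 * x.2) - miwaInv d x.1 * miwaInv d x.2
  refine eq_zero_of_evolution Φ (fun x => ?_) (fun n ih x => ?_) (F, G)
  · simp [Φ, constantCoeff_miwaInv]
  · have e : derivative R (Φ x) =
        -2 * timeSum d (Φ x) - Φ (derivative R x.1, x.2) - Φ (x.1, derivative R x.2) := by
      simp only [Φ, map_sub, Derivation.leibniz, smul_eq_mul, derivative_miwaInv, timeSum_sub,
        timeSum_mul, miwaInv_add, mul_comm x.2]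
      ring
    rw [e]
    exact (((X_pow_dvd_timeSum (ih x)).mul_left _).sub (ih _)).sub (ih _)

lemma miwaInv_C (hd : ∀ (i j : ℕ) (f : R), d i (d j f) = d j (d i f)) (f : R) :
    miwaInv d (C f) = miwaShift d f := by
  rw [← sub_eq_zero]
  let Φ : R → PowerSeries R := fun f => miwaInv d (C f) - miwaShift d f
  refine eq_zero_of_evolution Φ (fun f => ?_) (fun n ih f => ?_) f
  · have h1 := coeff_miwaShift d f 0
    rw [miwaSum_zero, taylorCoeff_zero, coeff_zero_eq_constantCoeff_apply] at h1
    simp [Φ, constantCoeff_miwaInv, h1]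
  · have e1 : derivative R (miwaShift d f) = -2 * timeSum d (miwaShift d f) := by
      ext n
      have e2 := nsmul_coeff_miwaShift_succ hd f n
      rw [nsmul_eq_mul, ← smul_sum, Algebra.smul_def] at e2
      have h2 : algebraMap ℂ R (-2) = -2 := by rw [map_neg, map_ofNat]
      rw [h2] at e2
      rw [neg_mul, two_mul, map_neg, map_add, coeff_derivative, timeSum, coeff_mk]
      push_cast at e2
      linear_combination e2
    have e : derivative R (Φ f) = -2 * timeSum d (Φ f) := by
      simp only [Φ, map_sub, e1, derivative_miwaInv, timeSum_sub, derivative_C, miwaInv_zero]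
      ring
    rw [e]
    exact (X_pow_dvd_timeSum (ih f)).mul_left _

lemma miwaInv_one : miwaInv d (1 : PowerSeries R) = 1 := by
  rw [← sub_eq_zero]
  let Φ : Unit → PowerSeries R := fun _ => miwaInv d 1 - 1
  refine eq_zero_of_evolution Φ (fun _ => ?_) (fun n ih i => ?_) ()
  · simp [Φ, constantCoeff_miwaInv]
  · have e : derivative R (Φ i) = -2 * timeSum d (Φ i) := by
      simp only [Φ, map_sub, derivative_miwaInv, timeSum_sub, derivative_one, miwaInv_zero,
        timeSum_one]
      ring
    rw [e]
    exact (X_pow_dvd_timeSum (ih i)).mul_left _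

lemma miwaInv_X : miwaInv d (X : PowerSeries R) = -X := by
  rw [← sub_eq_zero]
  let Φ : Unit → PowerSeries R := fun _ => miwaInv d X - -X
  refine eq_zero_of_evolution Φ (fun _ => ?_) (fun n ih i => ?_) ()
  · simp [Φ, constantCoeff_miwaInv]
  · have e : derivative R (Φ i) = -2 * timeSum d (Φ i) := by
      simp only [Φ, sub_neg_eq_add, map_add, derivative_miwaInv, timeSum_add, derivative_X,
        miwaInv_one, timeSum_X]
      ring
    rw [e]
    exact (X_pow_dvd_timeSum (ih i)).mul_left _

variable (d) in
/-- The transformation `miwaInv` as a ring homomorphism. -/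
def miwaInvHom : PowerSeries R →+* PowerSeries R where
  toFun := miwaInv d
  map_one' := miwaInv_one
  map_mul' := miwaInv_mul
  map_zero' := miwaInv_zero
  map_add' := miwaInv_add

lemma miwaInv_seriesDeriv (hd : ∀ (i j : ℕ) (f : R), d i (d j f) = d j (d i f)) (i : ℕ)
    (F : PowerSeries R) : miwaInv d (seriesDeriv (d i) F) = seriesDeriv (d i) (miwaInv d F) := by
  rw [← sub_eq_zero]
  let Φ : PowerSeries R → PowerSeries R := fun F =>
    miwaInv d (seriesDeriv (d i) F) - seriesDeriv (d i) (miwaInv d F)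
  refine eq_zero_of_evolution Φ (fun F => ?_) (fun n ih F => ?_) F
  · have h : ∀ G : PowerSeries R, constantCoeff (seriesDeriv (d i) G) = d i (constantCoeff G) :=
      fun G => by simp only [← coeff_zero_eq_constantCoeff_apply, coeff_seriesDeriv]
    simp only [Φ, map_sub, constantCoeff_miwaInv, h, sub_self]
  · have e : derivative R (Φ F) = -2 * timeSum d (Φ F) - Φ (derivative R F) := by
      have h2 : ∀ G : PowerSeries R, seriesDeriv (d i) (-2 * G) = -2 * seriesDeriv (d i) G :=
        fun G => by ext n; simp [coeff_seriesDeriv, two_mul]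
      simp only [Φ, map_sub, derivative_miwaInv, timeSum_sub,
        timeSum_seriesDeriv hd, ← seriesDeriv_derivative, seriesDeriv_sub, h2]
      ring
    rw [e]
    exact ((X_pow_dvd_timeSum (ih F)).mul_left _).sub (ih _)

lemma miwaInv_timeSum (hd : ∀ (i j : ℕ) (f : R), d i (d j f) = d j (d i f))
    (F : PowerSeries R) : miwaInv d (timeSum d F) = timeSum d (miwaInv d F) := by
  rw [← sub_eq_zero]
  refine eq_zero_of_forall_X_pow_dvd fun n => ?_
  have h1 := map_dvd (miwaInvHom d) (X_pow_dvd_timeSum_sub (d := d) F (n + 1))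
  have h2 := X_pow_dvd_timeSum_sub (d := d) (miwaInv d F) (n + 1)
  have hX : miwaInvHom d X = -X := miwaInv_X
  rw [map_pow, hX, neg_pow, IsUnit.mul_left_dvd (IsUnit.pow _ isUnit_one.neg)] at h1
  convert h1.sub h2 using 1
  simp only [map_sub, map_sum, map_mul, map_pow, hX, pow_mul, neg_sq]
  have h3 : ∀ k, miwaInvHom d (seriesDeriv (d k) F) = seriesDeriv (d k) (miwaInv d F) :=
    fun k => miwaInv_seriesDeriv hd k F
  simp only [h3]
  change miwaInv d (timeSum d F) - _ = miwaInv d (timeSum d F) - _ - _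
  ring

lemma miwaInv_miwaInv (hd : ∀ (i j : ℕ) (f : R), d i (d j f) = d j (d i f))
    (F : PowerSeries R) : miwaInv d (miwaInv d F) = F := by
  rw [← sub_eq_zero]
  let Φ : PowerSeries R → PowerSeries R := fun F => miwaInv d (miwaInv d F) - F
  refine eq_zero_of_evolution Φ (fun F => ?_) (fun n ih F => ?_) F
  · simp [Φ, constantCoeff_miwaInv]
  · have h2 : miwaInv d (2 : PowerSeries R) = 2 := map_ofNat (miwaInvHom d) 2
    have e : derivative R (Φ F) = Φ (derivative R F) := by
      simp only [Φ, map_sub, derivative_miwaInv, miwaInv_sub, miwaInv_mul, miwaInv_neg, h2,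
        miwaInv_timeSum hd]
      ring
    rw [e]
    exact ih _

/-- The coefficients of `F(t_o - 2[λ⁻¹]_o, -λ)`. -/
lemma coeff_miwaInv (hd : ∀ (i j : ℕ) (f : R), d i (d j f) = d j (d i f)) (n : ℕ) :
    ∀ F : PowerSeries R, coeff n (miwaInv d F) = ∑ x ∈ HasAntidiagonal.antidiagonal n,
      (-1) ^ x.2 * coeff x.1 (miwaShift d (coeff x.2 F)) := by
  induction n with
  | zero =>
    intro F
    rw [coeff_zero_eq_constantCoeff_apply, constantCoeff_miwaInv]
    have h1 := coeff_miwaShift d (constantCoeff F) 0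
    rw [miwaSum_zero, taylorCoeff_zero, coeff_zero_eq_constantCoeff_apply] at h1
    simp [h1]
  | succ n ih =>
    intro F
    have h1 := PowerSeries.eq_X_mul_shift_add_const F
    conv_lhs => rw [h1]
    rw [miwaInv_add, miwaInv_mul, miwaInv_X, miwaInv_C hd, map_add, neg_mul, map_neg,
      coeff_succ_X_mul, ih, Finset.Nat.antidiagonal_succ', sum_cons, sum_map, ← sum_neg_distrib,
      add_comm]
    congr 1
    · simp
    · refine sum_congr rfl fun x _ => ?_
      simp [pow_succ]

end MiwaInvolution

end CKP

end

noncomputable section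

namespace CKP

open Finset

variable {R : Type*} [CommRing R] [Algebra ℂ R]

open Psi hiding coeff coeff_zero coeff_sum coeff_one coeff_add coeff_sub coeff_neg
open PowerSeries

/-! ### Bilinear identities at the Miwa shift -/

section Miwa

variable {d : ℕ → Derivation ℂ R R} (hd : ∀ (i j : ℕ) (f : R), d i (d j f) = d j (d i f))

/-- The residue pairing at `s = -2[λ⁻¹]_o`, for a second factor with vanishing constant term. -/
lemma miwaSum_res (hd : ∀ (i j : ℕ) (f : R), d i (d j f) = d j (d i f)) (u χ : PowerSeries R)
    (n : ℕ) :
    miwaSum (fun α => res (waveTaylor d (ser (d 0) u) α * adj (ser (d 0) (X * χ)))) n =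
      coeff n (miwaShift d (constantCoeff u) * C (constantCoeff χ) - 2 * (miwaInv d u * χ)) := by
  have e1 : miwaSum (fun α => res (waveTaylor d (ser (d 0) u) α * adj (ser (d 0) (X * χ)))) n =
      ∑ y ∈ HasAntidiagonal.antidiagonal n, miwaSum (fun γ => (multiFactorial γ)⁻¹) y.2 •
        ∑ z ∈ HasAntidiagonal.antidiagonal (y.2 + 1), coeff y.1 (miwaShift d (coeff z.1 u)) *
          ((-1) ^ z.2 * coeff z.2 (X * χ)) := by
    simp only [miwaSum, res_waveTaylor_mul_adj]
    have h1 := sum_ofWeight_antidiagonal (fun β γ => (miwaMonomial β * miwaMonomial γ *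
      (multiFactorial γ)⁻¹) • ∑ z ∈ HasAntidiagonal.antidiagonal (weight γ + 1),
        taylorCoeff d (coeff z.1 u) β * ((-1) ^ z.2 * coeff z.2 (X * χ))) n
    refine Eq.trans (sum_congr rfl fun α _ => ?_) (h1.trans (sum_congr rfl fun y _ => ?_))
    · rw [smul_sum]
      refine sum_congr rfl fun x hx => ?_
      rw [smul_smul, ← miwaMonomial_add, HasAntidiagonal.mem_antidiagonal.mp hx]
    · rw [sum_comm, sum_smul]
      refine sum_congr rfl fun γ hγ => ?_
      rw [mem_ofWeight.mp hγ]
      simp only [coeff_miwaShift, miwaSum, smul_sum, sum_mul, smul_mul_assoc, smul_smul]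
      rw [sum_comm]
      refine sum_congr rfl fun z _ => sum_congr rfl fun β _ => ?_
      rw [smul_eq_mul]
      congr 1
      ring
  have e2 : ∀ b (g : ℕ → R), ∑ z ∈ HasAntidiagonal.antidiagonal (b + 1),
      g z.1 * ((-1) ^ z.2 * coeff z.2 (X * χ)) = - ∑ z ∈ HasAntidiagonal.antidiagonal b,
        g z.1 * ((-1) ^ z.2 * coeff z.2 χ) := by
    intro b g
    rw [Finset.Nat.antidiagonal_succ', sum_cons, sum_map, ← sum_neg_distrib]
    simp [pow_succ]
  have e3 : coeff n (miwaInv d u * χ) = ∑ y ∈ HasAntidiagonal.antidiagonal n,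
      (-1) ^ y.2 * ∑ z ∈ HasAntidiagonal.antidiagonal y.2,
        coeff y.1 (miwaShift d (coeff z.1 u)) * ((-1) ^ z.2 * coeff z.2 χ) := by
    rw [coeff_mul]
    simp only [coeff_miwaInv hd, sum_mul, mul_sum]
    rw [sum_sigma', sum_sigma']
    refine Finset.sum_nbij' (fun s => ⟨(s.2.1, s.2.2 + s.1.2), (s.2.2, s.1.2)⟩)
      (fun s => ⟨(s.1.1 + s.2.1, s.2.2), (s.1.1, s.2.1)⟩) ?_ ?_ ?_ ?_ ?_
    · rintro ⟨⟨a, b⟩, c, e⟩ hs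
      simp only [mem_sigma, HasAntidiagonal.mem_antidiagonal] at hs ⊢
      exact ⟨by omega, trivial⟩
    · rintro ⟨⟨a, b⟩, c, e⟩ hs
      simp only [mem_sigma, HasAntidiagonal.mem_antidiagonal] at hs ⊢
      exact ⟨by omega, trivial⟩
    · rintro ⟨⟨a, b⟩, c, e⟩ hs
      simp only [mem_sigma, HasAntidiagonal.mem_antidiagonal] at hs
      simp [hs.2]
    · rintro ⟨⟨a, b⟩, c, e⟩ hs
      simp only [mem_sigma, HasAntidiagonal.mem_antidiagonal] at hs
      simp [hs.2]
    · rintro ⟨⟨a, b⟩, c, e⟩ _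
      have hsq : ((-1 : R) ^ b) * (-1) ^ b = 1 := by rw [← mul_pow]; simp
      simp only [pow_add]
      linear_combination (-(-1) ^ e * coeff c (miwaShift d (coeff e u)) * coeff b χ) * hsq
  rw [e1, map_sub, two_mul, map_add, e3, ← sub_eq_zero, ← sum_add_distrib, coeff_mul_C]
  have e4 : ∀ y ∈ HasAntidiagonal.antidiagonal n, miwaSum (fun γ => (multiFactorial γ)⁻¹) y.2 •
      ∑ z ∈ HasAntidiagonal.antidiagonal (y.2 + 1), coeff y.1 (miwaShift d (coeff z.1 u)) *
          ((-1) ^ z.2 * coeff z.2 (X * χ)) = (if y.2 = 0 then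
            coeff n (miwaShift d (constantCoeff u)) * constantCoeff χ else 0) -
        ((-1) ^ y.2 * ∑ z ∈ HasAntidiagonal.antidiagonal y.2,
        coeff y.1 (miwaShift d (coeff z.1 u)) * ((-1) ^ z.2 * coeff z.2 χ) + (-1) ^ y.2 *
        ∑ z ∈ HasAntidiagonal.antidiagonal y.2,
        coeff y.1 (miwaShift d (coeff z.1 u)) * ((-1) ^ z.2 * coeff z.2 χ)) := by
    rintro ⟨a, b⟩ hab
    rw [HasAntidiagonal.mem_antidiagonal] at hab
    simp only at hab ⊢
    rw [e2 b (fun i => coeff a (miwaShift d (coeff i u))), miwaSum_exp, Algebra.smul_def]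
    split_ifs with hb
    · subst hb
      obtain rfl : a = n := by simpa using hab
      simp
    · simp only [map_mul, map_pow, map_neg, map_one, map_ofNat]
      ring
  rw [sum_congr rfl e4, sum_sub_distrib]
  have e5 : ∑ y ∈ HasAntidiagonal.antidiagonal n, (if y.2 = 0 then
      coeff n (miwaShift d (constantCoeff u)) * constantCoeff χ else 0) =
      coeff n (miwaShift d (constantCoeff u)) * constantCoeff χ := by
    rw [Finset.sum_eq_single (n, 0)]
    · simp
    · rintro ⟨a, b⟩ hab hne
      rw [HasAntidiagonal.mem_antidiagonal] at hab
      refine if_neg fun hb => hne ?_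
      simp only at hab hb
      ext <;> simp <;> omega
    · intro h
      exact absurd (HasAntidiagonal.mem_antidiagonal.mpr (by simp)) h
  rw [e5]
  ring

include hd

omit hd in
/-- The symbol of `∂⁻¹ q W`, divided by `λ⁻¹`. -/
lemma exists_symbol_integral (q : R) (w : PowerSeries R)
    (hw : constantCoeff w = 1) : ∃ χ : PowerSeries R,
      dpow (d 0) (-1) * fn (d 0) q * ser (d 0) w = ser (d 0) (X * χ) ∧
      X * seriesDeriv (d 0) χ + χ = C q * w ∧ constantCoeff χ = q := by
  have hX : OrdLE (dpow (d 0) (-1) * fn (d 0) q * ser (d 0) w) (-1) :=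
    OrdLE.mul (M := -1 + 0) (N := 0) ((ordLE_dpow _).mul (ordLE_fn _)) (ordLE_ser w)
  set A := dpow (d 0) (-1) * fn (d 0) q * ser (d 0) w with hA
  have hdA : dpow (d 0) 1 * A = fn (d 0) q * ser (d 0) w := by
    rw [hA, mul_assoc, dpow_mul_dpow_assoc]; simp
  set χ : PowerSeries R := PowerSeries.mk fun n => A.coeff (-(n + 1 : ℕ)) with hχ
  have h2 : X * seriesDeriv (d 0) χ + χ = C q * w := by
    ext n
    have h3 := congrArg (fun B : Psi (d 0) => B.coeff (-n)) hdA
    simp only [coeff_dpow_one_mul, coeff_fn_mul, coeff_ser_neg] at h3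
    rw [coeff_C_mul, ← h3, map_add, add_comm]
    congr 1
    · rw [hχ, coeff_mk]; congr 1; push_cast; ring
    · cases n with
      | zero => rw [hX _ (by simp)]; simp
      | succ n => rw [coeff_succ_X_mul, coeff_seriesDeriv, hχ, coeff_mk]
  refine ⟨χ, ?_, h2, ?_⟩
  · ext p
    rw [coeff_ser]
    split_ifs with hp
    · obtain ⟨n, rfl⟩ : ∃ n : ℕ, p = -n := ⟨(-p).toNat, by omega⟩
      cases n with
      | zero => rw [hX _ (by simp)]; simp
      | succ n =>
        rw [show (-(-((n + 1 : ℕ) : ℤ))).toNat = n + 1 by omega, coeff_succ_X_mul, hχ, coeff_mk]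
    · exact hX _ (by omega)
  · have := congrArg constantCoeff h2
    simpa [hw] using this

variable {w : PowerSeries R} {B : ℕ → Psi (d 0)} {q : R} {χ : PowerSeries R}

/-- The addition formula `q(t_o) + q(t_o - 2[λ⁻¹]_o) = 2 w(t_o - 2[λ⁻¹]_o, -λ) χ(t_o, λ)`. -/
lemma IsSato.add_miwaInv_eigenfunction (h : IsSato d (ser (d 0) w) B)
    (hq : ∀ k, d k q = app (B k) q) (hw : constantCoeff w = 1)
    (hχ : dpow (d 0) (-1) * fn (d 0) q * ser (d 0) w = ser (d 0) (X * χ))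
    (hχ0 : constantCoeff χ = q) :
    C q + miwaInv d (C q) = 2 * (miwaInv d w * χ) := by
  have h1 : miwaInv d (C q) = -(miwaShift d (constantCoeff w) * C (constantCoeff χ) -
      2 * (miwaInv d w * χ)) := by
    ext n
    rw [miwaInv_C hd, coeff_miwaShift, map_neg, ← miwaSum_res hd, miwaSum, miwaSum,
      ← sum_neg_distrib]
    refine sum_congr rfl fun α _ => ?_
    rw [h.taylorCoeff_eigenfunction hd hq, hχ, smul_neg]
  rw [hw, ← miwaInv_C hd, map_one, miwaInv_one, hχ0] at h1
  rw [h1]; ring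

/-- The addition formula
`Ω(t_o - 2[λ⁻¹]_o) = Ω(t_o) - 2 λ⁻¹ χ(t_o - 2[λ⁻¹]_o, -λ) χ(t_o, λ)` for `Ω = Ω(q, q)`. -/
lemma IsSato.miwaInv_potential {Ω : R} (h : IsSato d (ser (d 0) w) B)
    (hq : ∀ k, d k q = app (B k) q)
    (hΩ : ∀ k, d k Ω = res (dpow (d 0) (-1) * fn (d 0) q *
      (B k * (fn (d 0) q * dpow (d 0) (-1)))))
    (hχ : dpow (d 0) (-1) * fn (d 0) q * ser (d 0) w = ser (d 0) (X * χ)) :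
    miwaInv d (C Ω) = C Ω - 2 * (X * miwaInv d χ * χ) := by
  have h1 : miwaInv d (C Ω) = C Ω - (miwaShift d (constantCoeff (X * χ)) * C (constantCoeff χ) -
      2 * (miwaInv d (X * χ) * χ)) := by
    ext n
    rw [miwaInv_C hd, coeff_miwaShift, map_sub, ← miwaSum_res hd, miwaSum, miwaSum]
    have e : coeff n (C Ω) = ∑ α ∈ ofWeight n, miwaMonomial α • (if α = 0 then Ω else 0) := by
      simp only [smul_ite, smul_zero, sum_ite_eq', mem_ofWeight, coeff_C]
      simp [eq_comm, miwaMonomial]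
    rw [e, ← sum_sub_distrib]
    refine sum_congr rfl fun α _ => ?_
    rw [h.taylorCoeff_potential hd hq hΩ, hχ, smul_sub]
  rw [map_mul, constantCoeff_X, zero_mul, ← miwaInv_C hd, map_zero, miwaInv_zero, miwaInv_mul,
    miwaInv_X] at h1
  rw [h1]; ring

end Miwa

/-! ### The relation between tau function and wave function -/

/-- For `f = τ²`, the relation `w² = P + ½ λ⁻¹ ∂_x P` with `P = f(t_o - 2[λ⁻¹]_o) / f(t_o)`. It is
the square of the relation between the tau function `τ` and the wave function `w e^ξ`, and linear
in `P`. -/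
def IsWaveOfSquare (d : ℕ → Derivation ℂ R R) (f : R) (w : PowerSeries R) : Prop :=
  IsUnit f ∧ ∃ P : PowerSeries R, C f * P = miwaInv d (C f) ∧
    2 * w ^ 2 = 2 * P + X * seriesDeriv (d 0) P

section Tau

variable {d : ℕ → Derivation ℂ R R} (hd : ∀ (i j : ℕ) (f : R), d i (d j f) = d j (d i f))

include hd

omit [Algebra ℂ R] hd in
lemma isUnit_of_constantCoeff_eq_one {F : PowerSeries R} (h : constantCoeff F = 1) : IsUnit F := by
  rw [PowerSeries.isUnit_iff_constantCoeff, h]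
  exact isUnit_one

omit hd in
lemma isUnit_two : IsUnit (2 : R) := by
  have : (2 : R) = algebraMap ℂ R 2 := by rw [map_ofNat]
  rw [this]
  exact (isUnit_iff_ne_zero.mpr two_ne_zero).map _

omit hd in
/-- A square root of a power series is determined by its constant term `1`. -/
lemma eq_of_sq_eq_sq {F G : PowerSeries R} (hF : constantCoeff F = 1) (hG : constantCoeff G = 1)
    (h : F ^ 2 = G ^ 2) : F = G := by
  have h2 : IsUnit (F + G) := by
    rw [PowerSeries.isUnit_iff_constantCoeff, map_add, hF, hG]
    rw [one_add_one_eq_two]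
    exact isUnit_two
  rw [← sub_eq_zero, ← h2.mul_left_eq_zero]
  linear_combination h

omit hd in
lemma constantCoeff_eq_one_of_mul {f : R} {P : PowerSeries R} (hf : IsUnit f)
    (hP : C f * P = miwaInv d (C f)) : constantCoeff P = 1 := by
  have := congrArg constantCoeff hP
  rw [map_mul, constantCoeff_C, constantCoeff_miwaInv, constantCoeff_C] at this
  exact hf.mul_left_cancel (by rw [this, mul_one])

/-- If `f` corresponds to `w`, then `P(t_o) w(t_o - 2[λ⁻¹]_o, -λ) = w(t_o, λ)`. -/
lemma IsWaveOfSquare.mul_miwaInv {f : R} {w P : PowerSeries R} (hf : IsUnit f)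
    (hw : constantCoeff w = 1) (hP : C f * P = miwaInv d (C f))
    (h : 2 * w ^ 2 = 2 * P + X * seriesDeriv (d 0) P) : P * miwaInv d w = w := by
  have hP1 := constantCoeff_eq_one_of_mul hf hP
  have hPu := isUnit_of_constantCoeff_eq_one hP1
  -- the shifted `P` is the inverse of `P`
  have h1 : P * miwaInv d P = 1 := by
    have h2 := congrArg (miwaInv d) hP
    rw [miwaInv_mul, miwaInv_miwaInv hd] at h2
    refine (hf.map C).mul_left_cancel ?_
    linear_combination h2 + miwaInv d P * hP
  have h3 : seriesDeriv (d 0) P * miwaInv d P + P * seriesDeriv (d 0) (miwaInv d P) = 0 := by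
    rw [← seriesDeriv_mul, h1, ← map_one C, seriesDeriv_C]; simp
  have h4 := congrArg (miwaInv d) h
  have h2' : miwaInv d (2 : PowerSeries R) = 2 := map_ofNat (miwaInvHom d) 2
  rw [pow_two, miwaInv_mul, miwaInv_mul, miwaInv_add, miwaInv_mul, miwaInv_mul, miwaInv_X, h2',
    miwaInv_seriesDeriv hd] at h4
  refine eq_of_sq_eq_sq ?_ hw ?_
  · rw [map_mul, constantCoeff_miwaInv, hP1, hw, mul_one]
  · refine (isUnit_two (R := PowerSeries R)).mul_left_cancel ?_
    linear_combination P ^ 2 * h4 - h + 2 * P * h1 - X * P * h3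
      + X * seriesDeriv (d 0) P * h1

/-- The effect of a Darboux transformation on the square of the tau function: multiplication
by `Ω(q, q)`. -/
lemma IsWaveOfSquare.darboux {f q Ω Ωi : R} {w χ : PowerSeries R} {B : ℕ → Psi (d 0)}
    (hf : IsWaveOfSquare d f w) (h : IsSato d (ser (d 0) w) B) (hw : constantCoeff w = 1)
    (hq : ∀ k, d k q = app (B k) q)
    (hΩ : ∀ k, d k Ω = res (dpow (d 0) (-1) * fn (d 0) q *
      (B k * (fn (d 0) q * dpow (d 0) (-1)))))
    (hΩx : d 0 Ω = q ^ 2) (hΩi : Ω * Ωi = 1)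
    (hχ : dpow (d 0) (-1) * fn (d 0) q * ser (d 0) w = ser (d 0) (X * χ))
    (hχ0 : constantCoeff χ = q) (hχx : X * seriesDeriv (d 0) χ + χ = C q * w) :
    IsWaveOfSquare d (Ω * f) (w - C (Ωi * q) * X * χ) := by
  obtain ⟨hfu, P, hP, hPw⟩ := hf
  have hPs := IsWaveOfSquare.mul_miwaInv hd hfu hw hP hPw
  have e1 := h.add_miwaInv_eigenfunction hd hq hw hχ hχ0
  have e2 := h.miwaInv_potential hd hq hΩ hχ
  -- shift the addition formula for `q` and compare with the formula itself
  have e3 : χ = P * miwaInv d χ := by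
    have h1 := congrArg (miwaInv d) e1
    have h2' : miwaInv d (2 : PowerSeries R) = 2 := map_ofNat (miwaInvHom d) 2
    rw [miwaInv_add, miwaInv_miwaInv hd, miwaInv_mul, miwaInv_mul, miwaInv_miwaInv hd, h2'] at h1
    have hu : IsUnit (2 * w) := by
      rw [PowerSeries.isUnit_iff_constantCoeff, map_mul, hw, mul_one, map_ofNat]
      exact isUnit_two
    refine hu.mul_left_cancel ?_
    linear_combination -P * e1 + P * h1 - 2 * χ * hPs
  have hCi : C Ω * C Ωi = (1 : PowerSeries R) := by rw [← map_mul, hΩi, map_one]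
  have hix : d 0 Ωi = -(Ωi * q) ^ 2 := by
    have h1 := congrArg (d 0) hΩi
    rw [Derivation.leibniz, Derivation.map_one_eq_zero, hΩx, smul_eq_mul, smul_eq_mul] at h1
    linear_combination Ωi * h1 - d 0 Ωi * hΩi
  refine ⟨(IsUnit.of_mul_eq_one _ hΩi).mul hfu, P - 2 * X * C Ωi * χ ^ 2, ?_, ?_⟩
  · rw [map_mul, miwaInv_mul, ← hP, e2]
    linear_combination (-2 * X * χ ^ 2 * C f) * hCi - 2 * X * χ * C f * e3
  · have h2 : seriesDeriv (d 0) (2 : PowerSeries R) = 0 := by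
      rw [← one_add_one_eq_two, seriesDeriv_add, ← map_one C, seriesDeriv_C]; simp
    simp only [seriesDeriv_sub, pow_two, seriesDeriv_mul, seriesDeriv_X, seriesDeriv_C, hix, h2,
      map_neg, map_mul]
    linear_combination hPw + 4 * X * C Ωi * χ * hχx

end Tau

end CKP

end

noncomputable section

namespace CKP

open Finset Psi

variable {R : Type*} [CommRing R] [Algebra ℂ R]

/-! ### The Darboux transformation -/

section Darboux

variable {D : Derivation ℂ R R}

variable (D) in
/-- The operator `1 - v ∂⁻¹ q`, which for `v = Ω(q, q)⁻¹ q` is the Darboux operator `T[q]`. -/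
def darbouxPsi (q v : R) : Psi D := 1 - fn D v * dpow D (-1) * fn D q

lemma adj_darbouxPsi (q v : R) :
    adj (darbouxPsi D q v) = 1 + fn D q * dpow D (-1) * fn D v := by
  rw [darbouxPsi, map_sub, adj_one, Psi.adj_mul, Psi.adj_mul, adj_fn, adj_fn, adj_dpow_neg_one]
  noncomm_ring

lemma ordLE_integral (q v : R) : OrdLE (fn D v * dpow D (-1) * fn D q) (-1) :=
  OrdLE.mul (M := 0 + -1) (N := 0) ((ordLE_fn v).mul (ordLE_dpow (-1))) (ordLE_fn q)

lemma ordLE_darbouxPsi (q v : R) : OrdLE (darbouxPsi D q v) 0 := by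
  have h1 : OrdLE (1 : Psi D) 0 := fun p hp => by rw [coeff_one, if_neg (by omega)]
  exact h1.sub ((ordLE_integral q v).mono (by omega))

lemma coeff_darbouxPsi (q v : R) : (darbouxPsi D q v).coeff 0 = 1 := by
  rw [darbouxPsi, Psi.coeff_sub, ordLE_integral q v 0 (by omega), coeff_one, if_pos rfl, sub_zero]

/-- Integration by parts with `ω' = r q`. -/
lemma integral_mul {r q ω : R} (h : D ω = r * q) : dpow D (-1) * fn D q * (fn D r * dpow D (-1)) =
    fn D ω * dpow D (-1) - dpow D (-1) * fn D ω := by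
  rw [← dpow_neg_one_mul_fn_deriv, h, mul_comm r q, map_mul]
  noncomm_ring

lemma darbouxPsi_mul_adj {q Ω v : R} (hΩ : D Ω = q * q) (hv : v * Ω = q) :
    darbouxPsi D q v * adj (darbouxPsi D q v) = 1 := by
  have h1 : fn D v * fn D Ω = fn D q := by rw [← map_mul, hv]
  have h2 : fn D Ω * fn D v = fn D q := by rw [← map_mul, mul_comm, hv]
  have h3 : fn D v * dpow D (-1) * fn D q * (fn D q * dpow D (-1) * fn D v) =
      fn D q * dpow D (-1) * fn D v - fn D v * dpow D (-1) * fn D q := by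
    calc _ = fn D v * (dpow D (-1) * fn D q * (fn D q * dpow D (-1))) * fn D v := by noncomm_ring
      _ = fn D v * fn D Ω * dpow D (-1) * fn D v - fn D v * dpow D (-1) * (fn D Ω * fn D v) := by
        rw [integral_mul hΩ]; noncomm_ring
      _ = _ := by rw [h1, h2]
  rw [adj_darbouxPsi, darbouxPsi, sub_mul, mul_add, mul_add, h3]
  noncomm_ring

lemma adj_darbouxPsi_mul {q Ω v : R} (hΩ : D Ω = q * q) (hv : v * Ω = q) :
    adj (darbouxPsi D q v) * darbouxPsi D q v = 1 :=
  adj_mul_self_eq_one (ordLE_darbouxPsi q v) (coeff_darbouxPsi q v) (darbouxPsi_mul_adj hΩ hv)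

/-- `T r ∂⁻¹ = r̃ ∂⁻¹ + v ∂⁻¹ ω` for the transform `r̃ = r - v ω` of `r`, where `ω' = r q`. -/
lemma fn_transform_mul {q v r ω : R} (h : D ω = r * q) :
    fn D (r - v * ω) * dpow D (-1) = darbouxPsi D q v * (fn D r * dpow D (-1)) -
      fn D v * dpow D (-1) * fn D ω := by
  have h1 : darbouxPsi D q v * (fn D r * dpow D (-1)) = fn D r * dpow D (-1) -
      fn D v * (dpow D (-1) * fn D q * (fn D r * dpow D (-1))) := by
    rw [darbouxPsi]; noncomm_ring
  rw [h1, integral_mul h, map_sub, map_mul]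
  noncomm_ring

/-- The adjoint form of `fn_transform_mul`. -/
lemma mul_fn_transform {q v r ω : R} (h : D ω = r * q) :
    dpow D (-1) * fn D (r - v * ω) = dpow D (-1) * fn D r * adj (darbouxPsi D q v) -
      fn D ω * (dpow D (-1) * fn D v) := by
  have h1 := congrArg adj (fn_transform_mul (v := v) h)
  simp only [map_sub, Psi.adj_mul, adj_fn, adj_dpow_neg_one] at h1
  rw [← map_sub] at h1
  rw [← neg_inj, ← neg_mul, h1]
  noncomm_ring

/-- `T^* v ∂⁻¹ = q ∂⁻¹ Ω⁻¹`, since `(Ω⁻¹)' = -v²`. -/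
lemma adj_darbouxPsi_mul_fn {q Ω Ωi : R} (hΩ : D Ω = q * q) (hΩi : Ω * Ωi = 1) :
    adj (darbouxPsi D q (Ωi * q)) * (fn D (Ωi * q) * dpow D (-1)) =
      fn D q * dpow D (-1) * fn D Ωi := by
  have hi : D (-Ωi) = (Ωi * q) * (Ωi * q) := by
    have h1 := congrArg D hΩi
    rw [Derivation.leibniz, Derivation.map_one_eq_zero, hΩ, smul_eq_mul, smul_eq_mul] at h1
    rw [map_neg]
    linear_combination -Ωi * h1 + D Ωi * hΩi
  have h1 : adj (darbouxPsi D q (Ωi * q)) * (fn D (Ωi * q) * dpow D (-1)) =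
      fn D (Ωi * q) * dpow D (-1) + fn D q * (dpow D (-1) * fn D (Ωi * q) *
        (fn D (Ωi * q) * dpow D (-1))) := by
    rw [adj_darbouxPsi]; noncomm_ring
  have h2 : fn D (Ωi * q) = fn D q * fn D Ωi := by rw [← map_mul, mul_comm]
  rw [h1, integral_mul hi, map_neg, h2]
  noncomm_ring

lemma mul_fn_darbouxPsi {q Ω Ωi : R} (hΩ : D Ω = q * q) (hΩi : Ω * Ωi = 1) :
    dpow D (-1) * fn D (Ωi * q) * darbouxPsi D q (Ωi * q) =
      fn D Ωi * (dpow D (-1) * fn D q) := by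
  have h1 := congrArg adj (adj_darbouxPsi_mul_fn hΩ hΩi)
  simp only [Psi.adj_mul, adj_fn, adj_dpow_neg_one, adj_adj] at h1
  rw [← neg_inj, ← neg_mul, ← neg_mul, h1]
  noncomm_ring

variable {δ : Derivation ℂ R R} (hδ : ∀ f, δ (D f) = D (δ f))

/-- The evolution operator of the transformed wave function, if `B` is that of the wave function. -/
def darbouxB (δ : Derivation ℂ R R) (q v : R) (B : Psi D) : Psi D :=
  (tderiv δ (darbouxPsi D q v) + darbouxPsi D q v * B) * adj (darbouxPsi D q v)

include hδ

omit hδ in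
/-- For skew-adjoint `B`, `∂⁻¹ q B + ∂⁻¹ B(q)` computes the time derivative of potentials. -/
lemma app_integral {B : Psi D} (q r : R) :
    app (dpow D (-1) * fn D q * B + dpow D (-1) * fn D (app B q)) r =
      res (dpow D (-1) * fn D q * (B * (fn D r * dpow D (-1)))) := by
  rw [app_add_left, app_eq_res, app_eq_res]
  have : res (dpow D (-1) * fn D (app B q) * fn D r * dpow D (-1)) = 0 :=
    res_of_ordLE ((((ordLE_dpow _).mul (ordLE_fn _)).mul (ordLE_fn _)).mul (ordLE_dpow _))
  rw [this, add_zero]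
  congr 1
  noncomm_ring

variable {q Ω Ωi : R} {B : Psi D} (hΩi : Ω * Ωi = 1) (hB : B ∈ Diff D) (hB' : adj B = -B)
  (hΩx : D Ω = q * q) (hq : δ q = app B q)
  (hΩ : δ Ω = res (dpow D (-1) * fn D q * (B * (fn D q * dpow D (-1)))))

include hΩi hB hB' hΩx hq hΩ

omit hΩx in
/-- The differential operator `S = B - v (∂⁻¹ q B)_{≥ 0}` with `δ(T) + T B = S - δ(v) ∂⁻¹ q`
and `δ(v) = Ω⁻¹ S(q)`. -/
lemma exists_darboux_diff : ∃ S ∈ Diff D,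
    tderiv δ (darbouxPsi D q (Ωi * q)) + darbouxPsi D q (Ωi * q) * B =
      S - fn D (δ (Ωi * q)) * dpow D (-1) * fn D q ∧
    δ (Ωi * q) = Ωi * app S q ∧
    ∀ r, app S r = app B r -
      Ωi * q * res (dpow D (-1) * fn D q * (B * (fn D r * dpow D (-1)))) := by
  have hSapp : ∀ r, app (B - fn D (Ωi * q) * (dpow D (-1) * fn D q * B +
      dpow D (-1) * fn D (app B q))) r = app B r -
      Ωi * q * res (dpow D (-1) * fn D q * (B * (fn D r * dpow D (-1)))) := fun r => by
    rw [app_sub_left, app_fn_mul_left, app_integral]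
  refine ⟨_, sub_mem hB (mul_mem (fn_mem_Diff (Ωi * q)) (dpow_mul_fn_mul_add_mem_Diff hB hB' q)),
    ?_, ?_, hSapp⟩
  · rw [darbouxPsi, map_sub, tderiv_one, tderiv_mul hδ, tderiv_mul hδ, tderiv_dpow, tderiv_fn,
      tderiv_fn, hq]
    noncomm_ring
  · rw [hSapp, ← hΩ, ← hq]
    have h1 := congrArg δ hΩi
    rw [Derivation.leibniz, Derivation.map_one_eq_zero, smul_eq_mul, smul_eq_mul] at h1
    rw [Derivation.leibniz, smul_eq_mul, smul_eq_mul]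
    linear_combination Ωi * q * h1 - q * δ Ωi * hΩi

/-- The transformed evolution operator is differential. -/
lemma darbouxB_mem_Diff : darbouxB δ q (Ωi * q) B ∈ Diff D := by
  obtain ⟨S, hS, h1, h2, -⟩ := exists_darboux_diff hδ hΩi hB hB' hq hΩ
  have h3 : darbouxB δ q (Ωi * q) B = S + (S * fn D q * dpow D (-1) -
      fn D (app S q) * dpow D (-1)) * fn D (Ωi * q) := by
    have e1 : fn D (δ (Ωi * q)) = fn D (app S q) * fn D Ωi := by rw [h2, mul_comm, map_mul]
    have e2 : fn D Ωi * fn D Ω = 1 := by rw [← map_mul, mul_comm, hΩi, map_one]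
    have e3 : fn D Ω * fn D (Ωi * q) = fn D q := by rw [← map_mul, ← mul_assoc, hΩi, one_mul]
    have e4 : fn D Ωi * fn D q = fn D (Ωi * q) := (map_mul _ _ _).symm
    rw [darbouxB, h1, adj_darbouxPsi, e1]
    calc _ = S + S * fn D q * dpow D (-1) * fn D (Ωi * q) -
          fn D (app S q) * fn D Ωi * dpow D (-1) * fn D q - fn D (app S q) * fn D Ωi *
            (dpow D (-1) * fn D q * (fn D q * dpow D (-1))) * fn D (Ωi * q) := by noncomm_ring
      _ = S + S * fn D q * dpow D (-1) * fn D (Ωi * q) -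
          fn D (app S q) * fn D Ωi * dpow D (-1) * fn D q - fn D (app S q) *
            (fn D Ωi * fn D Ω) * dpow D (-1) * fn D (Ωi * q) +
            fn D (app S q) * fn D Ωi * dpow D (-1) * (fn D Ω * fn D (Ωi * q)) := by
        rw [integral_mul hΩx]; noncomm_ring
      _ = _ := by rw [e2, e3]; noncomm_ring
  rw [h3]
  exact add_mem hS (mul_mem (mul_fn_mul_dpow_sub_mem_Diff hS q) (fn_mem_Diff _))

/-- The transform of an eigenfunction is an eigenfunction. -/
lemma app_darbouxB {r ω : R} (hr : δ r = app B r) (hωx : D ω = r * q)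
    (hω : δ ω = res (dpow D (-1) * fn D q * (B * (fn D r * dpow D (-1))))) :
    δ (r - Ωi * q * ω) = app (darbouxB δ q (Ωi * q) B) (r - Ωi * q * ω) := by
  obtain ⟨S, hS, h1, h2, h3⟩ := exists_darboux_diff hδ hΩi hB hB' hq hΩ
  have hv : Ωi * q * Ω = q := by linear_combination q * hΩi
  have hBT : darbouxB δ q (Ωi * q) B * darbouxPsi D q (Ωi * q) =
      S - fn D (δ (Ωi * q)) * dpow D (-1) * fn D q := by
    rw [darbouxB, mul_assoc, adj_darbouxPsi_mul hΩx hv, mul_one, h1]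
  have key : ∀ r ω, D ω = r * q → app (darbouxB δ q (Ωi * q) B) (r - Ωi * q * ω) =
      app S r - app (darbouxB δ q (Ωi * q) B) (Ωi * q) * ω := by
    intro r ω h
    have e1 : res (fn D (δ (Ωi * q)) * dpow D (-1) * fn D q * (fn D r * dpow D (-1))) = 0 :=
      res_of_ordLE ((((ordLE_fn _).mul (ordLE_dpow _)).mul (ordLE_fn _)).mul
        ((ordLE_fn _).mul (ordLE_dpow _)))
    rw [app_eq_res, mul_assoc, fn_transform_mul h, mul_sub, ← mul_assoc, hBT, res_sub, sub_mul,
      res_sub, e1, sub_zero, ← mul_assoc, app_eq_res, ← mul_assoc, res_mul_fn, app_eq_res,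
      ← mul_assoc]
  have h4 : app (darbouxB δ q (Ωi * q) B) (Ωi * q) = δ (Ωi * q) := by
    -- the transform of `q` itself is zero
    have e := key q Ω hΩx
    rw [hv, sub_self, app_zero_right] at e
    rw [h2]
    linear_combination Ωi * e - app (darbouxB δ q (Ωi * q) B) (Ωi * q) * hΩi
  rw [key r ω hωx, h4, h3, map_sub, Derivation.leibniz, hr, ← hω, smul_eq_mul, smul_eq_mul]
  ring

omit hδ hB hB' hq hΩ in
/-- The transforms of the potentials are potentials of the transformed eigenfunctions. -/
lemma res_darbouxB {r₁ r₂ ω₁ ω₂ : R} (hω₁ : D ω₁ = r₁ * q) (hω₂ : D ω₂ = r₂ * q) :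
    res (dpow D (-1) * fn D (r₂ - Ωi * q * ω₂) * (darbouxB δ q (Ωi * q) B *
      (fn D (r₁ - Ωi * q * ω₁) * dpow D (-1)))) =
    res (dpow D (-1) * fn D r₂ * (B * (fn D r₁ * dpow D (-1)))) -
      res (dpow D (-1) * fn D r₂ * (B * (fn D q * dpow D (-1)))) * Ωi * ω₁ -
      ω₂ * Ωi * res (dpow D (-1) * fn D q * (B * (fn D r₁ * dpow D (-1)))) +
      ω₂ * Ωi * res (dpow D (-1) * fn D q * (B * (fn D q * dpow D (-1)))) * Ωi * ω₁ := by
  have hv : Ωi * q * Ω = q := by linear_combination q * hΩi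
  set T := darbouxPsi D q (Ωi * q) with hT
  have hTT : adj T * T = 1 := adj_darbouxPsi_mul hΩx hv
  -- `T^* B̃ T` differs from `B` by an operator of negative order
  set N := B + adj T * tderiv δ T with hN
  have hBN : darbouxB δ q (Ωi * q) B = T * N * adj T := by
    have : T * adj T = 1 := darbouxPsi_mul_adj hΩx hv
    rw [darbouxB, hN, mul_add, ← mul_assoc T, this, one_mul, add_comm]
  have hres : ∀ a b, res (dpow D (-1) * fn D a * (N * (fn D b * dpow D (-1)))) =
      res (dpow D (-1) * fn D a * (B * (fn D b * dpow D (-1)))) := by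
    intro a b
    have h1 : OrdLE (adj T * tderiv δ T) (0 + -1) :=
      (ordLE_darbouxPsi _ _).adj.mul
        (ordLE_tderiv_of_coeff_zero δ (ordLE_darbouxPsi _ _) (coeff_darbouxPsi _ _))
    have h2 : res (dpow D (-1) * fn D a * (adj T * tderiv δ T * (fn D b * dpow D (-1)))) = 0 :=
      res_of_ordLE ((((ordLE_dpow _).mul (ordLE_fn _)).mul
        (h1.mul ((ordLE_fn _).mul (ordLE_dpow _)))).mono (by norm_num))
    rw [hN, add_mul, mul_add, res_add, h2, add_zero]
  have e1 : dpow D (-1) * fn D (r₂ - Ωi * q * ω₂) * T =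
      dpow D (-1) * fn D r₂ - fn D (ω₂ * Ωi) * (dpow D (-1) * fn D q) := by
    rw [mul_fn_transform hω₂, sub_mul, mul_assoc _ (adj T), hTT, mul_one, mul_assoc (fn D ω₂),
      mul_fn_darbouxPsi hΩx hΩi, map_mul, mul_assoc (fn D ω₂)]
  have e2 : adj T * (fn D (r₁ - Ωi * q * ω₁) * dpow D (-1)) =
      fn D r₁ * dpow D (-1) - fn D q * dpow D (-1) * fn D (Ωi * ω₁) := by
    rw [fn_transform_mul hω₁, mul_sub, ← mul_assoc (adj T) T, hTT, one_mul, ← mul_assoc (adj T),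
      adj_darbouxPsi_mul_fn hΩx hΩi, map_mul, mul_assoc _ (fn D Ωi)]
  have e3 : dpow D (-1) * fn D (r₂ - Ωi * q * ω₂) * (darbouxB δ q (Ωi * q) B *
      (fn D (r₁ - Ωi * q * ω₁) * dpow D (-1))) =
      dpow D (-1) * fn D r₂ * (N * (fn D r₁ * dpow D (-1))) -
      dpow D (-1) * fn D r₂ * (N * (fn D q * dpow D (-1))) * fn D (Ωi * ω₁) -
      fn D (ω₂ * Ωi) * (dpow D (-1) * fn D q * (N * (fn D r₁ * dpow D (-1)))) +
      fn D (ω₂ * Ωi) * (dpow D (-1) * fn D q * (N * (fn D q * dpow D (-1)))) *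
        fn D (Ωi * ω₁) := by
    calc _ = (dpow D (-1) * fn D (r₂ - Ωi * q * ω₂) * T) * N *
          (adj T * (fn D (r₁ - Ωi * q * ω₁) * dpow D (-1))) := by rw [hBN]; noncomm_ring
      _ = _ := by rw [e1, e2]; noncomm_ring
  rw [e3, res_add, res_sub, res_sub, res_mul_fn, res_mul_fn, res_fn_mul, res_fn_mul, hres, hres,
    hres, hres]
  ring

end Darboux

/-- The Darboux transformation preserves the Sato equations. -/
lemma IsSato.darboux {d : ℕ → Derivation ℂ R R}
    (hd : ∀ (i j : ℕ) (f : R), d i (d j f) = d j (d i f))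
    {W : Psi (d 0)} {B : ℕ → Psi (d 0)} (h : IsSato d W B) {q Ω Ωi : R} (hΩi : Ω * Ωi = 1)
    (hΩx : d 0 Ω = q * q) (hq : ∀ k, d k q = app (B k) q)
    (hΩ : ∀ k, d k Ω = res (dpow (d 0) (-1) * fn (d 0) q *
      (B k * (fn (d 0) q * dpow (d 0) (-1))))) :
    IsSato d (darbouxPsi (d 0) q (Ωi * q) * W) fun k => darbouxB (d k) q (Ωi * q) (B k) := by
  have hv : Ωi * q * Ω = q := by linear_combination q * hΩi
  refine ⟨(ordLE_darbouxPsi _ _).mul h.ordLE, ?_, ?_, fun k => ?_, fun k => ?_⟩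
  · have := coeff_mul_top (ordLE_darbouxPsi (D := d 0) q (Ωi * q)) h.ordLE
    rwa [coeff_darbouxPsi, h.coeff_zero, mul_one] at this
  · rw [Psi.adj_mul, mul_assoc, ← mul_assoc W, h.mul_adj, one_mul, darbouxPsi_mul_adj hΩx hv]
  · exact darbouxB_mem_Diff (fun f => hd k 0 f) hΩi (h.mem_Diff k) (h.adj_B hd k) hΩx (hq k) (hΩ k)
  · rw [nabla_mul hd, h.nabla_eq, darbouxB, mul_assoc _ (adj _), ← mul_assoc (adj _) _ W,
      adj_darbouxPsi_mul hΩx hv, one_mul, ← mul_assoc, ← add_mul]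

/-- `B 0 = ∂`. -/
lemma IsSato.B_zero {d : ℕ → Derivation ℂ R R} {W : Psi (d 0)} {B : ℕ → Psi (d 0)}
    (h : IsSato d W B) : B 0 = dpow (d 0) 1 := by
  apply h.eq_of_mul_eq
  rw [← h.nabla_eq, nabla_zero]

/-- The `x`-derivative of a squared eigenfunction potential is the product of eigenfunctions. -/
lemma res_integral_dpow (D : Derivation ℂ R R) (q r : R) :
    res (dpow D (-1) * fn D r * (dpow D 1 * (fn D q * dpow D (-1)))) = q * r := by
  have h1 : dpow D (-1) * fn D r * (dpow D 1 * (fn D q * dpow D (-1))) =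
      dpow D (-1) * fn D r * fn D q +
        dpow D (-1) * fn D r * fn D (D q) * dpow D (-1) := by
    rw [← mul_assoc (dpow D 1), dpow_one_mul_fn, add_mul, mul_assoc _ (dpow D 1), dpow_mul_dpow]
    simp only [add_neg_cancel, dpow_zero, mul_one]
    noncomm_ring
  have h2 : res (dpow D (-1) * fn D r * fn D (D q) * dpow D (-1)) = 0 :=
    res_of_ordLE ((((ordLE_dpow _).mul (ordLE_fn _)).mul (ordLE_fn _)).mul (ordLE_dpow _))
  rw [h1, res_add, h2, add_zero, res_mul_fn, res_mul_fn, res, coeff_dpow, if_pos rfl]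
  ring

end CKP

end

noncomputable section

namespace CKP

open Finset
open Psi hiding coeff coeff_zero coeff_sum coeff_one coeff_add coeff_sub coeff_neg
open PowerSeries

variable {R : Type*} [CommRing R] [Algebra ℂ R]

/-! ### Tau functions and their squares -/

section TauSquare

variable {d : ℕ → Derivation ℂ R R} (hd : ∀ (i j : ℕ) (f : R), d i (d j f) = d j (d i f))

include hd

/-- The defining relation between tau function and wave function, without square root. -/
lemma isWaveOfTau_iff (τ : R) (w : PowerSeries R) : IsWaveOfTau d τ w ↔
    IsUnit τ ∧ constantCoeff w = 1 ∧ ∃ ρ : PowerSeries R, C τ * ρ = miwaInv d (C τ) ∧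
      2 * w ^ 2 = 2 * ρ ^ 2 + X * seriesDeriv (d 0) (ρ ^ 2) := by
  have hderiv : ∀ ρ : PowerSeries R,
      seriesDeriv (d 0) (ρ ^ 2) = 2 * (ρ * seriesDeriv (d 0) ρ) := fun ρ => by
    rw [pow_two, seriesDeriv_mul]; ring
  constructor
  · rintro ⟨hτ, G, ρ, h1, h2, h3, rfl⟩
    rw [← miwaInv_C hd] at h1
    have hρ := constantCoeff_eq_one_of_mul hτ h1
    have hi := Ring.mul_inverse_cancel ρ (isUnit_of_constantCoeff_eq_one hρ)
    refine ⟨hτ, by rw [map_mul, h2, hρ, mul_one], ρ, h1, ?_⟩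
    rw [hderiv]
    linear_combination 2 * ρ ^ 2 * h3 + 2 * X * ρ * seriesDeriv (d 0) ρ * hi
  · rintro ⟨hτ, hw, ρ, h1, h2⟩
    have hρ := constantCoeff_eq_one_of_mul hτ h1
    have hi := Ring.mul_inverse_cancel ρ (isUnit_of_constantCoeff_eq_one hρ)
    refine ⟨hτ, w * Ring.inverse ρ, ρ, by rw [h1, miwaInv_C hd], ?_, ?_, ?_⟩
    · have := congrArg constantCoeff hi
      rw [map_mul, hρ, one_mul, map_one] at this
      rw [map_mul, hw, this, one_mul]
    · refine (isUnit_two (R := PowerSeries R)).mul_left_cancel ?_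
      rw [hderiv] at h2
      linear_combination Ring.inverse ρ ^ 2 * h2 +
        (2 * (ρ * Ring.inverse ρ + 1) + 2 * X * seriesDeriv (d 0) ρ * Ring.inverse ρ) * hi
    · rw [mul_assoc, mul_comm _ ρ, hi, mul_one]

lemma IsWaveOfTau.isWaveOfSquare {τ : R} {w : PowerSeries R} (h : IsWaveOfTau d τ w) :
    IsWaveOfSquare d (τ ^ 2) w := by
  obtain ⟨hτ, -, ρ, h1, h2⟩ := (isWaveOfTau_iff hd τ w).mp h
  refine ⟨hτ.pow 2, ρ ^ 2, ?_, h2⟩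
  rw [pow_two, map_mul, miwaInv_mul, ← h1]
  ring

lemma IsWaveOfSquare.isWaveOfTau {τ : R} {w : PowerSeries R} (hw : constantCoeff w = 1)
    (h : IsWaveOfSquare d (τ ^ 2) w) : IsWaveOfTau d τ w := by
  obtain ⟨hτ2, P, h1, h2⟩ := h
  have hτ : IsUnit τ := (isUnit_pow_iff two_ne_zero).mp hτ2
  have hi : C τ * C (Ring.inverse τ) = (1 : PowerSeries R) := by
    rw [← map_mul, Ring.mul_inverse_cancel τ hτ, map_one]
  have hP : (C (Ring.inverse τ) * miwaInv d (C τ)) ^ 2 = P := by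
    rw [pow_two, map_mul, miwaInv_mul] at h1
    linear_combination -C (Ring.inverse τ) ^ 2 * h1 + P * (C τ * C (Ring.inverse τ) + 1) * hi
  refine (isWaveOfTau_iff hd τ w).mpr
    ⟨hτ, hw, C (Ring.inverse τ) * miwaInv d (C τ), ?_, by rw [hP, h2]⟩
  rw [← mul_assoc, hi, one_mul]

omit hd in
/-- The relation `w² = P + ½ λ⁻¹ ∂_x P` determines `P`. -/
lemma eq_of_two_mul_add_X_mul_seriesDeriv_eq {P Q : PowerSeries R}
    (h : 2 * P + X * seriesDeriv (d 0) P = 2 * Q + X * seriesDeriv (d 0) Q) : P = Q := by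
  have h2 : ∀ F : PowerSeries R, ∀ n, coeff n (2 * F) = 2 * coeff n F := fun F n => by
    rw [two_mul, map_add, two_mul]
  ext n
  induction n with
  | zero =>
    have := congrArg (coeff 0) h
    rw [map_add, map_add, h2, h2, coeff_zero_X_mul, coeff_zero_X_mul, add_zero, add_zero] at this
    exact isUnit_two.mul_left_cancel this
  | succ n ih =>
    have := congrArg (coeff (n + 1)) h
    rw [map_add, map_add, h2, h2, coeff_succ_X_mul, coeff_succ_X_mul, coeff_seriesDeriv,
      coeff_seriesDeriv, ih] at this
    exact isUnit_two.mul_left_cancel (add_right_cancel this)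

/-- A function which is invariant under the Miwa shift does not depend on the times. -/
lemma deriv_eq_zero_of_miwaInv_C {c : R} (h : miwaInv d (C c) = C c) (k : ℕ) : d k c = 0 := by
  rw [miwaInv_C hd] at h
  have h1 := nsmul_coeff_miwaShift_succ hd c (2 * k)
  rw [h, coeff_C, if_neg (Nat.succ_ne_zero _), smul_zero, Finset.sum_eq_single_of_mem k] at h1
  · rw [Nat.sub_self, coeff_C, if_pos rfl] at h1
    have h2 := congrArg (fun y => (-2 : ℂ)⁻¹ • y) h1
    simpa [smul_smul] using h2.symm
  · exact mem_range.mpr (by omega)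
  · intro j hj hjk
    have := mem_range.mp hj
    rw [coeff_C, if_neg (by omega), map_zero, smul_zero]

/-- The tau function is determined by the wave function up to constants. -/
lemma IsWaveOfTau.exists_eq_mul {τ τ' : R} {w : PowerSeries R} (h : IsWaveOfTau d τ w)
    (h' : IsWaveOfTau d τ' w) : ∃ c : R, IsUnit c ∧ (∀ k, d k c = 0) ∧ τ' = c * τ := by
  obtain ⟨hτ, -, ρ, h1, h2⟩ := (isWaveOfTau_iff hd τ w).mp h
  obtain ⟨hτ', -, ρ', h1', h2'⟩ := (isWaveOfTau_iff hd τ' w).mp h'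
  have hρ := constantCoeff_eq_one_of_mul hτ h1
  have hρ' := constantCoeff_eq_one_of_mul hτ' h1'
  obtain rfl : ρ = ρ' :=
    eq_of_sq_eq_sq hρ hρ' (eq_of_two_mul_add_X_mul_seriesDeriv_eq (h2.symm.trans h2'))
  have hi := Ring.inverse_mul_cancel τ hτ
  have hc : τ' = τ' * Ring.inverse τ * τ := by rw [mul_assoc, hi, mul_one]
  refine ⟨τ' * Ring.inverse τ, hτ'.mul hτ.ringInverse, ?_, hc⟩
  refine deriv_eq_zero_of_miwaInv_C hd ?_
  refine ((hτ.map C).mul (isUnit_of_constantCoeff_eq_one hρ)).mul_right_cancel ?_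
  calc _ = miwaInv d (C (τ' * Ring.inverse τ)) * miwaInv d (C τ) := by rw [h1]
    _ = C τ' * ρ := by rw [← miwaInv_mul, ← map_mul, ← hc, h1']
    _ = _ := by rw [← mul_assoc, ← map_mul, ← hc]

end TauSquare

/-! ### Determinants by successive elimination -/

section Det

omit [Algebra ℂ R]

/-- `det A = a det A'`, if `A'` arises from `A` by eliminating the row and the column `p` with
pivot `a = A p p`, and then putting `1` in place of the pivot. -/
lemma det_eq_mul_det_of_eliminate {ι : Type*} [Fintype ι] [DecidableEq ι] {A A' : Matrix ι ι R}
    {p : ι} {a : R} (ha : A p p * a = 1)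
    (h : ∀ i j, A' i j = A i j - A i p * A p j * a + if i = p ∧ j = p then 1 else 0) :
    A.det = A p p * A'.det := by
  -- `A` is obtained from `A'` by a column and a row operation
  set e : ι → R := fun i => if i = p then 1 else 0 with he
  have hrow : ∀ j, A' p j = e j := fun j => by
    rw [h, he]
    simp only [true_and]
    linear_combination -A p j * ha
  have hcol : ∀ i, A' i p = e i := fun i => by
    rw [h, he]
    simp only [and_true]
    linear_combination -A i p * ha
  have hA : A = (1 + Matrix.vecMulVec (fun i => A i p - e i) e) * A' *
      (1 + Matrix.vecMulVec e fun j => a * A p j - e j) := by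
    have h1 : (1 + Matrix.vecMulVec (fun i => A i p - e i) e) * A' =
        A' + Matrix.vecMulVec (fun i => A i p - e i) e := by
      rw [add_mul, one_mul, Matrix.vecMulVec_mul]
      congr 2
      ext j
      simp [Matrix.vecMul, dotProduct, he, hrow]
    have h2 : A'.mulVec e = e := by
      ext i
      simp [Matrix.mulVec, dotProduct, he, hcol]
    rw [h1, mul_add, mul_one, add_mul, Matrix.mul_vecMulVec, Matrix.mul_vecMulVec, h2]
    ext i j
    have h3 : (Matrix.vecMulVec (fun i => A i p - e i) e).mulVec e i = A i p - e i := by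
      simp [Matrix.mulVec, dotProduct, Matrix.vecMulVec_apply, he]
    have h4 : (if i = p ∧ j = p then (1 : R) else 0) = e i * e j := by
      simp only [he]; split_ifs <;> simp_all
    simp only [Matrix.add_apply, Matrix.vecMulVec_apply, h3, h, h4]
    ring
  have hdet : ∀ u v : ι → R, (1 + Matrix.vecMulVec u v).det = 1 + v ⬝ᵥ u := fun u v => by
    rw [Matrix.vecMulVec_eq Unit, Matrix.det_one_add_replicateCol_mul_replicateRow]
  conv_lhs => rw [hA, Matrix.det_mul, Matrix.det_mul, hdet, hdet]
  have h1 : e ⬝ᵥ (fun i => A i p - e i) = A p p - 1 := by simp [dotProduct, he]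
  have h2 : (fun j => a * A p j - e j) ⬝ᵥ e = a * A p p - 1 := by simp [dotProduct, he]
  rw [h1, h2]
  linear_combination (A p p * A'.det) * ha

variable {n : ℕ} (E : EigenData R n)

lemma EigenData.chain_succ (k : Fin n) : E.chain (k + 1) = (E.chain k).step k := by
  rw [EigenData.chain, dif_pos k.2]

lemma EigenData.step_Ω (p i j : Fin n) : (E.step p).Ω i j =
    E.Ω i j - E.Ω i p * E.Ω p j * Ring.inverse (E.Ω p p) := rfl

lemma EigenData.prod_chain_succ (p : Fin n) :
    (∏ i : Fin n, if (i : ℕ) < p + 1 then (E.chain i).Ω i i else 1) =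
      (∏ i : Fin n, if (i : ℕ) < p then (E.chain i).Ω i i else 1) * (E.chain p).Ω p p := by
  rw [← mul_prod_erase univ _ (mem_univ p), ← mul_prod_erase univ (fun i : Fin n =>
    if (i : ℕ) < p then (E.chain i).Ω i i else 1) (mem_univ p), if_pos (by omega),
    if_neg (by omega), one_mul, mul_comm]
  congr 1
  refine prod_congr rfl fun i hi => ?_
  have : (i : ℕ) ≠ p := fun h => (mem_erase.mp hi).1 (Fin.ext h)
  simp only [show (i : ℕ) < p + 1 ↔ (i : ℕ) < p by omega]

variable (hunit : ∀ k : Fin n, IsUnit ((E.chain k).Ω k k))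

include hunit

/-- The rows and columns of the potentials which have been eliminated vanish. -/
lemma EigenData.chain_Ω_eq_zero {k : ℕ} (hk : k ≤ n) (i j : Fin n) (hi : (i : ℕ) < k) :
    (E.chain k).Ω i j = 0 ∧ (E.chain k).Ω j i = 0 := by
  induction k generalizing j with
  | zero => omega
  | succ k ih =>
    rw [E.chain_succ ⟨k, hk⟩, EigenData.step_Ω, EigenData.step_Ω]
    rcases Nat.lt_succ_iff_lt_or_eq.mp hi with h | rfl
    · have h0 := fun l => ih (by omega) l h
      simp only [h0]
      simp
    · have h1 := Ring.mul_inverse_cancel _ (hunit i)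
      constructor
      · linear_combination -(E.chain i).Ω i j * h1
      · linear_combination -(E.chain i).Ω j i * h1

/-- The determinant of the potentials is the product of the pivots of the elimination. -/
lemma EigenData.det_eq_prod : E.Ω.det = ∏ k : Fin n, (E.chain k).Ω k k := by
  have key : ∀ k ≤ n, E.Ω.det = (∏ i : Fin n, if (i : ℕ) < k then (E.chain i).Ω i i else 1) *
      ((E.chain k).Ω + Matrix.diagonal fun i : Fin n => if (i : ℕ) < k then 1 else 0).det := by
    intro k
    induction k with
    | zero => simp [EigenData.chain]
    | succ k ih =>
      intro hk
      set p : Fin n := ⟨k, hk⟩ with hp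
      have h0 := fun (i j : Fin n) => E.chain_Ω_eq_zero hunit (k := k) (by omega) i j
      have ha := Ring.mul_inverse_cancel _ (hunit p)
      have hpp : ((E.chain k).Ω + Matrix.diagonal fun i : Fin n =>
          if (i : ℕ) < k then (1 : R) else 0) p p = (E.chain p).Ω p p := by
        simp [hp]
      rw [ih (by omega), E.prod_chain_succ p, mul_assoc, det_eq_mul_det_of_eliminate (p := p)
        (a := Ring.inverse ((E.chain p).Ω p p)) (by rw [hpp, ha]) _, hpp]
      intro i j
      have hdiag : ∀ i j : Fin n, Matrix.diagonal (fun i : Fin n =>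
          if (i : ℕ) < k + 1 then (1 : R) else 0) i j = Matrix.diagonal (fun i : Fin n =>
          if (i : ℕ) < k then (1 : R) else 0) i j + if i = p ∧ j = p then 1 else 0 := by
        intro i j
        by_cases hij : i = j
        · subst hij
          have hik : i = p ↔ (i : ℕ) = k := by rw [hp, Fin.ext_iff]
          simp only [Matrix.diagonal_apply_eq, and_self, hik]
          split_ifs <;> first | omega | simp
        · rw [Matrix.diagonal_apply_ne _ hij, Matrix.diagonal_apply_ne _ hij, if_neg, add_zero]
          rintro ⟨rfl, rfl⟩
          exact hij rfl
      have hip : ∀ i : Fin n, Matrix.diagonal (fun i : Fin n =>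
          if (i : ℕ) < k then (1 : R) else 0) i p = 0 ∧ Matrix.diagonal (fun i : Fin n =>
          if (i : ℕ) < k then (1 : R) else 0) p i = 0 := by
        intro i
        rw [Matrix.diagonal_apply, Matrix.diagonal_apply]
        constructor
        · split_ifs with h1 h2
          · rw [h1] at h2; simp [hp] at h2
          · rfl
          · rfl
        · simp [hp]
      simp only [Matrix.add_apply, hdiag, hip, add_zero]
      rw [E.chain_succ p, EigenData.step_Ω]
      ring
  rw [key n le_rfl]
  have h1 : (E.chain n).Ω + Matrix.diagonal (fun i : Fin n => if (i : ℕ) < n then (1 : R) else 0) =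
      1 := by
    ext i j
    rw [Matrix.add_apply, (E.chain_Ω_eq_zero hunit le_rfl i j i.2).1, zero_add]
    simp
  rw [h1, Matrix.det_one, mul_one]
  exact prod_congr rfl fun i _ => if_pos i.2

end Det

/-! ### Chains of Darboux transformations -/

section Chain

variable {d : ℕ → Derivation ℂ R R} (hd : ∀ (i j : ℕ) (f : R), d i (d j f) = d j (d i f))

/-- The properties which are preserved along a chain of Darboux transformations: the wave function
`w e^ξ` satisfies the Sato equations with the operators `B k`, it is the wave function of `L` and
corresponds to the square `f` of the tau function, and `E` consists of eigenfunctions with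
symmetric potentials. -/
structure IsDarbouxData {n : ℕ} (d : ℕ → Derivation ℂ R R) (L : Psi (d 0)) (w : PowerSeries R)
    (B : ℕ → Psi (d 0)) (E : EigenData R n) (f : R) : Prop where
  sato : IsSato d (ser (d 0) w) B
  constantCoeff_eq : constantCoeff w = 1
  dressed : L * ser (d 0) w = ser (d 0) w * dpow (d 0) 1
  eigen : ∀ i k, d k (E.q i) = app (B k) (E.q i)
  potential : ∀ i j k, d k (E.Ω i j) = res (dpow (d 0) (-1) * fn (d 0) (E.q j) *
    (B k * (fn (d 0) (E.q i) * dpow (d 0) (-1))))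
  symm : E.Ω.IsSymm
  square : IsWaveOfSquare d f w

lemma fn_mul_ser {D : Derivation ℂ R R} (a : R) (u : PowerSeries R) :
    fn D a * ser D u = ser D (C a * u) := by
  ext p
  rw [coeff_fn_mul, coeff_ser, coeff_ser]
  split_ifs
  · rw [coeff_C_mul]
  · rw [mul_zero]

lemma ser_sub {D : Derivation ℂ R R} (u v : PowerSeries R) :
    ser D (u - v) = ser D u - ser D v := by
  ext p
  rw [Psi.coeff_sub, coeff_ser, coeff_ser, coeff_ser]
  split_ifs
  · rw [map_sub]
  · rw [sub_zero]

lemma darbouxOp_eq (D : Derivation ℂ R R) (q Ω : R) :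
    darbouxOp D q Ω = darbouxPsi D q (Ring.inverse Ω * q) := by
  rw [darbouxPsi, ← mono_eq]
  rfl

include hd

/-- A Darboux transformation multiplies the square of the tau function by `Ω(q_p, q_p)`. -/
lemma IsDarbouxData.step {n : ℕ} {L L' : Psi (d 0)} {w : PowerSeries R} {B : ℕ → Psi (d 0)}
    {E : EigenData R n} {f : R} (h : IsDarbouxData d L w B E f) (p : Fin n)
    (hp : IsUnit (E.Ω p p))
    (hL : L' * darbouxPsi (d 0) (E.q p) (Ring.inverse (E.Ω p p) * E.q p) =
      darbouxPsi (d 0) (E.q p) (Ring.inverse (E.Ω p p) * E.q p) * L) :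
    ∃ w' B', darbouxPsi (d 0) (E.q p) (Ring.inverse (E.Ω p p) * E.q p) * ser (d 0) w =
        ser (d 0) w' ∧ IsDarbouxData d L' w' B' (E.step p) (E.Ω p p * f) := by
  have hΩi := Ring.mul_inverse_cancel _ hp
  have hx : ∀ i j, d 0 (E.Ω i j) = E.q i * E.q j := fun i j => by
    rw [h.potential, h.sato.B_zero, res_integral_dpow]
  obtain ⟨χ, h1, h2, h3⟩ := exists_symbol_integral (E.q p) w h.constantCoeff_eq
  have hser : darbouxPsi (d 0) (E.q p) (Ring.inverse (E.Ω p p) * E.q p) * ser (d 0) w =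
      ser (d 0) (w - C (Ring.inverse (E.Ω p p) * E.q p) * X * χ) := by
    rw [darbouxPsi, sub_mul, one_mul, mul_assoc, mul_assoc, ← mul_assoc (dpow (d 0) (-1)), h1,
      fn_mul_ser, ser_sub, mul_assoc]
  have hB := fun k => h.sato.adj_B hd k
  have hcomm : ∀ k f, d k (d 0 f) = d 0 (d k f) := fun k f => hd k 0 f
  refine ⟨_, fun k => darbouxB (d k) (E.q p) (Ring.inverse (E.Ω p p) * E.q p) (B k), hser,
    ?_, ?_, ?_, fun i k => ?_, fun i j k => ?_, ?_, ?_⟩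
  · rw [← hser]
    exact h.sato.darboux hd hΩi (hx p p) (h.eigen p) (h.potential p p)
  · rw [map_sub, map_mul, map_mul, constantCoeff_X, h.constantCoeff_eq]
    simp
  · rw [← hser, ← mul_assoc, hL, mul_assoc, h.dressed, mul_assoc]
  · exact app_darbouxB (hcomm k) hΩi (h.sato.mem_Diff k) (hB k) (hx p p) (h.eigen p k)
      (h.potential p p k) (h.eigen i k) (hx i p) (h.potential i p k)
  · refine Eq.trans ?_ (res_darbouxB hΩi (hx p p) (hx i p) (hx j p)).symm
    rw [← h.potential, ← h.potential, ← h.potential, ← h.potential, E.step_Ω]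
    have e1 := congrArg (d k) hΩi
    have e2 : E.Ω j p = E.Ω p j := h.symm.apply p j
    rw [Derivation.leibniz, Derivation.map_one_eq_zero, smul_eq_mul, smul_eq_mul] at e1
    have e3 : d k (Ring.inverse (E.Ω p p)) =
        -(Ring.inverse (E.Ω p p) * Ring.inverse (E.Ω p p) * d k (E.Ω p p)) := by
      linear_combination Ring.inverse (E.Ω p p) * e1 - d k (Ring.inverse (E.Ω p p)) * hΩi
    simp only [map_sub, Derivation.leibniz, smul_eq_mul, e3, e2]
    ring
  · refine Matrix.IsSymm.ext fun i j => ?_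
    rw [E.step_Ω, E.step_Ω, h.symm.apply i j, h.symm.apply p j, h.symm.apply i p]
    ring
  · exact h.square.darboux hd h.sato h.constantCoeff_eq (h.eigen p) (h.potential p p)
      (by rw [hx, pow_two]) hΩi h1 h3 h2

omit hd in
lemma EigenData.chainDressing_succ {n : ℕ} (D : Derivation ℂ R R) (E : EigenData R n) (W : Psi D)
    (k : Fin n) : E.chainDressing D W (k + 1) =
      PseudoDiffOp.comp D (darbouxPsi D ((E.chain k).q k)
        (Ring.inverse ((E.chain k).Ω k k) * (E.chain k).q k)) (E.chainDressing D W k) := by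
  rw [← darbouxOp_eq]
  exact dif_pos k.2

lemma IsDarbouxData.chain {n : ℕ} {L : ℕ → Psi (d 0)} {w : PowerSeries R} {B : ℕ → Psi (d 0)}
    {E : EigenData R n} {f : R} (h : IsDarbouxData d (L 0) w B E f)
    (hunit : ∀ k : Fin n, IsUnit ((E.chain k).Ω k k))
    (hchain : ∀ k : Fin n, PseudoDiffOp.comp (d 0) (L (k + 1)) (E.chainOp (d 0) k) =
      PseudoDiffOp.comp (d 0) (E.chainOp (d 0) k) (L k)) (k : ℕ) (hk : k ≤ n) :
    ∃ w' B', E.chainDressing (d 0) (ser (d 0) w) k = ser (d 0) w' ∧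
      IsDarbouxData d (L k) w' B' (E.chain k)
        ((∏ i : Fin n, if (i : ℕ) < k then (E.chain i).Ω i i else 1) * f) := by
  induction k with
  | zero => exact ⟨w, B, rfl, by simpa [EigenData.chain] using h⟩
  | succ k ih =>
    obtain ⟨w₁, B₁, h1, h2⟩ := ih (by omega)
    set p : Fin n := ⟨k, hk⟩ with hp
    obtain ⟨w₂, B₂, h3, h4⟩ := h2.step hd (L' := L (k + 1)) p (hunit p) (by
      rw [← darbouxOp_eq]
      exact hchain p)
    refine ⟨w₂, B₂, ?_, ?_⟩
    · rw [← h3, ← h1]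
      exact E.chainDressing_succ (d 0) (ser (d 0) w) p
    · have h5 : E.chain (k + 1) = (E.chain k).step p := E.chain_succ p
      rw [E.prod_chain_succ p, h5]
      convert h4 using 1
      ring

end Chain

end CKP

end

theorem mainTheorem7 {R : Type*} [CommRing R] [Algebra ℂ R]
    -- `d k = ∂ / ∂ t_{2k+1}`, commuting derivations of the algebra `R` of functions of `t_o`
    (d : ℕ → Derivation ℂ R R)
    (hd : ∀ (i j : ℕ) (f : R), d i (d j f) = d j (d i f))
    -- a CKP tau function with its wave function `w e^ξ`
    (τ : R) (w : PowerSeries R) (hτ : CKP.IsCKPTau d τ w)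
    -- eigenfunctions and symmetric potentials for the Lax operator `L 0 = W ∂ W⁻¹`
    (n : ℕ) (E : CKP.EigenData R n) (L : ℕ → CKP.PseudoDiffOp R)
    (hL : CKP.IsDressedBy (d 0) (L 0) (CKP.PseudoDiffOp.ofSeries w))
    (hq : ∀ i, CKP.IsEigenfunction d (L 0) (E.q i))
    (hΩ : ∀ i j, CKP.IsSEP d (L 0) (E.q i) (E.q j) (E.Ω i j))
    (hsymm : E.Ω.IsSymm)
    -- the chain `L (k + 1) = T[q_k^{k}] (L k) T[q_k^{k}]⁻¹`, `k < n`, is defined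
    (hunit : ∀ k : Fin n, IsUnit ((E.chain k).Ω k k))
    (hchain : ∀ k : Fin n, CKP.PseudoDiffOp.comp (d 0) (L (k + 1)) (E.chainOp (d 0) k) =
      CKP.PseudoDiffOp.comp (d 0) (E.chainOp (d 0) k) (L k)) :
    -- it is a chain of CKP Lax operators, with transformed eigenfunctions and potentials
    (∀ k ≤ n, CKP.IsCKPLax d (L k) ∧
      (∀ i, CKP.IsEigenfunction d (L k) ((E.chain k).q i)) ∧
      (∀ i j, CKP.IsSEP d (L k) ((E.chain k).q i) ((E.chain k).q j) ((E.chain k).Ω i j)) ∧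
      (E.chain k).Ω.IsSymm) ∧
    -- the transformed wave function belongs to `L n`, and its tau function is `√(det Ω) τ`
    ∃ w' : PowerSeries R,
      E.chainDressing (d 0) (CKP.PseudoDiffOp.ofSeries w) n = CKP.PseudoDiffOp.ofSeries w' ∧
      CKP.IsDressedBy (d 0) (L n) (CKP.PseudoDiffOp.ofSeries w') ∧
      ∀ s : R, s ^ 2 = E.Ω.det →
        CKP.IsCKPTau d (s * τ) w' ∧
        ∀ τ' : R, CKP.IsCKPTau d τ' w' →
          ∃ c : R, IsUnit c ∧ (∀ k, d k c = 0) ∧ τ' = c * (s * τ) := by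
  obtain ⟨hτw, hbil⟩ := hτ
  have hw := ((CKP.isWaveOfTau_iff hd τ w).mp hτw).2.1
  have hsato := CKP.isSato_of_bilinear hd hw hbil
  have h0 : CKP.IsDarbouxData d (L 0) w _ E (τ ^ 2) :=
    { sato := hsato
      constantCoeff_eq := hw
      dressed := hL
      eigen := fun i k => by
        rw [hsato.B_eq hL]
        exact (CKP.isEigenfunction_iff (d := d) (L 0) (E.q i)).mp (hq i) k
      potential := fun i j k => by
        rw [hsato.B_eq hL]
        exact (CKP.isSEP_iff (d := d) (L 0) (E.q i) (E.q j) (E.Ω i j)).mp (hΩ i j) k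
      symm := hsymm
      square := hτw.isWaveOfSquare hd }
  have h1 := h0.chain hd (L := L) hunit hchain
  refine ⟨fun k hk => ?_, ?_⟩
  · obtain ⟨w', B, -, h⟩ := h1 k hk
    refine ⟨h.sato.isCKPLax hd h.dressed, fun i => ?_, fun i j => ?_, h.symm⟩
    · refine (CKP.isEigenfunction_iff (d := d) (L k) _).mpr fun m => ?_
      rw [h.eigen, h.sato.B_eq h.dressed]
    · refine (CKP.isSEP_iff (d := d) (L k) _ _ _).mpr fun m => ?_
      rw [h.potential, h.sato.B_eq h.dressed]
  · obtain ⟨w', B, h2, h⟩ := h1 n le_rfl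
    refine ⟨w', h2, h.dressed, fun s hs => ?_⟩
    have h3 : (∏ i : Fin n, if (i : ℕ) < n then (E.chain i).Ω i i else 1) * τ ^ 2 =
        (s * τ) ^ 2 := by
      rw [mul_pow, hs, E.det_eq_prod hunit]
      congr 1
      exact Finset.prod_congr rfl fun i _ => if_pos i.2
    have h4 : CKP.IsWaveOfTau d (s * τ) w' :=
      CKP.IsWaveOfSquare.isWaveOfTau hd h.constantCoeff_eq (h3 ▸ h.square)
    exact ⟨⟨h4, h.sato.bilinear hd⟩, fun τ' hτ' => h4.exists_eq_mul hd hτ'.1⟩
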